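/- Let $-\infty\le a<b\le\infty$, let $J$ be a constant, invertible, skew-Hermitian $n\times n$ matrix, and let $q$ and $w$ be $n\times n$ matrices whose entries are distributions of order $0$ on $(a,b)$, i.e. $q=Q'$ and $w=W'$ with $Q,W$ of locally bounded variation; let $q$ be Hermitian and $w$ non-negative. Assume that $a$ and $b$ are regular endpoints, i.e. $Q$ and $W$ are of bounded variation on $(a,c)$ and on $(c',b)$ for some $c,c'\in(a,b)$, so that $q$ and $w$ are finite matrix-valued measures on $(a,b)$. A superscript $\pm$ denotes right/left-hand limits. Put $\Delta_q=Q^+-Q^-$, $\Delta_w=W^+-W^-$ and $B_\pm(x,\lambda)=J\pm\frac12\big(\Delta_q(x)-\lambda\Delta_w(x)\big)$. Let $a=x_0<x_1<\dots<x_N<x_{N+1}=b$ be such that every $x\in(a,b)$ at which $B_+(x,0)$ or $B_-(x,0)$ is not invertible is among $x_1,\dots,x_N$, and let $\lambda\in\mathbb C$ be such that $B_\pm(x,\lambda)$ are both invertible for all $x\in(a,b)\setminus\{x_1,\dots,x_N\}$. A solution on an open interval means a balanced function $u$ (that is, $u=(u^++u^-)/2$) of locally bounded variation with values in $\mathbb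 C^n$ which satisfies the equation in the sense of distributions. For $0\le j\le N$ let $U_j(\cdot,\lambda)$ be the fundamental matrix of solutions of $Ju'+(q-\lambda w)u=0$ on $(x_j,x_{j+1})$ with $\lim_{x\downarrow x_j}U_j(x,\lambda)=\mathbb 1$, let $U_j(x_{j+1},\lambda)$ be its left-hand limit at $x_{j+1}$, and for $f$ with $\int f^*wf<\infty$ let $I_j(f,\lambda)=\int_{(x_j,x_{j+1})}U_j(\cdot,\overline\lambda)^*wf$. Define the block matrices and vectors $$\mathcal B(\lambda)=\operatorname{diag}\big(B_+(x_1,\lambda),\dots,B_+(x_N,\lambda)\big),\quad \mathcal U(\lambda)=\operatorname{diag}\big(U_0(x_1,\lambda),\dots,U_{N-1}(x_N,\lambda)\big),\quad \mathcal J=\operatorname{diag}(J,\dots,J),$$ $$\mathbb B(\lambda)=\mathcal B(\overline\lambda)^*\,\mathcal U(\lambda)E_\bot+\mathcal B(\lambda)E_\top\in\mathbb C^{nN\times n(N+1)},\qquad \mathcal F_0(f,\lambda)=\mathcal R(f)-\mathcal B(\overline\lambda)^*\,\mathcal U(\lambda)\mathcal J^{-1}\mathcal I(f,\lambda),$$ where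 $E_\top$ and $E_\bot$ strip the first and the last $n$ components, respectively, off a vector in $\mathbb C^{n(N+1)}$, where $\mathcal R(f)\in\mathbb C^{nN}$ has the blocks $\Delta_w(x_j)f(x_j)$, $1\le j\le N$, and where $\mathcal I(f,\lambda)\in\mathbb C^{nN}$ has the blocks $I_0(f,\lambda),\dots,I_{N-1}(f,\lambda)$. Then, for every $f$ with $\int f^*wf<\infty$, the equation $Ju'+(q-\lambda w)u=wf$ has a solution on $(a,b)$ if and only if $\mathbb B(\lambda)\tilde u=\mathcal F_0(f,\lambda)$ has a solution $\tilde u\in\mathbb C^{n(N+1)}$. More precisely, if $u$ is a solution of the differential equation, then the right-hand limits of $u$ at $x_0,\dots,x_N$ exist and $\tilde u=(u^+(x_0),\dots,u^+(x_N))$ solves the system; conversely, for every solution $\tilde u=(c_0,\dots,c_N)$ of the system there is exactly one solution $u$ of the differential equation with $u^+(x_j)=c_j$ for $j=0,\dots,N$. In the homogeneous case $f=0$ the solutions form a vector space of dimension $n(N+1)-\operatorname{rk}\mathbb B(\lambda)\ge n$. -/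

import Mathlib

open MeasureTheory Filter Topology Set
open scoped Matrix ComplexOrder ContDiff ComplexConjugate

noncomputable section

namespace MeasureODE

/-- The open interval of real numbers between two extended real numbers. -/
def ival (a b : EReal) : Set ℝ := {y : ℝ | a < (y : EReal) ∧ (y : EReal) < b}

/-- Approach to `e` from the right through real numbers; for `e = ⊥` this means `y → -∞`. -/
def rightNhds (e : EReal) : Filter ℝ := comap Real.toEReal (𝓝[>] e)

open Classical in
/-- The complex measure `dg` on the interval `I` generated by a function `g` which is of bounded
variation on `I`: `dg([s,t)) = g⁻(t) - g⁻(s)` for `s < t` in `I`, and there is no mass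
outside `I`. (If `g` is of bounded variation on `I`, its extension by zero is of bounded variation
on the real line, and atoms which this extension may have at the endpoints of `I` are removed.) -/
def stieltjes (I : Set ℝ) (g : ℝ → ℂ) : ComplexMeasure ℝ :=
  if h : BoundedVariationOn (I.indicator g) univ then h.vectorMeasure.restrict I else 0

/-- Matrices of finite complex measures on the real line. -/
abbrev MatMeasure (n : ℕ) := Fin n → Fin n → ComplexMeasure ℝ

namespace MatMeasure

variable {n : ℕ}

/-- The value of a matrix of measures at a set. -/
def val (μ : MatMeasure n) (E : Set ℝ) : Matrix (Fin n) (Fin n) ℂ := Matrix.of fun i k => μ i k E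

/-- A finite positive measure with respect to which all entries are absolutely continuous: the sum
of the total variations of the entries. -/
def ref (μ : MatMeasure n) : Measure ℝ := ∑ i, ∑ k, (μ i k).variation

/-- The density of the matrix of measures `μ` with respect to the positive measure `μ.ref`. -/
def dens (μ : MatMeasure n) (y : ℝ) : Matrix (Fin n) (Fin n) ℂ :=
  Matrix.of fun i k => (μ i k).rnDeriv μ.ref y

/-- The vector `∫ φ dμ g`: the distribution `μ g` applied to the test function `φ`. -/
def pair (μ : MatMeasure n) (g : ℝ → Fin n → ℂ) (φ : ℝ → ℝ) : Fin n → ℂ :=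
  ∫ y, φ y • (μ.dens y *ᵥ g y) ∂μ.ref

/-- `g ∈ 𝓛²(μ)` for a non-negative `μ`: `∫ g* dμ g < ∞`. -/
def MemL2 (μ : MatMeasure n) (g : ℝ → Fin n → ℂ) : Prop :=
  AEStronglyMeasurable g μ.ref ∧
    Integrable (fun y => (star (g y) ⬝ᵥ (μ.dens y *ᵥ g y)).re) μ.ref

end MatMeasure

/-- `u ∈ BV^#_loc(I)ⁿ`: on the open interval `I` the function `u` is of locally bounded variation
and is the average of its one-sided limits. Functions on `I` are extended by zero to the real
line, so that different elements are different as functions on `I`. -/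
def IsBalancedBV {n : ℕ} (I : Set ℝ) (u : ℝ → Fin n → ℂ) : Prop :=
  LocallyBoundedVariationOn u I ∧
    (∀ y ∈ I, u y = (1 / 2 : ℂ) • (Function.rightLim u y + Function.leftLim u y)) ∧
    ∀ y, y ∉ I → u y = 0

/-- `u` is a balanced solution of `Ju' + (q - z w)u = wf` on the open interval `I`, the equation
being one between distributions on `I`. -/
def IsSolution {n : ℕ} (J : Matrix (Fin n) (Fin n) ℂ) (q w : MatMeasure n) (z : ℂ)
    (f : ℝ → Fin n → ℂ) (I : Set ℝ) (u : ℝ → Fin n → ℂ) : Prop :=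
  IsBalancedBV I u ∧
    ∀ φ : ℝ → ℝ, ContDiff ℝ ∞ φ → HasCompactSupport φ → tsupport φ ⊆ I →
      -(∫ y, deriv φ y • (J *ᵥ u y)) + q.pair u φ - z • w.pair u φ = w.pair f φ

/-- The data of the equation `Ju' + (q - z w)u = wf` on `(a,b)`: the constant matrix `J`,
anti-derivatives `Q` and `W` of `q` and `w`, and the interior points
`x₁, …, x_N` of a partition of `(a,b)`. -/
structure Problem (n N : ℕ) where
  a : EReal
  b : EReal
  J : Matrix (Fin n) (Fin n) ℂ
  Q : ℝ → Matrix (Fin n) (Fin n) ℂ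
  W : ℝ → Matrix (Fin n) (Fin n) ℂ
  x : Fin N → ℝ

namespace Problem

variable {n N : ℕ} (P : Problem n N)

/-- The interval `(a,b)`. -/
def I : Set ℝ := ival P.a P.b

/-- `q` and `w` are distributions of order zero: their anti-derivatives are of locally bounded
variation on `(a,b)`. -/
def OrderZero : Prop :=
  ∀ i k, LocallyBoundedVariationOn (fun y => P.Q y i k) P.I ∧
    LocallyBoundedVariationOn (fun y => P.W y i k) P.I

/-- `a` is a regular endpoint. -/
def RegularLeft : Prop :=
  ∃ c ∈ P.I, ∀ i k, BoundedVariationOn (fun y => P.Q y i k) {y ∈ P.I | y < c} ∧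
    BoundedVariationOn (fun y => P.W y i k) {y ∈ P.I | y < c}

/-- `b` is a regular endpoint. -/
def RegularRight : Prop :=
  ∃ c ∈ P.I, ∀ i k, BoundedVariationOn (fun y => P.Q y i k) {y ∈ P.I | c < y} ∧
    BoundedVariationOn (fun y => P.W y i k) {y ∈ P.I | c < y}

/-- `q`, the derivative of `Q`, as a matrix of measures on `(a,b)`. -/
def q : MatMeasure n := fun i k => stieltjes P.I fun y => P.Q y i k

/-- `w`, the derivative of `W`, as a matrix of measures on `(a,b)`. -/
def w : MatMeasure n := fun i k => stieltjes P.I fun y => P.W y i k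

/-- `Δ_q(y) = Q⁺(y) - Q⁻(y)`. -/
def Δq (y : ℝ) : Matrix (Fin n) (Fin n) ℂ := Function.rightLim P.Q y - Function.leftLim P.Q y

/-- `Δ_w(y) = W⁺(y) - W⁻(y)`. -/
def Δw (y : ℝ) : Matrix (Fin n) (Fin n) ℂ := Function.rightLim P.W y - Function.leftLim P.W y

/-- `B₊(y,z) = J + (Δ_q(y) - z Δ_w(y)) / 2`. -/
def Bplus (y : ℝ) (z : ℂ) : Matrix (Fin n) (Fin n) ℂ := P.J + (1 / 2 : ℂ) • (P.Δq y - z • P.Δw y)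

/-- `B₋(y,z) = J - (Δ_q(y) - z Δ_w(y)) / 2`. -/
def Bminus (y : ℝ) (z : ℂ) : Matrix (Fin n) (Fin n) ℂ := P.J - (1 / 2 : ℂ) • (P.Δq y - z • P.Δw y)

/-- `Ξ_z`, the set of points of `(a,b)` at which `B₊(·,z)` or `B₋(·,z)` is not invertible. -/
def Ξ (z : ℂ) : Set ℝ := {y ∈ P.I | (P.Bplus y z).det * (P.Bminus y z).det = 0}

/-- `x₀ = a, x₁, …, x_N`. -/
def lend : Fin (N + 1) → EReal := Fin.cons P.a fun j => (P.x j : EReal)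

/-- `x₁, …, x_N, x_{N+1} = b`. -/
def rend : Fin (N + 1) → EReal :=
  Fin.snoc (α := fun _ => EReal) (fun j : Fin N => (P.x j : EReal)) P.b

/-- The interval `(x_j, x_{j+1})`, `0 ≤ j ≤ N`. -/
def cell (j : Fin (N + 1)) : Set ℝ := ival (P.lend j) (P.rend j)

/-- `U` is the fundamental matrix of balanced solutions of `Ju' + (q - z w)u = 0` on
`(x_j, x_{j+1})` whose right limit at `x_j` is the identity. -/
def IsFundamental (j : Fin (N + 1)) (z : ℂ) (U : ℝ → Matrix (Fin n) (Fin n) ℂ) : Prop :=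
  (∀ l, IsSolution P.J P.q P.w z 0 (P.cell j) fun y i => U y i l) ∧
    Tendsto U (rightNhds (P.lend j)) (𝓝 1)

open Classical in
/-- The fundamental matrix `U_j(·,z)`. -/
def U (j : Fin (N + 1)) (z : ℂ) : ℝ → Matrix (Fin n) (Fin n) ℂ :=
  if h : ∃ V, P.IsFundamental j z V then h.choose else 0

/-- `I_j(f,z) = ∫_{(x_j,x_{j+1})} U_j(·,z̄)* w f`. -/
def int (f : ℝ → Fin n → ℂ) (z : ℂ) (j : Fin (N + 1)) : Fin n → ℂ :=
  ∫ y in P.cell j, (P.U j (conj z) y)ᴴ *ᵥ (P.w.dens y *ᵥ f y) ∂P.w.ref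

/-- The block-diagonal matrix `diag(B₊(x₁,z), …, B₊(x_N,z))`. The index `(i, j)` stands for the
component `i` in block `j`. -/
def calB (z : ℂ) : Matrix (Fin n × Fin N) (Fin n × Fin N) ℂ :=
  Matrix.blockDiagonal fun j => P.Bplus (P.x j) z

/-- The block-diagonal matrix `diag(U₀(x₁,z), …, U_{N-1}(x_N,z))` of left limits. -/
def calU (z : ℂ) : Matrix (Fin n × Fin N) (Fin n × Fin N) ℂ :=
  Matrix.blockDiagonal fun j => Function.leftLim (P.U j.castSucc z) (P.x j)

/-- The block-diagonal matrix `diag(J, …, J)`. -/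
def calJ : Matrix (Fin n × Fin N) (Fin n × Fin N) ℂ :=
  Matrix.blockDiagonal fun _ => P.J

/-- The matrix which strips off the first `n` components of a vector in `ℂ^{n(N+1)}`. -/
def Etop (n N : ℕ) : Matrix (Fin n × Fin N) (Fin n × Fin (N + 1)) ℂ :=
  Matrix.of fun r s => if s = (r.1, r.2.succ) then 1 else 0

/-- The matrix which strips off the last `n` components of a vector in `ℂ^{n(N+1)}`. -/
def Ebot (n N : ℕ) : Matrix (Fin n × Fin N) (Fin n × Fin (N + 1)) ℂ :=
  Matrix.of fun r s => if s = (r.1, r.2.castSucc) then 1 else 0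

/-- The matrix `𝔹(z)` of the block system. -/
def bbB (z : ℂ) : Matrix (Fin n × Fin N) (Fin n × Fin (N + 1)) ℂ :=
  (P.calB (conj z))ᴴ * P.calU z * Ebot n N + P.calB z * Etop n N

/-- The vector `((Δ_w f)(x₁), …, (Δ_w f)(x_N))`. -/
def calR (f : ℝ → Fin n → ℂ) : Fin n × Fin N → ℂ :=
  fun r => (P.Δw (P.x r.2) *ᵥ f (P.x r.2)) r.1

/-- The vector `(I₀(f,z), …, I_{N-1}(f,z))`. -/
def calI (f : ℝ → Fin n → ℂ) (z : ℂ) : Fin n × Fin N → ℂ :=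
  fun r => P.int f z r.2.castSucc r.1

/-- The right-hand side `𝓕₀(f,z)` of the block system. -/
def calF (f : ℝ → Fin n → ℂ) (z : ℂ) : Fin n × Fin N → ℂ :=
  P.calR f - ((P.calB (conj z))ᴴ * P.calU z * (P.calJ)⁻¹) *ᵥ P.calI f z

/-- `c = (u⁺(x₀), …, u⁺(x_N))`. -/
def HasRightLimits (u : ℝ → Fin n → ℂ) (c : Fin n × Fin (N + 1) → ℂ) : Prop :=
  ∀ j, Tendsto u (rightNhds (P.lend j)) (𝓝 fun i => c (i, j))

/-- `u` is a solution of `Ju' + (q - z w)u = wf` on `(a,b)`. -/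
def Solves (z : ℂ) (f u : ℝ → Fin n → ℂ) : Prop := IsSolution P.J P.q P.w z f P.I u

end Problem

end MeasureODE

end

noncomputable section

namespace MeasureODE

/-! ### Volterra equations with respect to a finite measure -/

section Volterra

/-! Fix a finite measure ν that dominates q and w and charges every x_j (`Problem.dom`). Let A be
the ν-density of J⁻¹(zw − q) and g that of J⁻¹wf. A solution is then a balanced primitive u of an
integrable density G with G = Au + g (`isSolution_iff`). Regularity of the endpoints enters here: A
and g are integrable over all of (a,b), so a linear inequality bounds u up to both ends, and the
equation can be integrated starting from a. In particular u⁺ exists at every x_j, including x₀ = a.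

At an atom y one has u = u⁻ + (ν{y}/2)G, so u(y) is recovered from u⁻(y) when 1 − (ν{y}/2)A = J⁻¹B₊
is invertible. Away from the interior points x_j this turns the equation into a Volterra equation
for u⁻ with an integrable coefficient; its iterates decay factorially (`exists_volterra`,
`eq_zero_of_volterra`). At an interior x_j, where B₊ may be singular, the equation is dropped and
u⁺(x_j) = c_j is imposed instead. This is again a Volterra term, namely G = (c_j − u⁻)/ν{x_j}. Hence
every vector (c_0, …, c_N) is realised by a function satisfying the equation off the x_j
(`exists_solution_off_finite`), and a true solution is determined by its vector
(`IsSolution.eq_of_tendsto`).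

What remains is the equation at the interior points, B₊u⁺ − B₋u⁻ = Δ_w f. Lagrange's identity
between u and the columns of the fundamental matrix at z̄ gives variation of constants on a cell:
the left limit at its right end is U(c + J⁻¹I), with c the right limit at its left end and I the
integral of the cell (`lagrange_identity`, `IsFundamentalOn.add_setIntegral_eq`). Since B₊(·, z̄)* =
−B₋(·, z), the N equations are precisely the block rows of the system
(`Problem.Admissible.bbB_mulVec_limits_eq_calF_iff`). For f = 0 the solution space is thereby
isomorphic to ker 𝔹, and the dimension bound holds because 𝔹 has only nN rows. -/

theorem measure_inter_le_measure_Iio_le (μ : Measure ℝ) [IsFiniteMeasure μ] (t τ : ℝ) :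
    μ (Iio t ∩ {s | τ ≤ μ.real (Iio s)}) ≤ ENNReal.ofReal (μ.real (Iio t) - τ) := by
  have hmono : Monotone fun s => μ.real (Iio s) := fun a b h =>
    measureReal_mono (Iio_subset_Iio h)
  have hm : MeasurableSet (Iio t ∩ {s | τ ≤ μ.real (Iio s)}) :=
    measurableSet_Iio.inter (measurableSet_le measurable_const hmono.measurable)
  -- The infimum of the set need not be attained. By inner regularity a compact K may be taken
  -- instead; its least point s gives K ⊆ [s, t).
  rw [hm.measure_eq_iSup_isCompact]
  refine iSup₂_le fun K hK => iSup_le fun hc => ?_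
  rcases K.eq_empty_or_nonempty with rfl | hne
  · simp
  obtain ⟨s, hs, hmin⟩ := hc.exists_isLeast hne
  have hst : s < t := (hK hs).1
  calc μ K ≤ μ (Ico s t) := measure_mono fun y hy => ⟨hmin hy, (hK hy).1⟩
    _ = ENNReal.ofReal (μ.real (Ico s t)) := by simp
    _ = ENNReal.ofReal (μ.real (Iio t) - μ.real (Iio s)) := by
        congr 1
        have : Ico s t = Iio t \ Iio s := by ext y; simp
        rw [this, measureReal_sdiff (Iio_subset_Iio hst.le) measurableSet_Iio]
    _ ≤ _ := ENNReal.ofReal_le_ofReal (sub_le_sub_left (hK hs).2 _)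

/-- This is the inequality (k+1)∫Fᵏ dF ≤ Fᵏ⁺¹ for the left-continuous distribution function F; atoms
only help, since F(s) excludes the mass at s. By the layer-cake formula the integral reduces to
∫₀^{F(t)} (F(t) − τ) kτᵏ⁻¹ dτ for k ≥ 1. -/
theorem lintegral_measure_Iio_pow_le (μ : Measure ℝ) [IsFiniteMeasure μ] (k : ℕ) (t : ℝ) :
    (k + 1) * ∫⁻ s in Iio t, μ (Iio s) ^ k ∂μ ≤ μ (Iio t) ^ (k + 1) := by
  have hmono : Monotone fun s => μ.real (Iio s) := fun a b h =>
    measureReal_mono (Iio_subset_Iio h)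
  rcases k with _ | j
  · simp
  have key := lintegral_comp_eq_lintegral_meas_le_mul (f := fun s => μ.real (Iio s))
    (g := fun τ => (j + 1) * τ ^ j) (μ.restrict (Iio t))
    (Eventually.of_forall fun s => measureReal_nonneg) hmono.measurable.aemeasurable
    (fun τ _ => (by fun_prop : Continuous fun τ : ℝ => (j + 1) * τ ^ j).intervalIntegrable _ _)
    (by filter_upwards [ae_restrict_mem measurableSet_Ioi] with τ hτ
        have : (0 : ℝ) < τ := hτ
        positivity)
  have h1 : ∀ x : ℝ, ∫ τ in (0 : ℝ)..x, ((j : ℝ) + 1) * τ ^ j = x ^ (j + 1) := fun x => by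
    have : ((j : ℝ) + 1) ≠ 0 := by positivity
    rw [intervalIntegral.integral_const_mul, integral_pow]
    field_simp
    simp
  simp only [h1] at key
  have h2 : ∀ s, ENNReal.ofReal (μ.real (Iio s) ^ (j + 1)) = μ (Iio s) ^ (j + 1) := fun s => by
    rw [ENNReal.ofReal_pow measureReal_nonneg]; simp
  simp only [h2] at key
  set F := μ.real (Iio t) with hF
  have hF0 : 0 ≤ F := measureReal_nonneg
  have h3 : ∫⁻ s in Iio t, μ (Iio s) ^ (j + 1) ∂μ ≤
      ∫⁻ τ in Ioi (0 : ℝ), ENNReal.ofReal (F - τ) * ENNReal.ofReal ((j + 1) * τ ^ j) := by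
    rw [key]
    refine lintegral_mono fun τ => ?_
    gcongr
    rw [Measure.restrict_apply (measurableSet_le measurable_const hmono.measurable), inter_comm]
    exact measure_inter_le_measure_Iio_le μ t τ
  have h4 : ∫⁻ τ in Ioi (0 : ℝ), ENNReal.ofReal (F - τ) * ENNReal.ofReal ((j + 1) * τ ^ j) =
      ENNReal.ofReal (F ^ (j + 2) / (j + 2)) := by
    have e1 : ∫⁻ τ in Ioi (0 : ℝ), ENNReal.ofReal (F - τ) * ENNReal.ofReal ((j + 1) * τ ^ j) =
        ∫⁻ τ in Ioc (0 : ℝ) F, ENNReal.ofReal ((F - τ) * ((j + 1) * τ ^ j)) := by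
      rw [← Ioc_union_Ioi_eq_Ioi hF0, lintegral_union measurableSet_Ioi
        (Set.disjoint_left.2 fun y hy hy' => not_lt.2 hy.2 hy')]
      rw [setLIntegral_congr_fun (s := Ioi F) (g := fun _ => 0) measurableSet_Ioi
        (fun τ hτ => by
          have : F < τ := hτ
          simp [ENNReal.ofReal_of_nonpos (sub_nonpos.2 this.le)])]
      simp only [lintegral_zero, add_zero]
      refine setLIntegral_congr_fun measurableSet_Ioc fun τ hτ => ?_
      exact (ENNReal.ofReal_mul (sub_nonneg.2 hτ.2)).symm
    have hc : Continuous fun τ : ℝ => (F - τ) * ((j + 1) * τ ^ j) := by fun_prop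
    rw [e1, ← ofReal_integral_eq_lintegral_ofReal hc.integrableOn_Ioc
      (by filter_upwards [ae_restrict_mem measurableSet_Ioc] with τ hτ
          have := hτ.1
          exact mul_nonneg (sub_nonneg.2 hτ.2) (by positivity)),
      ← intervalIntegral.integral_of_le hF0]
    congr 1
    have : ∀ τ : ℝ, (F - τ) * ((j + 1) * τ ^ j) = (F * (j + 1)) * τ ^ j - (j + 1) * τ ^ (j + 1) :=
      fun τ => by ring
    simp only [this]
    rw [intervalIntegral.integral_sub (Continuous.intervalIntegrable (by fun_prop) _ _)
      (Continuous.intervalIntegrable (by fun_prop) _ _), intervalIntegral.integral_const_mul,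
      intervalIntegral.integral_const_mul, integral_pow, integral_pow]
    have h5 : ((j : ℝ) + 1) ≠ 0 := by positivity
    have h6 : ((j : ℝ) + 2) ≠ 0 := by positivity
    push_cast
    have h7 : ((j : ℝ) + 1 + 1) ≠ 0 := by positivity
    field_simp
    simp
    ring
  calc ((j + 1 : ℕ) + 1 : ENNReal) * ∫⁻ s in Iio t, μ (Iio s) ^ (j + 1) ∂μ
      ≤ ((j + 1 : ℕ) + 1 : ENNReal) * ENNReal.ofReal (F ^ (j + 2) / (j + 2)) := by
        gcongr; exact h3.trans h4.le
    _ = ENNReal.ofReal (F ^ (j + 2)) := by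
        have : ((j + 1 : ℕ) + 1 : ENNReal) = ENNReal.ofReal (j + 2) := by
          rw [ENNReal.ofReal_add (by positivity) (by positivity)]
          simp; ring
        rw [this, ← ENNReal.ofReal_mul (by positivity)]
        congr 1
        field_simp
    _ = μ (Iio t) ^ (j + 1 + 1) := by
        rw [ENNReal.ofReal_pow hF0]; simp [hF]

variable {E : Type*} [NormedAddCommGroup E] [NormedSpace ℝ E]

/-- One step of the Volterra iteration gains a factor `Φ / (k + 1)`, where `Φ` is the distribution
function of `‖A‖ μ`. -/
theorem enorm_volterra_le {μ : Measure ℝ} {A : ℝ → E →L[ℝ] E} (hA : Integrable A μ) {C : ENNReal}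
    {k : ℕ} {d : ℝ → E}
    (hd : ∀ t, (k.factorial : ENNReal) * ‖d t‖ₑ ≤
      C * (μ.withDensity fun s => ‖A s‖ₑ) (Iio t) ^ k) (t : ℝ) :
    ((k + 1).factorial : ENNReal) * ‖∫ s in Iio t, A s (d s) ∂μ‖ₑ ≤
      C * (μ.withDensity fun s => ‖A s‖ₑ) (Iio t) ^ (k + 1) := by
  set ρ := μ.withDensity fun s => ‖A s‖ₑ
  have : IsFiniteMeasure ρ := isFiniteMeasure_withDensity hA.2.ne
  have hm : Measurable fun s => ρ (Iio s) :=
    Monotone.measurable fun a b h => measure_mono (Iio_subset_Iio h)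
  calc ((k + 1).factorial : ENNReal) * ‖∫ s in Iio t, A s (d s) ∂μ‖ₑ
      ≤ ((k + 1).factorial : ENNReal) * ∫⁻ s in Iio t, ‖A s (d s)‖ₑ ∂μ := by
        gcongr; exact enorm_integral_le_lintegral_enorm _
    _ ≤ ((k + 1).factorial : ENNReal) * ∫⁻ s in Iio t, ‖A s‖ₑ * ‖d s‖ₑ ∂μ := by
        gcongr with s; exact (A s).le_opENorm _
    _ = (k + 1) * ∫⁻ s in Iio t, ‖A s‖ₑ * (k.factorial * ‖d s‖ₑ) ∂μ := by
        rw [Nat.factorial_succ, Nat.cast_mul, mul_assoc,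
          ← lintegral_const_mul' _ _ (ENNReal.natCast_ne_top _)]
        push_cast
        congr 2
        ext s
        ring
    _ ≤ (k + 1) * ∫⁻ s in Iio t, ‖A s‖ₑ * (C * ρ (Iio s) ^ k) ∂μ := by
        refine mul_le_mul_right (lintegral_mono fun s => mul_le_mul_right (hd s) _) _
    _ = (k + 1) * ∫⁻ s in Iio t, C * ρ (Iio s) ^ k ∂ρ := by
        rw [restrict_withDensity measurableSet_Iio, lintegral_withDensity_eq_lintegral_mul₀
          hA.1.enorm.restrict ((hm.pow_const k).const_mul C).aemeasurable]
        rfl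
    _ = C * ((k + 1) * ∫⁻ s in Iio t, ρ (Iio s) ^ k ∂ρ) := by
        rw [lintegral_const_mul _ (hm.pow_const k)]; ring
    _ ≤ C * ρ (Iio t) ^ (k + 1) := by
        gcongr; exact lintegral_measure_Iio_pow_le ρ k t

theorem norm_le_of_factorial_mul_enorm_le {F : Type*} [NormedAddCommGroup F] {ρ : Measure ℝ}
    [IsFiniteMeasure ρ] {C : NNReal} {k : ℕ}
    {x : F} {t : ℝ} (h : (k.factorial : ENNReal) * ‖x‖ₑ ≤ C * ρ (Iio t) ^ k) :
    ‖x‖ ≤ C * (ρ.real univ ^ k / k.factorial) := by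
  have h1 : (k.factorial : ENNReal) * ‖x‖ₑ ≤ C * ρ univ ^ k :=
    h.trans (by gcongr; exact subset_univ _)
  have h2 := ENNReal.toReal_mono (by finiteness) h1
  simp only [ENNReal.toReal_mul, ENNReal.toReal_natCast, toReal_enorm, ENNReal.coe_toReal,
    ENNReal.toReal_pow] at h2
  rw [← mul_div_assoc, le_div_iff₀ (by positivity), mul_comm]
  exact h2

/-- A bounded solution of the homogeneous Volterra equation vanishes. -/
theorem eq_zero_of_volterra {μ : Measure ℝ} {A : ℝ → E →L[ℝ] E}
    (hA : Integrable A μ) {y : ℝ → E} {C : NNReal} (hC : ∀ t, ‖y t‖ ≤ C)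
    (hy : ∀ t, y t = ∫ s in Iio t, A s (y s) ∂μ) (t : ℝ) : y t = 0 := by
  have : IsFiniteMeasure (μ.withDensity fun s => ‖A s‖ₑ) := isFiniteMeasure_withDensity hA.2.ne
  have hk : ∀ k : ℕ, ∀ t, (k.factorial : ENNReal) * ‖y t‖ₑ ≤
      C * (μ.withDensity fun s => ‖A s‖ₑ) (Iio t) ^ k := by
    intro k
    induction k with
    | zero =>
      intro t
      simpa [enorm_le_coe, ← NNReal.coe_le_coe] using hC t
    | succ k ih =>
      intro t
      rw [hy t]
      exact enorm_volterra_le hA ih t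
  have hlim := ((Real.summable_pow_div_factorial
    ((μ.withDensity fun s => ‖A s‖ₑ).real univ)).tendsto_atTop_zero).const_mul (C : ℝ)
  rw [mul_zero] at hlim
  have := ge_of_tendsto' hlim fun k => norm_le_of_factorial_mul_enorm_le (hk k t)
  exact norm_le_zero_iff.1 this

theorem stronglyMeasurable_setIntegral_Iio (μ : Measure ℝ) [SFinite μ] {f : ℝ → E}
    (hf : AEStronglyMeasurable f μ) : StronglyMeasurable fun t => ∫ s in Iio t, f s ∂μ := by
  have h1 : (fun t => ∫ s in Iio t, f s ∂μ) =
      fun t => ∫ s, (Iio t).indicator (hf.mk f) s ∂μ := by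
    ext t
    rw [integral_indicator measurableSet_Iio]
    exact integral_congr_ae (ae_restrict_of_ae hf.ae_eq_mk)
  rw [h1]
  have h2 : StronglyMeasurable fun p : ℝ × ℝ => {p : ℝ × ℝ | p.2 < p.1}.indicator
      (fun p => hf.mk f p.2) p :=
    (hf.stronglyMeasurable_mk.comp_measurable measurable_snd).indicator
      (measurableSet_lt measurable_snd measurable_fst)
  exact h2.integral_prod_right'

theorem integrable_clm_apply {α : Type*} [MeasurableSpace α] {μ : Measure α}
    {A : α → E →L[ℝ] E} (hA : Integrable A μ) {y : α → E}
    (hy : AEStronglyMeasurable y μ) {C : ℝ} (hC : ∀ᵐ t ∂μ, ‖y t‖ ≤ C) :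
    Integrable (fun t => A t (y t)) μ := by
  refine (hA.norm.mul_const C).mono' ?_ ?_
  · exact (ContinuousLinearMap.id ℝ (E →L[ℝ] E)).aestronglyMeasurable_comp₂ hA.1 hy
  · filter_upwards [hC] with t ht
    exact (A t).le_opNorm_of_le ht

/-- The Volterra equation `y(t) = h(t) + ∫_{(-∞,t)} A y dμ` has a bounded solution. -/
theorem exists_volterra [CompleteSpace E] {μ : Measure ℝ} [IsFiniteMeasure μ] {A : ℝ → E →L[ℝ] E}
    (hA : Integrable A μ) {h : ℝ → E} (hm : StronglyMeasurable h) {C : NNReal}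
    (hC : ∀ t, ‖h t‖ ≤ C) :
    ∃ y : ℝ → E, StronglyMeasurable y ∧ (∃ C' : ℝ, ∀ t, ‖y t‖ ≤ C') ∧
      ∀ t, y t = h t + ∫ s in Iio t, A s (y s) ∂μ := by
  set ρ := μ.withDensity fun s => ‖A s‖ₑ with hρ
  have : IsFiniteMeasure ρ := isFiniteMeasure_withDensity hA.2.ne
  -- The `d k` are the increments of the Picard iteration; their sum is the solution.
  set d : ℕ → ℝ → E := fun k => Nat.rec h (fun _ f t => ∫ s in Iio t, A s (f s) ∂μ) k with hd
  have d0 : d 0 = h := rfl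
  have dS : ∀ k, d (k + 1) = fun t => ∫ s in Iio t, A s (d k s) ∂μ := fun k => rfl
  have hk : ∀ k : ℕ, ∀ t, (k.factorial : ENNReal) * ‖d k t‖ₑ ≤ C * ρ (Iio t) ^ k := by
    intro k
    induction k with
    | zero =>
      intro t
      simpa [enorm_le_coe, ← NNReal.coe_le_coe, d0] using hC t
    | succ k ih =>
      intro t
      exact enorm_volterra_le hA ih t
  have hn : ∀ k t, ‖d k t‖ ≤ C * (ρ.real univ ^ k / k.factorial) := fun k t =>
    norm_le_of_factorial_mul_enorm_le (hk k t)
  have hsum : Summable fun k : ℕ => (C : ℝ) * (ρ.real univ ^ k / k.factorial) :=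
    (Real.summable_pow_div_factorial _).mul_left _
  have hmeas : ∀ k, StronglyMeasurable (d k) := by
    intro k
    induction k with
    | zero => exact hm
    | succ k ih =>
      rw [dS]
      exact stronglyMeasurable_setIntegral_Iio μ (integrable_clm_apply hA ih.aestronglyMeasurable
        (Eventually.of_forall (hn k))).1
  have hs : ∀ t, Summable fun k => d k t := fun t => hsum.of_norm_bounded (hn · t)
  refine ⟨fun t => ∑' k, d k t, ?_, ⟨∑' k : ℕ, (C : ℝ) * (ρ.real univ ^ k / k.factorial), fun t =>
    tsum_of_norm_bounded hsum.hasSum (hn · t)⟩, fun t => ?_⟩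
  · refine stronglyMeasurable_of_tendsto atTop (f := fun m t => ∑ k ∈ Finset.range m, d k t)
      (fun m => Finset.stronglyMeasurable_fun_sum _ fun k _ => hmeas k) ?_
    rw [tendsto_pi_nhds]
    exact fun t => (hs t).hasSum.tendsto_sum_nat
  · have hi : ∀ k, Integrable (fun s => A s (d k s)) (μ.restrict (Iio t)) := fun k =>
      (integrable_clm_apply hA (hmeas k).aestronglyMeasurable
        (Eventually.of_forall (hn k))).integrableOn
    have h1 := hasSum_integral_of_summable_integral_norm hi (by
      refine Summable.of_nonneg_of_le (fun k => integral_nonneg fun _ => norm_nonneg _)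
          (fun k => ?_)
        (hsum.mul_left (∫ s in Iio t, ‖A s‖ ∂μ))
      rw [← integral_mul_const]
      exact integral_mono (hi k).norm (hA.norm.integrableOn.mul_const _) fun s =>
        (A s).le_opNorm_of_le (hn k s))
    have h2 : ∀ s, ∑' k, A s (d k s) = A s (∑' k, d k s) := fun s =>
      ((A s).map_tsum (hs s)).symm
    simp only [h2] at h1
    change ∑' k, d k t = _
    rw [← h1.tsum_eq, (hs t).tsum_eq_zero_add]
    rfl

end Volterra

/-! ### The integrated linear equation: existence and uniqueness -/

section Balanced

variable {E : Type*} [NormedAddCommGroup E] [NormedSpace ℝ E]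

/-- The balanced representative of `ξ + ∫_{(-∞,t)} G dμ`. -/
def bal (μ : Measure ℝ) (ξ : E) (G : ℝ → E) (t : ℝ) : E :=
  ξ + ∫ s in Iio t, G s ∂μ + (μ.real {t} / 2) • G t

/-- On a countable set every function is almost everywhere measurable, because it is so for a point
mass. This allows values at atoms to be altered without further thought. -/
theorem aestronglyMeasurable_of_eqOn_compl_countable {F : Type*} [TopologicalSpace F]
    [TopologicalSpace.PseudoMetrizableSpace F] {μ : Measure ℝ} {f g : ℝ → F}
    {Z : Set ℝ} (hZ : Z.Countable) (hg : AEStronglyMeasurable g μ) (h : ∀ y ∉ Z, f y = g y) :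
    AEStronglyMeasurable f μ := by
  have h1 : AEStronglyMeasurable f (μ.restrict Zᶜ) :=
    hg.restrict.congr (by
      filter_upwards [ae_restrict_mem hZ.measurableSet.compl] with y hy using (h y hy).symm)
  have h2 : AEStronglyMeasurable f (μ.restrict Z) := by
    have : Countable Z := hZ.to_subtype
    rw [← biUnion_of_singleton Z, biUnion_eq_iUnion, aestronglyMeasurable_iUnion_iff]
    intro y
    rw [Measure.restrict_singleton]
    exact aestronglyMeasurable_dirac.smul_measure _
  have h3 := aestronglyMeasurable_union_iff.2 ⟨h2, h1⟩
  rwa [union_compl_self, Measure.restrict_univ] at h3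

theorem countable_measureReal_singleton_ne_zero (μ : Measure ℝ) [IsFiniteMeasure μ] :
    {y | μ.real {y} ≠ 0}.Countable := by
  refine (Measure.countable_meas_pos_of_disjoint_iUnion (μ := μ) (As := fun y : ℝ => {y})
    (fun y => measurableSet_singleton y) fun a b hab => by simpa using hab).mono fun y hy => ?_
  by_contra hc
  have h0 : μ {y} = 0 := by simpa using hc
  exact hy (by simp [measureReal_def, h0])

/-- The inverse of `1 - μ{y}/2 A(y)`. -/
def atomInv (μ : Measure ℝ) (A : ℝ → E →L[ℝ] E) (y : ℝ) : E →L[ℝ] E :=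
  Ring.inverse (1 - (μ.real {y} / 2) • A y)

/-- The finite measure ‖A‖μ has only finitely many atoms of mass at least 1, and finitely many norms
are bounded whatever `Ring.inverse` returns there. At all other points ‖(μ{y}/2)A(y)‖ ≤ 1/2 and the
inverse has norm at most 2. -/
theorem exists_norm_atomInv_le [CompleteSpace E] {μ : Measure ℝ} [IsFiniteMeasure μ]
    {A : ℝ → E →L[ℝ] E} (hA : Integrable A μ) : ∃ C : ℝ, ∀ y, ‖atomInv μ A y‖ ≤ C := by
  set ρ := μ.withDensity fun s => ‖A s‖ₑ with hρ
  have : IsFiniteMeasure ρ := isFiniteMeasure_withDensity hA.2.ne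
  have hfin : {y : ℝ | 1 ≤ ρ {y}}.Finite :=
    Measure.finite_const_le_meas_of_disjoint_iUnion ρ zero_lt_one (As := fun y : ℝ => {y})
      (fun y => measurableSet_singleton y) (fun a b hab => by simpa using hab)
      (measure_ne_top _ _)
  obtain ⟨C, hC⟩ := (hfin.image fun y => ‖atomInv μ A y‖).bddAbove
  refine ⟨max 2 C, fun y => ?_⟩
  by_cases hy : 1 ≤ ρ {y}
  · exact (hC ⟨y, hy, rfl⟩).trans (le_max_right _ _)
  refine le_trans ?_ (le_max_left _ _)
  set T : E →L[ℝ] E := (μ.real {y} / 2) • A y with hT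
  have h1 : ρ {y} = ‖A y‖ₑ * μ {y} := by
    rw [hρ, withDensity_apply _ (measurableSet_singleton y), lintegral_singleton]
  have h2 : ‖A y‖ * μ.real {y} ≤ 1 := by
    have := ENNReal.toReal_mono ENNReal.one_ne_top (not_le.1 hy).le
    rwa [h1, ENNReal.toReal_mul, toReal_enorm, ENNReal.toReal_one] at this
  have h3 : ‖T‖ ≤ 1 / 2 := by
    rw [hT, norm_smul, Real.norm_of_nonneg (by positivity)]
    linarith
  have h4 : IsUnit (1 - T) := isUnit_one_sub_of_norm_lt_one (by linarith)
  -- From R(1 − T) = 1 follows R = 1 + RT, so ‖R‖ ≤ 1 + ‖R‖/2.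
  have h5 : atomInv μ A y = 1 + atomInv μ A y * T := by
    have := Ring.inverse_mul_cancel _ h4
    rw [mul_sub, mul_one, sub_eq_iff_eq_add] at this
    exact this
  have h6 : ‖(1 : E →L[ℝ] E)‖ ≤ 1 := ContinuousLinearMap.norm_id_le
  have h7 : ‖atomInv μ A y‖ ≤ 1 + ‖atomInv μ A y‖ * (1 / 2) := by
    calc ‖atomInv μ A y‖ = ‖1 + atomInv μ A y * T‖ := by rw [← h5]
      _ ≤ 1 + ‖atomInv μ A y‖ * ‖T‖ := (norm_add_le _ _).trans (add_le_add h6 (norm_mul_le _ _))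
      _ ≤ _ := by gcongr
  linarith

theorem atomInv_eq_one {μ : Measure ℝ} {A : ℝ → E →L[ℝ] E} {y : ℝ} (hy : μ.real {y} = 0) :
    atomInv μ A y = 1 := by simp [atomInv, hy]

open Classical in
/-- The coefficient of the Volterra equation for the left limits of a solution `u` of
`du = A u dμ`, where the right limits of `u` at the points of `D` are to vanish. -/
def feedback (μ : Measure ℝ) (A : ℝ → E →L[ℝ] E) (D : Set ℝ) (y : ℝ) : E →L[ℝ] E :=
  if y ∈ D then -((μ.real {y})⁻¹ • (1 : E →L[ℝ] E)) else A y * atomInv μ A y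

theorem integrable_of_eqOn_compl_finite {F : Type*} [NormedAddCommGroup F] {μ : Measure ℝ}
    [IsFiniteMeasure μ] {f g : ℝ → F} {D : Set ℝ} (hD : D.Finite) (hg : Integrable g μ)
    (h : ∀ y ∉ D, f y = g y) : Integrable f μ := by
  have hm : AEStronglyMeasurable f μ :=
    aestronglyMeasurable_of_eqOn_compl_countable hD.countable hg.1 h
  obtain ⟨C, hC⟩ := (hD.image fun y => ‖f y‖).bddAbove
  refine (hg.norm.add (integrable_const |C|)).mono' hm (Eventually.of_forall fun y => ?_)
  by_cases hy : y ∈ D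
  · have := hC ⟨y, hy, rfl⟩
    simp only at this
    have := norm_nonneg (g y)
    have := le_abs_self C
    simp only [Pi.add_apply]
    linarith
  · simp [h y hy]

theorem integrable_feedback [CompleteSpace E] {μ : Measure ℝ} [IsFiniteMeasure μ]
    {A : ℝ → E →L[ℝ] E} (hA : Integrable A μ) {D : Set ℝ} (hD : D.Finite) :
    Integrable (feedback μ A D) μ := by
  obtain ⟨C, hC⟩ := exists_norm_atomInv_le hA
  have h1 : Integrable (fun y => A y * atomInv μ A y) μ := by
    refine (hA.norm.mul_const C).mono' (aestronglyMeasurable_of_eqOn_compl_countable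
      (countable_measureReal_singleton_ne_zero μ) hA.1 fun y hy => ?_)
      (Eventually.of_forall fun y => ?_)
    · rw [atomInv_eq_one (by simpa using hy), mul_one]
    · exact (norm_mul_le _ _).trans (by gcongr; exact hC y)
  exact integrable_of_eqOn_compl_finite hD h1 fun y hy => if_neg hy

theorem add_smul_atomInv {μ : Measure ℝ} {A : ℝ → E →L[ℝ] E} {y : ℝ}
    (h : IsUnit (1 - (μ.real {y} / 2) • A y)) (x : E) :
    x + (μ.real {y} / 2) • A y (atomInv μ A y x) = atomInv μ A y x := by
  have := congrArg (fun T : E →L[ℝ] E => T x) (Ring.mul_inverse_cancel _ h)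
  simp only [mul_apply_eq_comp, sub_apply,
    one_apply_eq_self, smul_apply] at this
  exact (sub_eq_iff_eq_add.1 this).symm

/-- The unknown of the Volterra equation is the left limit p(t) = ξ + ∫_{(-∞,t)} G. The density G is
an affine function of p at each point, both off D, where the equation holds, and on D, where the
right limit is prescribed. -/
theorem exists_bal_eq [CompleteSpace E] {μ : Measure ℝ} [IsFiniteMeasure μ]
    {A : ℝ → E →L[ℝ] E} (hA : Integrable A μ) {g : ℝ → E} (hg : Integrable g μ)
    {D : Set ℝ} (hD : D.Finite) (hμD : ∀ y ∈ D, μ.real {y} ≠ 0)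
    (hR : ∀ y ∉ D, IsUnit (1 - (μ.real {y} / 2) • A y)) (ξ : E) (ζ : ℝ → E) :
    ∃ G : ℝ → E, Integrable G μ ∧ (∀ y ∉ D, G y = A y (bal μ ξ G y) + g y) ∧
      ∀ y ∈ D, ξ + ∫ s in Iio y, G s ∂μ + μ.real {y} • G y = ζ y := by
  classical
  obtain ⟨C, hC⟩ := exists_norm_atomInv_le hA
  set B := feedback μ A D with hB
  have hBi : Integrable B μ := integrable_feedback hA hD
  -- Let R be the inverse of 1 − (μ{y}/2)A. Solving u = p + (μ{y}/2)G and G = Au + g gives G = ARp +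
  -- Rg. On D, solving p + μ{y}G = ζ gives G = (ζ − p)/μ{y}. In both cases G = Bp + γ.
  set γ : ℝ → E := fun y => if y ∈ D then (μ.real {y})⁻¹ • ζ y else atomInv μ A y (g y) with hγ
  have hγi : Integrable γ μ := by
    have h1 : Integrable (fun y => atomInv μ A y (g y)) μ := by
      refine (hg.norm.const_mul C).mono' (aestronglyMeasurable_of_eqOn_compl_countable
        (countable_measureReal_singleton_ne_zero μ) hg.1 fun y hy => ?_)
        (Eventually.of_forall fun y => ContinuousLinearMap.le_of_opNorm_le _ (hC y) _)
      rw [atomInv_eq_one (by simpa using hy)]; rfl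
    exact integrable_of_eqOn_compl_finite hD h1 fun y hy => if_neg hy
  have hhm : StronglyMeasurable fun t => ξ + ∫ s in Iio t, γ s ∂μ :=
    stronglyMeasurable_const.add (stronglyMeasurable_setIntegral_Iio μ hγi.1)
  have hhb : ∀ t, ‖ξ + ∫ s in Iio t, γ s ∂μ‖ ≤
      (⟨‖ξ‖ + ∫ s, ‖γ s‖ ∂μ, by positivity⟩ : NNReal) := fun t => by
    refine (norm_add_le _ _).trans (add_le_add le_rfl ((norm_integral_le_integral_norm _).trans ?_))
    exact setIntegral_le_integral hγi.norm (Eventually.of_forall fun _ => norm_nonneg _)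
  obtain ⟨p, hpm, ⟨C', hC'⟩, hp⟩ := exists_volterra hBi hhm hhb
  have hBp : Integrable (fun s => B s (p s)) μ :=
    integrable_clm_apply hBi hpm.aestronglyMeasurable (Eventually.of_forall hC')
  have hpG : ∀ t, ξ + ∫ s in Iio t, (B s (p s) + γ s) ∂μ = p t := fun t => by
    rw [hp t, integral_add hBp.integrableOn hγi.integrableOn]
    abel
  refine ⟨fun s => B s (p s) + γ s, hBp.add hγi, fun y hy => ?_, fun y hy => ?_⟩
  · rw [bal, hpG]
    have e1 : B y = A y * atomInv μ A y := if_neg hy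
    have e2 : γ y = atomInv μ A y (g y) := if_neg hy
    simp only [e1, e2, mul_apply_eq_comp]
    have h1 := add_smul_atomInv (hR y hy) (p y)
    have h2 := add_smul_atomInv (hR y hy) (g y)
    rw [smul_add, ← add_assoc, h1, map_add, map_smul, add_assoc, add_comm _ (g y), h2]
  · rw [hpG]
    have e1 : B y = -((μ.real {y})⁻¹ • (1 : E →L[ℝ] E)) := if_pos hy
    have e2 : γ y = (μ.real {y})⁻¹ • ζ y := if_pos hy
    have h0 := hμD y hy
    simp only [e1, e2]
    simp [smul_add, smul_smul, h0]

/-- The left limits solve the homogeneous Volterra equation with coefficient `feedback` and are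
bounded by ∫‖G‖, so they vanish. Then G vanishes on S too, and with it the atomic correction. -/
theorem bal_zero_eq_zero [CompleteSpace E] {ν : Measure ℝ} {S : Set ℝ} (hS : MeasurableSet S)
    [IsFiniteMeasure ν] {A : ℝ → E →L[ℝ] E} (hA : Integrable A (ν.restrict S))
    {D : Set ℝ} (hD : D.Finite) (hνD : ∀ y ∈ D, ν.real {y} ≠ 0)
    (hR : ∀ y ∈ S, y ∉ D → IsUnit (1 - (ν.real {y} / 2) • A y)) {G : ℝ → E}
    (hGi : Integrable G (ν.restrict S))
    (hG : ∀ y ∈ S, y ∉ D → G y = A y (bal (ν.restrict S) 0 G y))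
    (hGD : ∀ y ∈ D, ∫ s in Iio y, G s ∂ν.restrict S + ν.real {y} • G y = 0) (y : ℝ) (hy : y ∈ S) :
    bal (ν.restrict S) 0 G y = 0 := by
  set μ := ν.restrict S with hμ
  have hμν : ∀ y ∈ S, μ.real {y} = ν.real {y} := fun y hy => by
    rw [measureReal_def, hμ, Measure.restrict_apply (measurableSet_singleton y),
      singleton_inter_of_mem hy, measureReal_def]
  set p : ℝ → E := fun t => ∫ s in Iio t, G s ∂μ with hp
  have hpG : ∀ y ∈ S, G y = feedback μ A D y (p y) := by
    intro y hy
    by_cases hyD : y ∈ D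
    · have h1 := hGD y hyD
      have h2 := hνD y hyD
      rw [feedback, if_pos hyD, hμν y hy]
      simp only [neg_apply, smul_apply,
        one_apply_eq_self]
      have h3 : p y = -(ν.real {y} • G y) := add_eq_zero_iff_eq_neg.1 h1
      rw [h3]
      simp [smul_smul, h2]
    · rw [feedback, if_neg hyD]
      have h1 := hG y hy hyD
      have h2 : IsUnit (1 - (μ.real {y} / 2) • A y) := by rw [hμν y hy]; exact hR y hy hyD
      have h3 : (1 - (μ.real {y} / 2) • A y) (bal μ 0 G y) = p y := by
        simp only [sub_apply, one_apply_eq_self,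
          smul_apply]
        rw [← h1, bal, zero_add, add_sub_cancel_right]
      have h4 := congrArg (fun T : E →L[ℝ] E => T (bal μ 0 G y)) (Ring.inverse_mul_cancel _ h2)
      simp only [mul_apply_eq_comp, h3, one_apply_eq_self] at h4
      rw [h1, mul_apply_eq_comp, atomInv, h4]
  have hp0 : ∀ t, p t = 0 := by
    refine eq_zero_of_volterra (integrable_feedback hA hD)
      (C := ⟨∫ s, ‖G s‖ ∂μ, by positivity⟩) (fun t => ?_) (fun t => ?_)
    · exact (norm_integral_le_integral_norm _).trans
        (setIntegral_le_integral hGi.norm (Eventually.of_forall fun _ => norm_nonneg _))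
    · refine integral_congr_ae (ae_restrict_of_ae ?_)
      filter_upwards [ae_restrict_mem hS] with s hs using hpG s hs
  have hGy : G y = 0 := by rw [hpG y hy, hp0, map_zero]
  rw [bal, hGy]
  simpa using hp0 y

end Balanced

/-! ### Calculus of balanced primitives -/

section Kernel

variable {E : Type*} [NormedAddCommGroup E] [NormedSpace ℝ E]

/-- The balanced indicator function of `(-∞, t)`, as a function of `y`. -/
def heavi (t y : ℝ) : ℝ := (Iio t).indicator 1 y + ({t} : Set ℝ).indicator (fun _ => 1 / 2) y

theorem heavi_of_lt {t y : ℝ} (h : y < t) : heavi t y = 1 := by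
  simp [heavi, h, h.ne]

theorem heavi_of_gt {t y : ℝ} (h : t < y) : heavi t y = 0 := by
  simp [heavi, h.le, h.ne']

theorem heavi_self (t : ℝ) : heavi t t = 1 / 2 := by
  simp [heavi]

/-- The weight 1/2 on the diagonal makes this hold without exception; for this reason balanced
functions satisfy the product rule with no correction at common atoms. -/
theorem heavi_add_heavi (t y : ℝ) : heavi t y + heavi y t = 1 := by
  rcases lt_trichotomy t y with h | rfl | h
  · simp [heavi_of_lt h, heavi_of_gt h]
  · rw [heavi_self]; norm_num
  · simp [heavi_of_lt h, heavi_of_gt h]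

theorem heavi_nonneg (t y : ℝ) : 0 ≤ heavi t y := by
  rcases lt_trichotomy t y with h | rfl | h
  · simp [heavi_of_gt h]
  · rw [heavi_self]; norm_num
  · simp [heavi_of_lt h]

theorem heavi_le_one (t y : ℝ) : heavi t y ≤ 1 := by
  have := heavi_add_heavi t y
  have := heavi_nonneg y t
  linarith

theorem heavi_mono {s t : ℝ} (h : s ≤ t) (y : ℝ) : heavi s y ≤ heavi t y := by
  rcases h.eq_or_lt with rfl | h
  · rfl
  rcases lt_or_ge y t with h1 | h1
  · rw [heavi_of_lt h1]; exact heavi_le_one _ _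
  · rw [heavi_of_gt (h.trans_le h1)]; exact heavi_nonneg _ _

theorem norm_heavi_le (t y : ℝ) : ‖heavi t y‖ ≤ 1 := by
  rw [Real.norm_of_nonneg (heavi_nonneg t y)]; exact heavi_le_one t y

theorem measurable_heavi : Measurable fun p : ℝ × ℝ => heavi p.1 p.2 := by
  have : (fun p : ℝ × ℝ => heavi p.1 p.2) = fun p =>
      {p : ℝ × ℝ | p.2 < p.1}.indicator (fun _ => (1 : ℝ)) p +
        {p : ℝ × ℝ | p.2 = p.1}.indicator (fun _ => (1 / 2 : ℝ)) p := by
    ext p; simp [heavi, indicator]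
  rw [this]
  exact (measurable_const.indicator (measurableSet_lt measurable_snd measurable_fst)).add
    (measurable_const.indicator (measurableSet_eq_fun measurable_snd measurable_fst))

theorem measurable_heavi_right (t : ℝ) : Measurable (heavi t) :=
  measurable_heavi.comp measurable_prodMk_left

theorem integrable_heavi_smul {μ : Measure ℝ} {G : ℝ → E} (hG : Integrable G μ) (t : ℝ) :
    Integrable (fun y => heavi t y • G y) μ :=
  hG.bdd_smul (𝕜 := ℝ) 1 (measurable_heavi_right t).aestronglyMeasurable
    (Eventually.of_forall (norm_heavi_le t))

theorem bal_eq_integral_heavi [CompleteSpace E] {μ : Measure ℝ} [IsFiniteMeasure μ] {G : ℝ → E}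
    (hG : Integrable G μ) (ξ : E) (t : ℝ) : bal μ ξ G t = ξ + ∫ y, heavi t y • G y ∂μ := by
  have h : (fun y => heavi t y • G y) =
      fun y => (Iio t).indicator G y + ({t} : Set ℝ).indicator (fun y => (1 / 2 : ℝ) • G y) y := by
    ext y
    rw [heavi, add_smul]
    congr 1 <;> by_cases h : y = t <;> simp [indicator, h]
  have h1 : Integrable (fun y => (Iio t).indicator G y) μ := hG.indicator measurableSet_Iio
  have h2 : Integrable (fun y => ({t} : Set ℝ).indicator (fun y => (1 / 2 : ℝ) • G y) y) μ :=
    (hG.smul (1 / 2 : ℝ)).indicator (measurableSet_singleton t)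
  rw [h, integral_add h1 h2, integral_indicator measurableSet_Iio,
    integral_indicator (measurableSet_singleton t), integral_singleton, bal, smul_smul, add_assoc]
  congr 3
  ring

/-- Limits of `bal` along filters along which the intervals `(-∞, t)` converge. -/
theorem tendsto_bal [CompleteSpace E] {μ : Measure ℝ} [IsFiniteMeasure μ] {G : ℝ → E}
    (hG : Integrable G μ) (ξ : E) {l : Filter ℝ} [l.IsCountablyGenerated] {T : Set ℝ}
    (hT : MeasurableSet T)
    (h : ∀ᵐ y ∂μ, ∀ᶠ t in l, heavi t y = T.indicator 1 y) :
    Tendsto (bal μ ξ G) l (𝓝 (ξ + ∫ y in T, G y ∂μ)) := by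
  have e : bal μ ξ G = fun t => ξ + ∫ y, heavi t y • G y ∂μ :=
    funext (bal_eq_integral_heavi hG ξ)
  rw [e, ← integral_indicator hT]
  refine tendsto_const_nhds.add (tendsto_integral_filter_of_dominated_convergence (fun y => ‖G y‖)
    (Eventually.of_forall fun t => (integrable_heavi_smul hG t).1)
    (Eventually.of_forall fun t => Eventually.of_forall fun y => ?_) hG.norm ?_)
  · rw [norm_smul]
    exact mul_le_of_le_one_left (norm_nonneg _) (norm_heavi_le t y)
  · filter_upwards [h] with y hy
    refine tendsto_const_nhds.congr' ?_
    filter_upwards [hy] with t ht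
    rw [ht]
    by_cases hyT : y ∈ T <;> simp [hyT]

theorem tendsto_bal_right [CompleteSpace E] {μ : Measure ℝ} [IsFiniteMeasure μ] {G : ℝ → E}
    (hG : Integrable G μ) (ξ : E) (s : ℝ) :
    Tendsto (bal μ ξ G) (𝓝[>] s) (𝓝 (ξ + ∫ y in Iic s, G y ∂μ)) := by
  refine tendsto_bal hG ξ measurableSet_Iic (Eventually.of_forall fun y => ?_)
  rcases le_or_gt y s with h | h
  · filter_upwards [self_mem_nhdsWithin] with t ht
    rw [heavi_of_lt (lt_of_le_of_lt h ht)]; simp [h]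
  · filter_upwards [Ioo_mem_nhdsGT h] with t ht
    rw [heavi_of_gt ht.2]; simp [h]

theorem tendsto_bal_left [CompleteSpace E] {μ : Measure ℝ} [IsFiniteMeasure μ] {G : ℝ → E}
    (hG : Integrable G μ) (ξ : E) (s : ℝ) :
    Tendsto (bal μ ξ G) (𝓝[<] s) (𝓝 (ξ + ∫ y in Iio s, G y ∂μ)) := by
  refine tendsto_bal hG ξ measurableSet_Iio (Eventually.of_forall fun y => ?_)
  rcases lt_or_ge y s with h | h
  · filter_upwards [Ioo_mem_nhdsLT h] with t ht
    rw [heavi_of_lt ht.1]; simp [h]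
  · filter_upwards [self_mem_nhdsWithin] with t ht
    rw [heavi_of_gt (lt_of_lt_of_le ht h)]; simp [h]

theorem setIntegral_Iic_eq [CompleteSpace E] {μ : Measure ℝ} {G : ℝ → E} (hG : Integrable G μ)
    (s : ℝ) : ∫ y in Iic s, G y ∂μ = ∫ y in Iio s, G y ∂μ + μ.real {s} • G s := by
  rw [← Iio_union_right, setIntegral_union (by simp) (measurableSet_singleton s) hG.integrableOn
    hG.integrableOn, integral_singleton]

/-- Increments are dominated by those of a monotone function, since the kernel increases in t.
Bounded variation follows from this. -/
theorem norm_bal_sub_le [CompleteSpace E] {μ : Measure ℝ} [IsFiniteMeasure μ] {G : ℝ → E}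
    (hG : Integrable G μ) (ξ : E) {s t : ℝ} (h : s ≤ t) :
    ‖bal μ ξ G t - bal μ ξ G s‖ ≤ bal μ 0 (fun y => ‖G y‖) t - bal μ 0 (fun y => ‖G y‖) s := by
  have h1 := integrable_heavi_smul hG t
  have h2 := integrable_heavi_smul hG s
  have h3 := integrable_heavi_smul hG.norm t
  have h4 := integrable_heavi_smul hG.norm s
  simp only [bal_eq_integral_heavi hG, bal_eq_integral_heavi hG.norm, add_sub_add_left_eq_sub]
  rw [← integral_sub h1 h2, ← integral_sub h3 h4]
  refine norm_integral_le_of_norm_le (h3.sub h4) (Eventually.of_forall fun y => ?_)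
  rw [← sub_smul, norm_smul, Real.norm_of_nonneg (sub_nonneg.2 (heavi_mono h y)),
    smul_eq_mul, smul_eq_mul, sub_mul]

theorem eVariationOn_le_of_edist_le {α E F : Type*} [LinearOrder α] [PseudoEMetricSpace E]
    [PseudoEMetricSpace F] {f : α → E} {g : α → F} {s : Set α}
    (h : ∀ x ∈ s, ∀ y ∈ s, edist (f x) (f y) ≤ edist (g x) (g y)) :
    eVariationOn f s ≤ eVariationOn g s := by
  refine iSup_le fun p => le_trans (Finset.sum_le_sum fun i _ => ?_)
    (eVariationOn.sum_le (f := g) (n := p.1) p.2.2.1 p.2.2.2)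
  exact h _ (p.2.2.2 _) _ (p.2.2.2 _)

theorem locallyBoundedVariationOn_bal [CompleteSpace E] {μ : Measure ℝ} [IsFiniteMeasure μ]
    {G : ℝ → E} (hG : Integrable G μ) (ξ : E) (S : Set ℝ) :
    LocallyBoundedVariationOn (bal μ ξ G) S := by
  set m := bal μ 0 (fun y => ‖G y‖)
  have hm : Monotone m := fun s t h =>
    sub_nonneg.1 ((norm_nonneg _).trans (norm_bal_sub_le hG ξ h))
  intro a b ha hb
  refine ne_top_of_le_ne_top ((hm.monotoneOn S).locallyBoundedVariationOn a b ha hb)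
    (eVariationOn_le_of_edist_le fun x _ y _ => ?_)
  wlog h : y ≤ x generalizing x y
  · rw [edist_comm, edist_comm (m x)]
    exact this y ‹_› x ‹_› (le_of_not_ge h)
  rw [edist_dist, edist_dist, dist_eq_norm, Real.dist_eq]
  exact ENNReal.ofReal_le_ofReal ((norm_bal_sub_le hG ξ h).trans (le_abs_self _))

/-- As a function of t the kernel is the indicator of (y, ∞) up to a Lebesgue null set. -/
theorem integral_deriv_mul_heavi {φ : ℝ → ℝ} (hφ : ContDiff ℝ ∞ φ) (hc : HasCompactSupport φ)
    (y : ℝ) : ∫ t, deriv φ t * heavi t y = -φ y := by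
  rw [← hc.integral_Ioi_deriv_eq (hφ.of_le (by simp)) y, ← integral_indicator measurableSet_Ioi]
  refine integral_congr_ae ?_
  have : ∀ᵐ t : ℝ, t ≠ y := by simp [ae_iff, measure_singleton]
  filter_upwards [this] with t ht
  rcases lt_or_gt_of_ne ht with h | h
  · simp [heavi_of_gt h, h.le]
  · simp [heavi_of_lt h, h]

theorem integrable_deriv_of_contDiff {φ : ℝ → ℝ} (hφ : ContDiff ℝ ∞ φ)
    (hc : HasCompactSupport φ) : Integrable (deriv φ) :=
  (hφ.continuous_deriv (by simp)).integrable_of_hasCompactSupport hc.deriv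

/-- Integration by parts against a test function. -/
theorem integral_deriv_smul_bal [CompleteSpace E] {μ : Measure ℝ} [IsFiniteMeasure μ] {G : ℝ → E}
    (hG : Integrable G μ) (ξ : E) {φ : ℝ → ℝ} (hφ : ContDiff ℝ ∞ φ)
    (hc : HasCompactSupport φ) :
    ∫ t, deriv φ t • bal μ ξ G t = -∫ y, φ y • G y ∂μ := by
  have hd := integrable_deriv_of_contDiff hφ hc
  have hF : Integrable (fun p : ℝ × ℝ => (deriv φ p.1 * heavi p.1 p.2) • G p.2)
      (volume.prod μ) := by
    have h1 : Integrable (fun p : ℝ × ℝ => deriv φ p.1 • G p.2) (volume.prod μ) :=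
      hd.smul_prod hG
    have h2 := h1.bdd_smul (𝕜 := ℝ) 1 measurable_heavi.aestronglyMeasurable
      (Eventually.of_forall fun p => norm_heavi_le p.1 p.2)
    refine h2.congr (Eventually.of_forall fun p => ?_)
    simp only [Pi.smul_apply', smul_smul, mul_comm]
  have h0 : ∫ t, deriv φ t = 0 := integral_eq_zero_of_hasDerivAt_of_integrable
    (fun t => (hφ.differentiable (by simp) t).hasDerivAt) hd
    (hφ.continuous.integrable_of_hasCompactSupport hc)
  have h3 : ∀ t, deriv φ t • bal μ ξ G t =
      deriv φ t • ξ + ∫ y, (deriv φ t * heavi t y) • G y ∂μ := fun t => by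
    rw [bal_eq_integral_heavi hG, smul_add, ← integral_smul]
    simp only [smul_smul]
  simp only [h3]
  rw [integral_add (hd.smul_const ξ) hF.integral_prod_left, integral_smul_const, h0, zero_smul,
    zero_add, integral_integral_swap hF, ← integral_neg]
  refine integral_congr_ae (Eventually.of_forall fun y => ?_)
  simp only
  rw [integral_smul_const, integral_deriv_mul_heavi hφ hc, neg_smul]

/-- The product rule for balanced functions of bounded variation. -/
theorem integral_mul_bal_add_bal_mul {μ : Measure ℝ} [IsFiniteMeasure μ] {G H : ℝ → ℂ}
    (hG : Integrable G μ) (hH : Integrable H μ) (ξ η : ℂ) :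
    ∫ y, (bal μ ξ G y * H y + G y * bal μ η H y) ∂μ =
      (ξ + ∫ y, G y ∂μ) * (η + ∫ y, H y ∂μ) - ξ * η := by
  have hP : Integrable (fun p : ℝ × ℝ => G p.1 * H p.2) (μ.prod μ) := hG.mul_prod hH
  have h1 : Integrable (fun p : ℝ × ℝ => heavi p.2 p.1 • (G p.1 * H p.2)) (μ.prod μ) :=
    hP.bdd_smul (𝕜 := ℝ) 1 (measurable_heavi.comp measurable_swap).aestronglyMeasurable
      (Eventually.of_forall fun p => norm_heavi_le _ _)
  have h2 : Integrable (fun p : ℝ × ℝ => heavi p.1 p.2 • (G p.1 * H p.2)) (μ.prod μ) :=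
    hP.bdd_smul (𝕜 := ℝ) 1 measurable_heavi.aestronglyMeasurable
      (Eventually.of_forall fun p => norm_heavi_le _ _)
  have e1 : ∀ y, bal μ ξ G y * H y = ξ * H y + ∫ x, heavi y x • (G x * H y) ∂μ := fun y => by
    rw [bal_eq_integral_heavi hG, add_mul, ← integral_mul_const]
    simp only [smul_mul_assoc]
  have e2 : ∀ y, G y * bal μ η H y = G y * η + ∫ x, heavi y x • (G y * H x) ∂μ := fun y => by
    rw [bal_eq_integral_heavi hH, mul_add, ← integral_const_mul]
    simp only [mul_smul_comm]
  have i1 : Integrable (fun y => ∫ x, heavi y x • (G x * H y) ∂μ) μ := h1.integral_prod_right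
  have i2 : Integrable (fun y => ∫ x, heavi y x • (G y * H x) ∂μ) μ := h2.integral_prod_left
  have i3 : Integrable (fun y => ξ * H y) μ := hH.const_mul ξ
  have i4 : Integrable (fun y => G y * η) μ := hG.mul_const η
  have i5 : Integrable (fun y => ∫ x, heavi x y • (G y * H x) ∂μ) μ := h1.integral_prod_left
  -- Exchanging the order in the first double integral gives both the integrand G(y)H(x), with
  -- weights `heavi x y` and `heavi y x`, which add up to 1.
  have e3 : ∫ y, ∫ x, heavi y x • (G x * H y) ∂μ ∂μ + ∫ y, ∫ x, heavi y x • (G y * H x) ∂μ ∂μ =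
      (∫ y, G y ∂μ) * ∫ y, H y ∂μ := by
    rw [integral_integral_swap (f := fun y x => heavi y x • (G x * H y)) h1.swap,
      ← integral_add i5 i2, ← integral_mul_const]
    refine integral_congr_ae ?_
    filter_upwards [h1.prod_right_ae, h2.prod_right_ae] with y hy1 hy2
    rw [← integral_add hy1 hy2, ← integral_const_mul]
    refine integral_congr_ae (Eventually.of_forall fun x => ?_)
    simp only
    rw [← add_smul, heavi_add_heavi, one_smul]
  have i6 : Integrable (fun y => ξ * H y + ∫ x, heavi y x • (G x * H y) ∂μ) μ := i3.add i1
  have i7 : Integrable (fun y => G y * η + ∫ x, heavi y x • (G y * H x) ∂μ) μ := i4.add i2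
  simp only [e1, e2]
  rw [integral_add i6 i7, integral_add i3 i1, integral_add i4 i2,
    integral_const_mul, integral_mul_const]
  linear_combination e3

end Kernel

/-! ### Open intervals with extended real endpoints -/

section Intervals

variable {c d : EReal}

theorem isOpen_ival (c d : EReal) : IsOpen (ival c d) :=
  (isOpen_Ioi.preimage continuous_coe_real_ereal).inter
    (isOpen_Iio.preimage continuous_coe_real_ereal)

theorem measurableSet_ival (c d : EReal) : MeasurableSet (ival c d) :=
    (isOpen_ival c d).measurableSet

theorem Icc_subset_ival {s t : ℝ} (hs : s ∈ ival c d) (ht : t ∈ ival c d) :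
    Icc s t ⊆ ival c d := fun _ hy =>
  ⟨hs.1.trans_le (EReal.coe_le_coe_iff.2 hy.1), (EReal.coe_le_coe_iff.2 hy.2).trans_lt ht.2⟩

theorem exists_lt_mem_ival {t : ℝ} (ht : t ∈ ival c d) : ∃ s ∈ ival c d, s < t := by
  obtain ⟨s, h1, h2⟩ := EReal.lt_iff_exists_real_btwn.1 ht.1
  exact ⟨s, ⟨h1, h2.trans ht.2⟩, EReal.coe_lt_coe_iff.1 h2⟩

theorem exists_gt_mem_ival {t : ℝ} (ht : t ∈ ival c d) : ∃ s ∈ ival c d, t < s := by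
  obtain ⟨s, h1, h2⟩ := EReal.lt_iff_exists_real_btwn.1 ht.2
  exact ⟨s, ⟨ht.1.trans h1, h2⟩, EReal.coe_lt_coe_iff.1 h1⟩

theorem ival_nonempty (h : c < d) : (ival c d).Nonempty := by
  obtain ⟨s, h1, h2⟩ := EReal.lt_iff_exists_real_btwn.1 h
  exact ⟨s, h1, h2⟩

/-- Approach to `e` from the left through real numbers. -/
def leftNhds (e : EReal) : Filter ℝ := comap Real.toEReal (𝓝[<] e)

instance (e : EReal) : (rightNhds e).IsCountablyGenerated := by unfold rightNhds; infer_instance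

instance (e : EReal) : (leftNhds e).IsCountablyGenerated := by unfold leftNhds; infer_instance

theorem ival_mem_rightNhds (h : c < d) : ival c d ∈ rightNhds c :=
  ⟨Ioo c d, Ioo_mem_nhdsGT h, fun _ hy => hy⟩

theorem ival_mem_leftNhds (h : c < d) : ival c d ∈ leftNhds d :=
  ⟨Ioo c d, Ioo_mem_nhdsLT h, fun _ hy => hy⟩

theorem rightNhds_neBot (h : c < d) : (rightNhds c).NeBot := by
  refine comap_neBot_iff.2 fun T hT => ?_
  obtain ⟨e, he, hsub⟩ := (mem_nhdsGT_iff_exists_Ioo_subset' h).1 hT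
  obtain ⟨s, h1, h2⟩ := EReal.lt_iff_exists_real_btwn.1 he
  exact ⟨s, hsub ⟨h1, h2⟩⟩

theorem leftNhds_neBot (h : c < d) : (leftNhds d).NeBot := by
  refine comap_neBot_iff.2 fun T hT => ?_
  obtain ⟨e, he, hsub⟩ := (mem_nhdsLT_iff_exists_Ioo_subset' h).1 hT
  obtain ⟨s, h1, h2⟩ := EReal.lt_iff_exists_real_btwn.1 he
  exact ⟨s, hsub ⟨h1, h2⟩⟩

theorem rightNhds_coe (x : ℝ) : rightNhds (x : EReal) = 𝓝[>] x := by
  rw [rightNhds, nhdsWithin, comap_inf, comap_principal, ← EReal.isEmbedding_coe.nhds_eq_comap,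
    nhdsWithin]
  congr 2
  ext y
  simp

variable {E : Type*} [NormedAddCommGroup E] [NormedSpace ℝ E] [CompleteSpace E]

theorem tendsto_bal_rightNhds {ν : Measure ℝ} [IsFiniteMeasure ν] {G : ℝ → E}
    (hG : Integrable G (ν.restrict (ival c d))) (ξ : E) :
    Tendsto (bal (ν.restrict (ival c d)) ξ G) (rightNhds c) (𝓝 ξ) := by
  have := tendsto_bal hG ξ (l := rightNhds c) MeasurableSet.empty (by
    filter_upwards [ae_restrict_mem (measurableSet_ival c d)] with y hy
    filter_upwards [ival_mem_rightNhds hy.1] with t ht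
    rw [heavi_of_gt (EReal.coe_lt_coe_iff.1 ht.2)]; simp)
  simpa using this

theorem tendsto_bal_leftNhds {ν : Measure ℝ} [IsFiniteMeasure ν] {G : ℝ → E}
    (hG : Integrable G (ν.restrict (ival c d))) (ξ : E) :
    Tendsto (bal (ν.restrict (ival c d)) ξ G) (leftNhds d) (𝓝 (ξ + ∫ y in ival c d, G y ∂ν)) := by
  have := tendsto_bal hG ξ (l := leftNhds d) MeasurableSet.univ (by
    filter_upwards [ae_restrict_mem (measurableSet_ival c d)] with y hy
    filter_upwards [ival_mem_leftNhds hy.2] with t ht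
    rw [heavi_of_lt (EReal.coe_lt_coe_iff.1 ht.1)]; simp)
  simpa using this

end Intervals

/-! ### From the distributional to the integrated equation -/

section WeakEquation

theorem integrable_smul_of_contDiff {E : Type*} [NormedAddCommGroup E] [NormedSpace ℝ E]
    {μ : Measure ℝ} {h : ℝ → E} (hh : Integrable h μ) {φ : ℝ → ℝ}
    (hφ : Continuous φ) (hc : HasCompactSupport φ) : Integrable (fun t => φ t • h t) μ := by
  obtain ⟨C, hC⟩ := hc.exists_bound_of_continuous hφ
  exact hh.bdd_smul (𝕜 := ℝ) C hφ.aestronglyMeasurable (Eventually.of_forall hC)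

variable {E : Type*} [NormedAddCommGroup E] [NormedSpace ℝ E] [CompleteSpace E]

/-- The primitive that starts at the left end of the support vanishes beyond the right end because
the total integral is zero. -/
theorem exists_primitive_of_integral_eq_zero {c d : EReal} {θ : ℝ → ℝ} (hθ : ContDiff ℝ ∞ θ)
    (hc : HasCompactSupport θ) (hS : tsupport θ ⊆ ival c d) (hne : (ival c d).Nonempty)
    (h0 : ∫ t, θ t = 0) :
    ∃ φ : ℝ → ℝ, ContDiff ℝ ∞ φ ∧ HasCompactSupport φ ∧ tsupport φ ⊆ ival c d ∧ deriv φ = θ := by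
  obtain ⟨α, hα, β, hβ, hsub⟩ : ∃ α ∈ ival c d, ∃ β ∈ ival c d, tsupport θ ⊆ Icc α β := by
    rcases (tsupport θ).eq_empty_or_nonempty with h | h
    · obtain ⟨s, hs⟩ := hne
      exact ⟨s, hs, s, hs, by simp [h]⟩
    · obtain ⟨α, hα, h1⟩ := hc.isCompact.exists_isLeast h
      obtain ⟨β, hβ, h2⟩ := hc.isCompact.exists_isGreatest h
      exact ⟨α, hS hα, β, hS hβ, fun y hy => ⟨h1 hy, h2 hy⟩⟩
  have hz : ∀ t ∉ Icc α β, θ t = 0 := fun t ht =>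
    image_eq_zero_of_notMem_tsupport fun h => ht (hsub h)
  set φ : ℝ → ℝ := fun t => ∫ s in α..t, θ s with hφ
  have hd : ∀ t, HasDerivAt φ (θ t) t := fun t =>
    (hθ.continuous.integral_hasStrictDerivAt α t).hasDerivAt
  have hderiv : deriv φ = θ := funext fun t => (hd t).deriv
  have hsupp : tsupport φ ⊆ Icc α β := by
    refine closure_minimal (fun t ht => ?_) isClosed_Icc
    by_contra hcon
    apply ht
    rw [mem_Icc, not_and_or, not_le, not_le] at hcon
    rcases hcon with h | h
    · refine intervalIntegral.integral_zero_ae ?_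
      have : ∀ᵐ s : ℝ, s ≠ α := by simp [ae_iff, measure_singleton]
      filter_upwards [this] with s hs hs'
      rw [uIoc_of_ge h.le] at hs'
      exact hz s fun h' => hs (le_antisymm hs'.2 h'.1)
    · rw [hφ]
      simp only
      by_cases hαβ : α ≤ β
      · rw [intervalIntegral.integral_of_le (hαβ.trans h.le), ← integral_Icc_eq_integral_Ioc,
          setIntegral_eq_integral_of_forall_compl_eq_zero, h0]
        exact fun s hs => hz s fun h' => hs ⟨h'.1, h'.2.trans h.le⟩
      · refine intervalIntegral.integral_zero_ae (Eventually.of_forall fun s _ => hz s ?_)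
        rw [Icc_eq_empty hαβ]; simp
  refine ⟨φ, ?_, HasCompactSupport.of_support_subset_isCompact isCompact_Icc
    ((subset_tsupport _).trans hsupp), hsupp.trans (Icc_subset_ival hα hβ), hderiv⟩
  rw [contDiff_infty_iff_deriv, hderiv]
  exact ⟨fun t => (hd t).differentiableAt, hθ⟩

/-- The lemma of du Bois-Reymond. -/
theorem ae_eq_const_of_integral_deriv_smul_eq_zero {c d : EReal} (hcd : c < d) {h : ℝ → E}
    (hh : Integrable h)
    (hw : ∀ φ : ℝ → ℝ, ContDiff ℝ ∞ φ → HasCompactSupport φ → tsupport φ ⊆ ival c d →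
      ∫ t, deriv φ t • h t = 0) :
    ∃ C : E, ∀ᵐ t, t ∈ ival c d → h t = C := by
  obtain ⟨s, hs⟩ := ival_nonempty hcd
  obtain ⟨ε, hε, hball⟩ := Metric.isOpen_iff.1 (isOpen_ival c d) s hs
  let b : ContDiffBump s := ⟨ε / 4, ε / 2, by positivity, by linarith⟩
  set φ₀ := b.normed volume
  have hφ₀ : ContDiff ℝ ∞ φ₀ := b.contDiff_normed
  have hφ₀c : HasCompactSupport φ₀ := b.hasCompactSupport_normed
  have hφ₀s : tsupport φ₀ ⊆ ival c d := by
    rw [b.tsupport_normed_eq]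
    exact (Metric.closedBall_subset_ball (by change ε / 2 < ε; linarith)).trans hball
  have hφ₀i : ∫ t, φ₀ t = 1 := b.integral_normed
  set C := ∫ t, φ₀ t • h t
  refine ⟨C, ?_⟩
  have key := (isOpen_ival c d).ae_eq_zero_of_integral_contDiff_smul_eq_zero (μ := volume)
    (f := fun t => h t - C) ((hh.locallyIntegrable.sub
        (locallyIntegrable_const C)).locallyIntegrableOn _)
    fun ψ hψ hψc hψs => ?_
  · filter_upwards [key] with t ht hts using sub_eq_zero.1 (ht hts)
  have hψi := hψ.continuous.integrable_of_hasCompactSupport hψc (μ := volume)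
  have hφi := hφ₀.continuous.integrable_of_hasCompactSupport hφ₀c (μ := volume)
  -- Subtracting the right multiple of the unit-mass bump φ₀ leaves a test function of mean zero,
  -- hence a derivative. Testing with it yields ∫ψh = (∫ψ)C with C = ∫φ₀h.
  obtain ⟨φ, h1, h2, h3, h4⟩ := exists_primitive_of_integral_eq_zero
    (θ := fun t => ψ t - (∫ s, ψ s) * φ₀ t) (hψ.sub (contDiff_const.mul hφ₀))
    (hψc.sub hφ₀c.mul_left)
    ((tsupport_sub _ _).trans (union_subset hψs ((tsupport_mul_subset_right).trans hφ₀s)))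
    ⟨s, hs⟩ (by rw [integral_sub hψi (hφi.const_mul _), integral_const_mul, hφ₀i]; simp)
  have h5 := hw φ h1 h2 h3
  have i1 := integrable_smul_of_contDiff hh hψ.continuous hψc
  have i2 := integrable_smul_of_contDiff hh hφ₀.continuous hφ₀c
  rw [h4] at h5
  simp only [sub_smul, mul_smul] at h5
  have i3 : Integrable (fun t => (∫ s, ψ s) • φ₀ t • h t) := i2.smul _
  rw [integral_sub i1 i3, integral_smul] at h5
  simp only [smul_sub]
  rw [integral_sub i1 (hψi.smul_const C), integral_smul_const]
  exact h5

/-- Every nondegenerate subinterval contains a point where h takes the value C, so C is a cluster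
value from either side. -/
theorem eq_of_ae_eq_of_tendsto {E : Type*} [NormedAddCommGroup E] {c d : EReal} {h : ℝ → E} {C : E}
    (hC : ∀ᵐ t, t ∈ ival c d → h t = C) {y : ℝ} (hy : y ∈ ival c d) {l r : E}
    (hl : Tendsto h (𝓝[<] y) (𝓝 l)) (hr : Tendsto h (𝓝[>] y) (𝓝 r)) : l = C ∧ r = C := by
  have aux : ∀ α β : ℝ, α < β → Ioo α β ⊆ ival c d → ∃ t ∈ Ioo α β, h t = C := by
    intro α β hαβ hsub
    by_contra hcon
    push Not at hcon
    have h1 : Ioo α β ⊆ {t | ¬ (t ∈ ival c d → h t = C)} := fun t ht h' =>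
      hcon t ht (h' (hsub ht))
    have h2 := measure_mono_null h1 hC
    simp [Real.volume_Ioo] at h2
    exact absurd hαβ (not_lt.2 h2)
  obtain ⟨α, hα, hαy⟩ := exists_lt_mem_ival hy
  obtain ⟨β, hβ, hβy⟩ := exists_gt_mem_ival hy
  have hsub := Icc_subset_ival hα hβ
  constructor
  · have hf : ∃ᶠ t in 𝓝[<] y, h t ∈ ({C} : Set E) := by
      rw [(nhdsLT_basis_of_exists_lt ⟨α, hαy⟩).frequently_iff]
      intro γ hγ
      obtain ⟨t, ht, h'⟩ := aux (max α γ) y (max_lt hαy hγ) fun t ht =>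
        hsub ⟨((le_max_left _ _).trans_lt ht.1).le, (ht.2.trans hβy).le⟩
      exact ⟨t, ⟨(le_max_right _ _).trans_lt ht.1, ht.2⟩, h'⟩
    simpa using mem_closure_of_frequently_of_tendsto hf hl
  · have hf : ∃ᶠ t in 𝓝[>] y, h t ∈ ({C} : Set E) := by
      rw [(nhdsGT_basis_of_exists_gt ⟨β, hβy⟩).frequently_iff]
      intro γ hγ
      obtain ⟨t, ht, h'⟩ := aux y (min β γ) (lt_min hβy hγ) fun t ht =>
        hsub ⟨(hαy.trans ht.1).le, (ht.2.trans_le (min_le_left _ _)).le⟩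
      exact ⟨t, ⟨ht.1, ht.2.trans_le (min_le_right _ _)⟩, h'⟩
    simpa using mem_closure_of_frequently_of_tendsto hf hr

/-- The two summands are the right and the left limit at t, so this is the balancing condition. -/
theorem bal_eq_smul_add {μ : Measure ℝ} {G : ℝ → E} (hG : Integrable G μ) (ξ : E) (t : ℝ) :
    bal μ ξ G t = (1 / 2 : ℝ) • ((ξ + ∫ y in Iic t, G y ∂μ) + (ξ + ∫ y in Iio t, G y ∂μ)) := by
  rw [setIntegral_Iic_eq hG, bal]
  module

/-- `u` is the average of its one-sided limits at the points of `S`. -/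
def IsBalancedOn (u : ℝ → E) (S : Set ℝ) : Prop :=
  ∀ y ∈ S, ∃ l r, Tendsto u (𝓝[<] y) (𝓝 l) ∧ Tendsto u (𝓝[>] y) (𝓝 r) ∧
    u y = (1 / 2 : ℝ) • (r + l)

theorem isBalancedOn_bal {μ : Measure ℝ} [IsFiniteMeasure μ] {G : ℝ → E} (hG : Integrable G μ)
    (ξ : E) (S : Set ℝ) : IsBalancedOn (bal μ ξ G) S := fun y _ =>
  ⟨_, _, tendsto_bal_left hG ξ y, tendsto_bal_right hG ξ y, bal_eq_smul_add hG ξ y⟩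

theorem norm_bal_zero_le {μ : Measure ℝ} [IsFiniteMeasure μ] {G : ℝ → E} (hG : Integrable G μ)
    (t : ℝ) : ‖bal μ 0 G t‖ ≤ ∫ y, ‖G y‖ ∂μ := by
  rw [bal_eq_integral_heavi hG, zero_add]
  refine norm_integral_le_of_norm_le hG.norm (Eventually.of_forall fun y => ?_)
  rw [norm_smul]
  exact mul_le_of_le_one_left (norm_nonneg _) (norm_heavi_le t y)

theorem aestronglyMeasurable_bal {E : Type*} [NormedAddCommGroup E] [NormedSpace ℝ E]
    {μ : Measure ℝ} [IsFiniteMeasure μ] {G : ℝ → E}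
    (hG : Integrable G μ) (ξ : E) (ρ : Measure ℝ) : AEStronglyMeasurable (bal μ ξ G) ρ := by
  refine aestronglyMeasurable_of_eqOn_compl_countable
    (countable_measureReal_singleton_ne_zero μ) (stronglyMeasurable_const.add
    (stronglyMeasurable_setIntegral_Iio μ hG.1)).aestronglyMeasurable (g := fun t =>
      ξ + ∫ s in Iio t, G s ∂μ) fun y hy => ?_
  have : μ.real {y} = 0 := by simpa using hy
  rw [bal, this]
  simp

/-- Both u and the balanced primitive of G have the same distributional derivative, so they differ
by a constant almost everywhere. Being balanced, they do so at every point. -/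
theorem exists_eq_bal_of_weak {α β : ℝ} (hαβ : α < β) {ν : Measure ℝ} [IsFiniteMeasure ν]
    {u G : ℝ → E} (hu : IntegrableOn u (ival α β)) (hb : IsBalancedOn u (ival α β))
    (hG : IntegrableOn G (ival α β) ν)
    (hw : ∀ φ : ℝ → ℝ, ContDiff ℝ ∞ φ → HasCompactSupport φ → tsupport φ ⊆ ival α β →
      ∫ t, deriv φ t • u t = -∫ y, φ y • G y ∂ν) :
    ∃ C : E, ∀ t ∈ ival α β, u t = bal (ν.restrict (ival α β)) C G t := by
  set S := ival α β with hSdef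
  have hS : MeasurableSet S := measurableSet_ival _ _
  have hSfin : volume S ≠ ⊤ := by
    refine ((measure_mono (t := Icc α β) fun y hy => ?_).trans_lt (by simp)).ne
    exact ⟨EReal.coe_le_coe_iff.1 hy.1.le, EReal.coe_le_coe_iff.1 hy.2.le⟩
  set v := bal (ν.restrict S) 0 G with hv
  have hvi : IntegrableOn v S := Measure.integrableOn_of_bounded hSfin
    (aestronglyMeasurable_bal hG 0 _) (Eventually.of_forall (norm_bal_zero_le hG))
  obtain ⟨C, hC⟩ := ae_eq_const_of_integral_deriv_smul_eq_zero (c := α) (d := β)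
    (EReal.coe_lt_coe_iff.2 hαβ)
    (h := S.indicator (u - v)) ((hu.sub hvi).integrable_indicator hS) (fun φ h1 h2 h3 => by
      have hz : ∀ t ∉ S, deriv φ t = 0 := fun t ht =>
        image_eq_zero_of_notMem_tsupport fun h' => ht (h3 (tsupport_deriv_subset h'))
      have hz' : ∀ t ∉ S, φ t = 0 := fun t ht =>
        image_eq_zero_of_notMem_tsupport fun h' => ht (h3 h')
      have hcd := h1.continuous_deriv (by simp)
      have e1 : ∀ t, deriv φ t • S.indicator (u - v) t =
          deriv φ t • S.indicator u t - deriv φ t • S.indicator v t := fun t => by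
        rw [indicator_sub', Pi.sub_apply, smul_sub]
      have e2 : ∀ (w : ℝ → E) t, deriv φ t • S.indicator w t = deriv φ t • w t := fun w t => by
        by_cases ht : t ∈ S
        · rw [indicator_of_mem ht]
        · rw [hz t ht, zero_smul, zero_smul]
      have i1 := integrable_smul_of_contDiff (hu.integrable_indicator hS) hcd h2.deriv
      have i2 := integrable_smul_of_contDiff (hvi.integrable_indicator hS) hcd h2.deriv
      simp only [e1]
      rw [integral_sub i1 i2]
      simp only [e2]
      rw [hw φ h1 h2 h3, integral_deriv_smul_bal hG 0 h1 h2,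
        setIntegral_eq_integral_of_forall_compl_eq_zero fun y hy => by rw [hz' y hy, zero_smul],
        sub_self])
  refine ⟨C, fun y hy => ?_⟩
  obtain ⟨l, r, hl, hr, hy'⟩ := hb y hy
  have hSy : S ∈ 𝓝 y := (isOpen_ival _ _).mem_nhds hy
  have key := eq_of_ae_eq_of_tendsto hC hy
    (((hl.sub (tendsto_bal_left hG 0 y))).congr' (by
      filter_upwards [nhdsWithin_le_nhds hSy] with t ht
      rw [indicator_of_mem ht]; rfl))
    (((hr.sub (tendsto_bal_right hG 0 y))).congr' (by
      filter_upwards [nhdsWithin_le_nhds hSy] with t ht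
      rw [indicator_of_mem ht]; rfl))
  rw [hy', bal_eq_smul_add hG, ← key.1]
  have h2 := key.2
  rw [sub_eq_iff_eq_add, ← key.1] at h2
  rw [h2]
  module

/-- Where a has mass at most 1/2, the supremum M of ‖u‖ between s and t satisfies M ≤ ‖u(s)‖ + M/2 +
Γ, and the term M/2 can be absorbed because M is finite. The resulting bound does not depend on t.
-/
theorem norm_le_of_forall_norm_sub_le {E : Type*} [NormedAddCommGroup E] {S : Set ℝ} {ν : Measure ℝ}
    {a : ℝ → ℝ} {u : ℝ → E}
    {Γ : ℝ} (ha0 : ∀ y, 0 ≤ a y)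
    (hb : ∀ s ∈ S, ∀ t ∈ S, ∃ M, ∀ y ∈ Icc s t, ‖u y‖ ≤ M)
    (hu : ∀ s ∈ S, ∀ t ∈ S, s ≤ t → ∀ M, (∀ y ∈ Icc s t, ‖u y‖ ≤ M) →
      ‖u t - u s‖ ≤ M * ∫ y in Icc s t, a y ∂ν + Γ)
    {T : Set ℝ} (hT : T.OrdConnected) (hTS : T ⊆ S) (haT : IntegrableOn a T ν)
    (hT2 : ∫ y in T, a y ∂ν ≤ 1 / 2) {s t : ℝ} (hs : s ∈ T) (ht : t ∈ T) :
    ‖u t‖ ≤ 2 * (‖u s‖ + Γ) := by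
  have hK : uIcc s t ⊆ T := hT.uIcc_subset hs ht
  set M := sSup ((fun y => ‖u y‖) '' uIcc s t) with hM
  have hbdd : BddAbove ((fun y => ‖u y‖) '' uIcc s t) := by
    obtain ⟨M, hM⟩ := hb (min s t) (hTS (hK ⟨le_rfl, min_le_max⟩)) (max s t)
      (hTS (hK ⟨min_le_max, le_rfl⟩))
    exact ⟨M, by rintro _ ⟨y, hy, rfl⟩; exact hM y hy⟩
  have hMy : ∀ y ∈ uIcc s t, ‖u y‖ ≤ M := fun y hy => le_csSup hbdd ⟨y, hy, rfl⟩
  have hM0 : 0 ≤ M := (norm_nonneg _).trans (hMy s left_mem_uIcc)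
  have aux : ∀ p ∈ uIcc s t, ∀ r ∈ uIcc s t, p ≤ r → ‖u r - u p‖ ≤ M * (1 / 2) + Γ := by
    intro p hp r hr hpr
    have hsub : Icc p r ⊆ uIcc s t := ordConnected_uIcc.out hp hr
    refine (hu p (hTS (hK hp)) r (hTS (hK hr)) hpr M fun y hy => hMy y (hsub hy)).trans ?_
    gcongr
    exact (setIntegral_mono_set haT (Eventually.of_forall ha0)
      (Eventually.of_forall (hsub.trans hK))).trans hT2
  have hr : ∀ r ∈ uIcc s t, ‖u r‖ ≤ ‖u s‖ + (M * (1 / 2) + Γ) := by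
    intro r hr
    have h1 : ‖u r - u s‖ ≤ M * (1 / 2) + Γ := by
      rcases le_total s r with h | h
      · exact aux s left_mem_uIcc r hr h
      · rw [norm_sub_rev]; exact aux r hr s left_mem_uIcc h
    calc ‖u r‖ = ‖u s + (u r - u s)‖ := by rw [add_sub_cancel]
      _ ≤ _ := (norm_add_le _ _).trans (by gcongr)
  have h2 : M ≤ ‖u s‖ + (M * (1 / 2) + Γ) := by
    refine csSup_le ⟨_, s, left_mem_uIcc, rfl⟩ ?_
    rintro _ ⟨y, hy, rfl⟩
    exact hr y hy
  have h3 := hMy t right_mem_uIcc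
  linarith

/-- Functions which are governed by a linear inequality with integrable coefficients are bounded
up to the endpoints of the interval. -/
theorem exists_norm_le_of_forall_norm_sub_le {E : Type*} [NormedAddCommGroup E] {c d : EReal}
    (hcd : c < d) {ν : Measure ℝ}
    [IsFiniteMeasure ν] {a : ℝ → ℝ} {u : ℝ → E}
    {Γ : ℝ} (ha0 : ∀ y, 0 ≤ a y) (ha : IntegrableOn a (ival c d) ν)
    (hb : ∀ s ∈ ival c d, ∀ t ∈ ival c d, ∃ M, ∀ y ∈ Icc s t, ‖u y‖ ≤ M)
    (hu : ∀ s ∈ ival c d, ∀ t ∈ ival c d, s ≤ t → ∀ M, (∀ y ∈ Icc s t, ‖u y‖ ≤ M) →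
      ‖u t - u s‖ ≤ M * ∫ y in Icc s t, a y ∂ν + Γ) :
    ∃ M, ∀ t ∈ ival c d, ‖u t‖ ≤ M := by
  set S := ival c d
  have hord : S.OrdConnected := ⟨fun s hs t ht => Icc_subset_ival hs ht⟩
  have hrest : ∀ T, MeasurableSet T → ∫ y in T, a y ∂ν.restrict S = ∫ y in S ∩ T, a y ∂ν :=
    fun T hT => by rw [Measure.restrict_restrict hT, inter_comm]
  have hleft : ∃ β ∈ S, ∃ M, ∀ t ∈ S, t < β → ‖u t‖ ≤ M := by
    have := rightNhds_neBot hcd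
    -- The mass of a to the left of β tends to 0 as β approaches c, so it is below 1/2 near that
    -- endpoint; likewise at d.
    have h1 := (tendsto_bal_rightNhds ha 0).eventually (gt_mem_nhds (by norm_num : (0 : ℝ) < 1 / 2))
    obtain ⟨β, hβ1, hβS⟩ := (h1.and (ival_mem_rightNhds hcd)).exists
    obtain ⟨s, hs, hsβ⟩ := exists_lt_mem_ival hβS
    refine ⟨β, hβS, 2 * (‖u s‖ + Γ), fun t ht htβ => norm_le_of_forall_norm_sub_le ha0 hb hu
      (T := S ∩ Iio β) (hord.inter ordConnected_Iio) inter_subset_left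
      (ha.mono_set inter_subset_left) ?_ ⟨hs, hsβ⟩ ⟨ht, htβ⟩⟩
    rw [← hrest _ measurableSet_Iio]
    refine le_trans ?_ hβ1.le
    rw [bal, zero_add]
    exact le_add_of_nonneg_right (mul_nonneg (by positivity) (ha0 _))
  have hright : ∃ α ∈ S, ∃ M, ∀ t ∈ S, α < t → ‖u t‖ ≤ M := by
    have := leftNhds_neBot hcd
    have h1 := (tendsto_bal_leftNhds ha 0).eventually
      (lt_mem_nhds (show 0 + ∫ y in S, a y ∂ν - 1 / 2 < 0 + ∫ y in S, a y ∂ν by linarith))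
    obtain ⟨α, hα1, hαS⟩ := (h1.and (ival_mem_leftNhds hcd)).exists
    obtain ⟨s, hs, hsα⟩ := exists_gt_mem_ival hαS
    refine ⟨α, hαS, 2 * (‖u s‖ + Γ), fun t ht htα => norm_le_of_forall_norm_sub_le ha0 hb hu
      (T := S ∩ Ioi α) (hord.inter ordConnected_Ioi) inter_subset_left
      (ha.mono_set inter_subset_left) ?_ ⟨hs, hsα⟩ ⟨ht, htα⟩⟩
    rw [← hrest _ measurableSet_Ioi]
    have h2 := integral_add_compl (measurableSet_Iic (a := α)) ha
    rw [compl_Iic] at h2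
    have h3 := setIntegral_Iic_eq ha α
    have h4 : 0 ≤ (ν.restrict S).real {α} * a α := mul_nonneg (by positivity) (ha0 _)
    rw [bal, zero_add, smul_eq_mul] at hα1
    rw [smul_eq_mul] at h3
    linarith
  obtain ⟨β, hβ, M₁, h1⟩ := hleft
  obtain ⟨α, hα, M₂, h2⟩ := hright
  obtain ⟨M₃, h3⟩ := hb β hβ α hα
  refine ⟨max M₁ (max M₂ M₃), fun t ht => ?_⟩
  rcases lt_or_ge t β with h | h
  · exact (h1 t ht h).trans (le_max_left _ _)
  rcases lt_or_ge α t with h' | h'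
  · exact (h2 t ht h').trans ((le_max_left _ _).trans (le_max_right _ _))
  · exact (h3 t ⟨h, h'⟩).trans ((le_max_right _ _).trans (le_max_right _ _))

/-- A balanced function of locally bounded variation which solves `u' = (A u + g) ν` in the sense
of distributions satisfies the integrated equation up to the endpoints. -/
theorem exists_eq_bal_of_weak_linear {c d : EReal} (hcd : c < d) {ν : Measure ℝ}
    [IsFiniteMeasure ν] {A : ℝ → E →L[ℝ] E} {g u : ℝ → E} (hA : IntegrableOn A (ival c d) ν)
    (hg : IntegrableOn g (ival c d) ν) (hBV : LocallyBoundedVariationOn u (ival c d))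
    (hum : ∀ ρ : Measure ℝ, AEStronglyMeasurable u (ρ.restrict (ival c d)))
    (hb : IsBalancedOn u (ival c d))
    (hw : ∀ φ : ℝ → ℝ, ContDiff ℝ ∞ φ → HasCompactSupport φ → tsupport φ ⊆ ival c d →
      ∫ t, deriv φ t • u t = -∫ y, φ y • (A y (u y) + g y) ∂ν) :
    IntegrableOn (fun y => A y (u y) + g y) (ival c d) ν ∧
      ∃ ξ : E, ∀ t ∈ ival c d, u t =
        bal (ν.restrict (ival c d)) ξ (fun y => A y (u y) + g y) t := by
  set S := ival c d with hSdef
  have hS : MeasurableSet S := measurableSet_ival c d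
  set G : ℝ → E := fun y => A y (u y) + g y with hGdef
  have hum' : ∀ (ρ : Measure ℝ), ∀ T ⊆ S, AEStronglyMeasurable u (ρ.restrict T) := fun ρ T hT =>
    (hum ρ).mono_measure (Measure.restrict_mono hT le_rfl)
  have hbd : ∀ s ∈ S, ∀ t ∈ S, ∃ M, ∀ y ∈ Icc s t, ‖u y‖ ≤ M := by
    intro s hs t ht
    have hBVst : BoundedVariationOn u (S ∩ Icc s t) := hBV s t hs ht
    refine ⟨(eVariationOn u (S ∩ Icc s t)).toReal + ‖u s‖, fun y hy => ?_⟩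
    have h1 := hBVst.dist_le ⟨Icc_subset_ival hs ht hy, hy⟩
      ⟨hs, left_mem_Icc.2 (hy.1.trans hy.2)⟩
    rw [dist_eq_norm] at h1
    calc ‖u y‖ = ‖(u y - u s) + u s‖ := by rw [sub_add_cancel]
      _ ≤ _ := (norm_add_le _ _).trans (by gcongr)
  have hGloc : ∀ T ⊆ S, ∀ M, MeasurableSet T → (∀ y ∈ T, ‖u y‖ ≤ M) → IntegrableOn G T ν := by
    intro T hT M hTm hM
    refine Integrable.add (integrable_clm_apply (hA.mono_set hT)
      (hum' ν T hT) (C := M) ?_) (hg.mono_set hT)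
    filter_upwards [ae_restrict_mem hTm] with y hy using hM y hy
  -- The weak equation is integrated on a slightly larger bounded interval (α, β), where u is
  -- bounded. The kernel difference vanishes off [s, t], so α and β drop out of the formula.
  have hdiff : ∀ s ∈ S, ∀ t ∈ S, s ≤ t →
      u t - u s = ∫ y in S, (heavi t y - heavi s y) • G y ∂ν := by
    intro s hs t ht hst
    obtain ⟨α, hα, hαs⟩ := exists_lt_mem_ival hs
    obtain ⟨β, hβ, hβt⟩ := exists_gt_mem_ival ht
    have hαβ : α < β := hαs.trans (hst.trans_lt hβt)
    have hmem : ∀ y, y ∈ ival α β ↔ α < y ∧ y < β := fun y => by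
      simp [ival]
    have hsub : ival α β ⊆ S := fun y hy =>
      Icc_subset_ival hα hβ ⟨((hmem y).1 hy).1.le, ((hmem y).1 hy).2.le⟩
    obtain ⟨M, hM⟩ := hbd α hα β hβ
    have hM' : ∀ y ∈ ival (α : EReal) β, ‖u y‖ ≤ M := fun y hy =>
      hM y ⟨((hmem y).1 hy).1.le, ((hmem y).1 hy).2.le⟩
    have hGi := hGloc _ hsub M (measurableSet_ival _ _) hM'
    have hfin : volume (ival (α : EReal) β) < ⊤ := by
      refine (measure_mono (t := Icc α β) fun y hy => ?_).trans_lt (by simp)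
      exact ⟨((hmem y).1 hy).1.le, ((hmem y).1 hy).2.le⟩
    have hui : IntegrableOn u (ival α β) := ⟨hum' volume _ hsub,
        HasFiniteIntegral.restrict_of_bounded M hfin (by
        filter_upwards [ae_restrict_mem (measurableSet_ival _ _)] with y hy using hM' y hy)⟩
    obtain ⟨C, hC⟩ := exists_eq_bal_of_weak hαβ hui (fun y hy => hb y (hsub hy)) hGi
      fun φ h1 h2 h3 => hw φ h1 h2 (h3.trans hsub)
    rw [hC t ((hmem t).2 ⟨hαs.trans_le hst, hβt⟩), hC s ((hmem s).2 ⟨hαs, hst.trans_lt hβt⟩),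
      bal_eq_integral_heavi hGi, bal_eq_integral_heavi hGi, add_sub_add_left_eq_sub,
      ← integral_sub (integrable_heavi_smul hGi t) (integrable_heavi_smul hGi s),
      setIntegral_eq_of_subset_of_forall_sdiff_eq_zero hS hsub]
    · simp only [sub_smul]
    · intro y hy
      have h1 : ¬ (α < y ∧ y < β) := fun h => hy.2 ((hmem y).2 h)
      rw [not_and_or, not_lt, not_lt] at h1
      rcases h1 with h1 | h1
      · rw [heavi_of_lt (h1.trans_lt hαs), heavi_of_lt (h1.trans_lt (hαs.trans_le hst)), sub_self,
          zero_smul]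
      · rw [heavi_of_gt (hβt.trans_le h1), heavi_of_gt (hst.trans_lt (hβt.trans_le h1)), sub_self,
          zero_smul]
  -- Integrability of A and g up to the endpoints bounds u on the whole interval, and then Au + g is
  -- integrable there.
  obtain ⟨M, hM⟩ := exists_norm_le_of_forall_norm_sub_le hcd (ν := ν) (a := fun y => ‖A y‖)
    (Γ := ∫ y in S, ‖g y‖ ∂ν) (fun y => norm_nonneg _) hA.norm hbd (fun s hs t ht hst M hM => by
      have hsub : Icc s t ⊆ S := Icc_subset_ival hs ht
      have hAi := (hA.mono_set hsub).norm
      have hgi := (hg.mono_set hsub).norm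
      rw [hdiff s hs t ht hst, setIntegral_eq_of_subset_of_forall_sdiff_eq_zero hS hsub]
      · calc ‖∫ y in Icc s t, (heavi t y - heavi s y) • G y ∂ν‖
            ≤ ∫ y in Icc s t, (M * ‖A y‖ + ‖g y‖) ∂ν := by
              refine norm_integral_le_of_norm_le ((hAi.const_mul M).add hgi) ?_
              filter_upwards [ae_restrict_mem measurableSet_Icc] with y hy
              rw [norm_smul, Real.norm_of_nonneg (sub_nonneg.2 (heavi_mono hst y))]
              refine (mul_le_of_le_one_left (norm_nonneg _) ?_).trans ?_
              · have := heavi_le_one t y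
                have := heavi_nonneg s y
                linarith
              · refine (norm_add_le _ _).trans (add_le_add ?_ le_rfl)
                rw [mul_comm]
                exact (A y).le_opNorm_of_le (hM y hy)
          _ ≤ M * ∫ y in Icc s t, ‖A y‖ ∂ν + ∫ y in S, ‖g y‖ ∂ν := by
              rw [integral_add (hAi.const_mul M) hgi, integral_const_mul]
              exact add_le_add le_rfl (setIntegral_mono_set hg.norm
                (Eventually.of_forall fun _ => norm_nonneg _) (Eventually.of_forall hsub))
      · intro y hy
        have h1 : ¬ (s ≤ y ∧ y ≤ t) := hy.2
        rw [not_and_or, not_le, not_le] at h1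
        rcases h1 with h1 | h1
        · rw [heavi_of_lt h1, heavi_of_lt (h1.trans_le hst), sub_self, zero_smul]
        · rw [heavi_of_gt h1, heavi_of_gt (hst.trans_lt h1), sub_self, zero_smul])
  have hGS : IntegrableOn G S ν := hGloc S Subset.rfl M hS hM
  obtain ⟨s, hs⟩ := ival_nonempty hcd
  -- The constant is chosen so that the formula holds at s; the difference formula carries it to
  -- every other t.
  refine ⟨hGS, u s - ∫ y in S, heavi s y • G y ∂ν, fun t ht => ?_⟩
  have hit := integrable_heavi_smul hGS t
  have his := integrable_heavi_smul hGS s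
  rw [bal_eq_integral_heavi hGS]
  rcases le_total s t with h | h
  · have h1 := hdiff s hs t ht h
    simp only [sub_smul] at h1
    rw [integral_sub hit his, sub_eq_iff_eq_add] at h1
    rw [h1]
    abel
  · have h1 := hdiff t ht s hs h
    simp only [sub_smul] at h1
    rw [integral_sub his hit, sub_eq_iff_eq_add] at h1
    rw [h1]
    abel

end WeakEquation

/-! ### Functions of bounded variation and their measures -/

section Stieltjes

theorem eVariationOn_Iic_add_norm_sub_le {E : Type*} [NormedAddCommGroup E] {I : Set ℝ} {g : ℝ → E}
    (hg : BoundedVariationOn g I) {s t : ℝ} (hs : s ∈ I) (ht : t ∈ I) (hst : s ≤ t) :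
    ‖g t - g s‖ ≤ (eVariationOn g (I ∩ Iic t)).toReal - (eVariationOn g (I ∩ Iic s)).toReal := by
  have hfin : ∀ T, eVariationOn g (I ∩ T) ≠ ⊤ := fun T => hg.mono inter_subset_left
  have h1 := eVariationOn.add_le_union g (s := I ∩ Iic s) (t := {s, t}) (by
    rintro x hx y (rfl | rfl)
    · exact hx.2
    · exact le_trans hx.2 hst)
  rw [eVariationOn.pair] at h1
  have h2 := h1.trans (eVariationOn.mono g (t := I ∩ Iic s ∪ {s, t}) (s := I ∩ Iic t) (by
    rintro x (hx | rfl | rfl)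
    · exact ⟨hx.1, le_trans hx.2 hst⟩
    · exact ⟨hs, hst⟩
    · exact ⟨ht, le_refl x⟩))
  have h3 := ENNReal.toReal_mono (hfin _) h2
  rw [ENNReal.toReal_add (hfin _) (edist_ne_top _ _), edist_dist,
    ENNReal.toReal_ofReal dist_nonneg, dist_comm, dist_eq_norm] at h3
  linarith

/-- Let K bound ‖g‖ on the interval. The increments of the extension are dominated by those of a
bounded monotone function: the accumulated variation of g plus steps of height K at a and at b,
which pay for the jumps to zero. -/
theorem boundedVariationOn_indicator_ival {E : Type*} [NormedAddCommGroup E] {a b : EReal}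
    {g : ℝ → E} (hg : BoundedVariationOn g (ival a b)) :
    BoundedVariationOn ((ival a b).indicator g) univ := by
  classical
  set I := ival a b
  rcases I.eq_empty_or_nonempty with h | ⟨s₀, hs₀⟩
  · rw [h]
    refine ne_of_eq_of_ne (eVariationOn.constant_on fun x hx y hy => ?_) ENNReal.zero_ne_top
    obtain ⟨x, _, rfl⟩ := hx
    obtain ⟨y, _, rfl⟩ := hy
    simp
  have hfin : ∀ T, eVariationOn g (I ∩ T) ≠ ⊤ := fun T => hg.mono inter_subset_left
  set K := (eVariationOn g I).toReal + ‖g s₀‖ with hK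
  have hK0 : 0 ≤ K := by positivity
  have hgK : ∀ y ∈ I, ‖g y‖ ≤ K := fun y hy => by
    have h1 := hg.dist_le hy hs₀
    rw [dist_eq_norm] at h1
    calc ‖g y‖ = ‖(g y - g s₀) + g s₀‖ := by rw [sub_add_cancel]
      _ ≤ _ := (norm_add_le _ _).trans (add_le_add h1 le_rfl)
  set V : ℝ → ℝ := fun t => (eVariationOn g (I ∩ Iic t)).toReal
  have hV : Monotone V := fun s t h => ENNReal.toReal_mono (hfin _)
    (eVariationOn.mono g (inter_subset_inter_right _ (Iic_subset_Iic.2 h)))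
  set p : ℝ → ℝ := fun t => if a < (t : EReal) then K else 0
  set r : ℝ → ℝ := fun t => if b ≤ (t : EReal) then K else 0
  have hp : Monotone p := fun s t h => by
    simp only [p]
    split_ifs with h1 h2
    · exact le_rfl
    · exact absurd (h1.trans_le (EReal.coe_le_coe_iff.2 h)) h2
    · exact hK0
    · exact le_rfl
  have hr : Monotone r := fun s t h => by
    simp only [r]
    split_ifs with h1 h2
    · exact le_rfl
    · exact absurd (h1.trans (EReal.coe_le_coe_iff.2 h)) h2
    · exact hK0
    · exact le_rfl
  set m : ℝ → ℝ := fun t => V t + p t + r t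
  have hm : Monotone m := (hV.add hp).add hr
  have hmb : ∀ t ∈ (univ : Set ℝ), |m t| ≤ (eVariationOn g I).toReal + K + K := fun t _ => by
    have h1 : 0 ≤ V t := ENNReal.toReal_nonneg
    have h2 : V t ≤ (eVariationOn g I).toReal := ENNReal.toReal_mono hg
      (eVariationOn.mono g inter_subset_left)
    have h3 : 0 ≤ p t ∧ p t ≤ K := by simp only [p]; split_ifs <;> simp [hK0]
    have h4 : 0 ≤ r t ∧ r t ≤ K := by simp only [r]; split_ifs <;> simp [hK0]
    rw [abs_of_nonneg (add_nonneg (add_nonneg h1 h3.1) h4.1)]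
    exact add_le_add (add_le_add h2 h3.2) h4.2
  have key : ∀ s t, s ≤ t → ‖I.indicator g t - I.indicator g s‖ ≤ m t - m s := by
    intro s t hst
    have e1 := hV hst
    have e2 := hp hst
    have e3 := hr hst
    by_cases hs : s ∈ I <;> by_cases ht : t ∈ I
    · rw [indicator_of_mem hs, indicator_of_mem ht]
      have := eVariationOn_Iic_add_norm_sub_le hg hs ht hst
      simp only [m]
      linarith
    · rw [indicator_of_mem hs, indicator_of_notMem ht, zero_sub, norm_neg]
      have hb : b ≤ (t : EReal) := by
        by_contra hc
        exact ht ⟨hs.1.trans_le (EReal.coe_le_coe_iff.2 hst), not_le.1 hc⟩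
      have h1 : r t = K := if_pos hb
      have h2 : r s = 0 := if_neg (not_le.2 hs.2)
      have := hgK s hs
      simp only [m]
      linarith
    · rw [indicator_of_notMem hs, indicator_of_mem ht, sub_zero]
      have ha : ¬ a < (s : EReal) := fun hc =>
        hs ⟨hc, (EReal.coe_le_coe_iff.2 hst).trans_lt ht.2⟩
      have h1 : p t = K := if_pos ht.1
      have h2 : p s = 0 := if_neg ha
      have := hgK t ht
      simp only [m]
      linarith
    · rw [indicator_of_notMem hs, indicator_of_notMem ht, sub_zero, norm_zero]
      exact sub_nonneg.2 (hm hst)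
  refine ne_top_of_le_ne_top ((hm.monotoneOn univ).boundedVariationOn hmb)
    (eVariationOn_le_of_edist_le fun x _ y _ => ?_)
  wlog h : y ≤ x generalizing x y
  · rw [edist_comm, edist_comm (m x)]
    exact this y ‹_› x ‹_› (le_of_not_ge h)
  rw [edist_dist, edist_dist, dist_eq_norm, Real.dist_eq]
  exact ENNReal.ofReal_le_ofReal ((key y x h).trans (le_abs_self _))

theorem boundedVariationOn_ival_of_ends {E : Type*} [PseudoEMetricSpace E] {a b : EReal}
    {g : ℝ → E} (hg : LocallyBoundedVariationOn g (ival a b)) {c c' : ℝ} (hc : c ∈ ival a b)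
    (hc' : c' ∈ ival a b) (hl : BoundedVariationOn g {y ∈ ival a b | y < c})
    (hr : BoundedVariationOn g {y ∈ ival a b | c' < y}) : BoundedVariationOn g (ival a b) := by
  obtain ⟨s, hs, hsc⟩ := exists_lt_mem_ival hc
  obtain ⟨t, ht, hct⟩ := exists_gt_mem_ival hc'
  -- The two end pieces may overlap, so the left cut is moved down to t if necessary.
  obtain ⟨s', hs', hsc', hst⟩ : ∃ s' ∈ ival a b, s' < c ∧ s' ≤ t := by
    rcases le_total s t with h | h
    · exact ⟨s, hs, hsc, h⟩
    · exact ⟨t, ht, h.trans_lt hsc, le_rfl⟩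
  have e : ival a b = (ival a b ∩ Iic s' ∪ ival a b ∩ Icc s' t) ∪ ival a b ∩ Ici t := by
    ext y
    simp only [mem_union, mem_inter_iff, mem_Iic, mem_Icc, mem_Ici]
    constructor
    · intro hy
      rcases le_total y s' with h | h
      · exact Or.inl (Or.inl ⟨hy, h⟩)
      rcases le_total y t with h' | h'
      · exact Or.inl (Or.inr ⟨hy, h, h'⟩)
      · exact Or.inr ⟨hy, h'⟩
    · tauto
  rw [BoundedVariationOn, e, eVariationOn.union g (x := t), eVariationOn.union g (x := s')]
  · refine ENNReal.add_ne_top.2 ⟨ENNReal.add_ne_top.2 ⟨hl.mono ?_, hg s' t hs' ht⟩, hr.mono ?_⟩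
    · exact fun y hy => ⟨hy.1, lt_of_le_of_lt hy.2 hsc'⟩
    · exact fun y hy => ⟨hy.1, lt_of_lt_of_le hct hy.2⟩
  · exact ⟨⟨hs', le_refl s'⟩, fun y hy => hy.2⟩
  · exact ⟨⟨hs', le_rfl, hst⟩, fun y hy => hy.2.1⟩
  · refine ⟨Or.inr ⟨ht, hst, le_rfl⟩, ?_⟩
    rintro y (hy | hy)
    · exact le_trans hy.2 hst
    · exact hy.2.2
  · exact ⟨⟨ht, le_refl t⟩, fun y hy => hy.2⟩

theorem tendsto_limits_of_boundedVariationOn_ival {E : Type*} [NormedAddCommGroup E]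
    [CompleteSpace E] {a b : EReal} {g : ℝ → E} (hg : BoundedVariationOn g (ival a b)) {y : ℝ}
    (hy : y ∈ ival a b) :
    Tendsto g (𝓝[>] y) (𝓝 (((ival a b).indicator g).rightLim y)) ∧
      Tendsto g (𝓝[<] y) (𝓝 (((ival a b).indicator g).leftLim y)) := by
  have h := boundedVariationOn_indicator_ival hg
  have hI : ival a b ∈ 𝓝 y := (isOpen_ival a b).mem_nhds hy
  constructor
  · refine (h.tendsto_rightLim y).congr' ?_
    filter_upwards [nhdsWithin_le_nhds hI] with t ht using indicator_of_mem ht g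
  · refine (h.tendsto_leftLim y).congr' ?_
    filter_upwards [nhdsWithin_le_nhds hI] with t ht using indicator_of_mem ht g

/-- The interval is a neighbourhood of y, so the extension by zero does not affect the one-sided
limits. This identifies the atoms of q and w with Δ_q and Δ_w. -/
theorem stieltjes_singleton {a b : EReal} {g : ℝ → ℂ} (hg : BoundedVariationOn g (ival a b)) {y : ℝ}
    (hy : y ∈ ival a b) :
    stieltjes (ival a b) g {y} = Function.rightLim g y - Function.leftLim g y := by
  have h := boundedVariationOn_indicator_ival hg
  obtain ⟨h1, h2⟩ := tendsto_limits_of_boundedVariationOn_ival hg hy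
  rw [stieltjes, dif_pos h, VectorMeasure.restrict_apply _ (measurableSet_ival a b)
    (measurableSet_singleton y), singleton_inter_of_mem hy, h.vectorMeasure_singleton,
    rightLim_eq_of_tendsto h1, leftLim_eq_of_tendsto h2]

end Stieltjes

/-! ### Densities of matrix-valued measures -/

section Densities

/-- The variation is at most the sum of the total variations of the real and the imaginary part. -/
theorem isFiniteMeasure_variation (c : ComplexMeasure ℝ) : IsFiniteMeasure c.variation := by
  have h : c.variation ≤ c.re.totalVariation + c.im.totalVariation := by
    refine VectorMeasure.variation_le_of_forall_enorm_le fun E hE => ?_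
    rw [SignedMeasure.totalVariation_eq_variation, SignedMeasure.totalVariation_eq_variation,
      Measure.add_apply]
    refine le_trans ?_ (add_le_add (VectorMeasure.enorm_measure_le_variation _ E)
      (VectorMeasure.enorm_measure_le_variation _ E))
    calc ‖c E‖ₑ = ‖((c E).re : ℂ) + ((c E).im : ℂ) * Complex.I‖ₑ := by rw [Complex.re_add_im]
      _ ≤ ‖((c E).re : ℂ)‖ₑ + ‖((c E).im : ℂ) * Complex.I‖ₑ := enorm_add_le _ _
      _ = _ := by
        simp [← ofReal_norm]; rfl
  exact isFiniteMeasure_of_le _ h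

theorem setIntegral_complexMeasure_rnDeriv {c : ComplexMeasure ℝ} {μ : Measure ℝ}
    [IsFiniteMeasure μ] (h : c.variation ≪ μ) {E : Set ℝ} (hE : MeasurableSet E) :
    ∫ y in E, c.rnDeriv μ y ∂μ = c E := by
  have hac : c ≪ᵥ μ.toENNRealVectorMeasure := by
    refine VectorMeasure.AbsolutelyContinuous.mk fun s hs hs0 => ?_
    rw [Measure.toENNRealVectorMeasure_apply_measurable hs] at hs0
    have := (VectorMeasure.enorm_measure_le_variation c s).trans (h hs0).le
    simpa using this
  rw [ComplexMeasure.absolutelyContinuous_ennreal_iff] at hac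
  have h1 := SignedMeasure.withDensityᵥ_rnDeriv_eq _ _ hac.1
  have h2 := SignedMeasure.withDensityᵥ_rnDeriv_eq _ _ hac.2
  have i1 := SignedMeasure.integrable_rnDeriv c.re μ
  have i2 := SignedMeasure.integrable_rnDeriv c.im μ
  have ic := (ComplexMeasure.integrable_rnDeriv c μ).integrableOn (s := E)
  apply Complex.ext
  · have e := congrArg (fun v : SignedMeasure ℝ => v E) h1
    simp only [withDensityᵥ_apply i1 hE] at e
    rw [← RCLike.re_eq_complex_re, ← integral_re ic]
    exact e
  · have e := congrArg (fun v : SignedMeasure ℝ => v E) h2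
    simp only [withDensityᵥ_apply i2 hE] at e
    rw [← RCLike.im_eq_complex_im, ← integral_im ic]
    exact e

namespace MatMeasure

variable {n : ℕ} (μ : MatMeasure n)

instance : IsFiniteMeasure μ.ref := by
  have := fun i k => isFiniteMeasure_variation (μ i k)
  unfold ref
  infer_instance

theorem variation_le_ref (i k : Fin n) : (μ i k).variation ≤ μ.ref := by
  unfold ref
  exact (Finset.single_le_sum (f := fun k => (μ i k).variation) (fun _ _ => Measure.zero_le _)
    (Finset.mem_univ k)).trans (Finset.single_le_sum (f := fun i => ∑ k, (μ i k).variation)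
      (fun _ _ => Measure.zero_le _) (Finset.mem_univ i))

theorem integrable_dens (i k : Fin n) : Integrable (fun y => μ.dens y i k) μ.ref :=
  ComplexMeasure.integrable_rnDeriv _ _

theorem setIntegral_dens (i k : Fin n) {E : Set ℝ} (hE : MeasurableSet E) :
    ∫ y in E, μ.dens y i k ∂μ.ref = μ.val E i k :=
  setIntegral_complexMeasure_rnDeriv (Measure.absolutelyContinuous_of_le (μ.variation_le_ref i k))
      hE

/-- The density of `μ` with respect to a positive measure `ν` which dominates `μ.ref`. -/
def densWrt (ν : Measure ℝ) (y : ℝ) : Matrix (Fin n) (Fin n) ℂ :=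
  (μ.ref.rnDeriv ν y).toReal • μ.dens y

variable {μ} {ν : Measure ℝ}

/-- The reference measures of q and w differ; this moves both pairings to one common ν. -/
theorem pair_eq (h : μ.ref ≪ ν) [SigmaFinite ν] (g : ℝ → Fin n → ℂ) (φ : ℝ → ℝ) :
    μ.pair g φ = ∫ y, φ y • (μ.densWrt ν y *ᵥ g y) ∂ν := by
  rw [pair, ← integral_rnDeriv_smul h]
  refine integral_congr_ae (Eventually.of_forall fun y => ?_)
  simp only [densWrt, Matrix.smul_mulVec]
  rw [smul_comm]

theorem integrable_densWrt (h : μ.ref ≪ ν) [SigmaFinite ν] (i k : Fin n) :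
    Integrable (fun y => μ.densWrt ν y i k) ν :=
  (integrable_rnDeriv_smul_iff h).2 (μ.integrable_dens i k)

theorem setIntegral_densWrt (h : μ.ref ≪ ν) [SigmaFinite ν] (i k : Fin n) {E : Set ℝ}
    (hE : MeasurableSet E) : ∫ y in E, μ.densWrt ν y i k ∂ν = μ.val E i k := by
  rw [← μ.setIntegral_dens i k hE, ← setIntegral_rnDeriv_smul h hE]
  rfl

/-- It also holds when ν has no mass at y, where both sides vanish by absolute continuity. -/
theorem real_smul_densWrt (h : μ.ref ≪ ν) [SigmaFinite ν] (y : ℝ) :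
    ν.real {y} • μ.densWrt ν y = μ.val {y} := by
  ext i k
  rw [← setIntegral_densWrt h i k (measurableSet_singleton y), integral_singleton]
  rfl

theorem ae_isHermitian_densWrt (h : μ.ref ≪ ν) [SigmaFinite ν]
    (hμ : ∀ E : Set ℝ, MeasurableSet E → (μ.val E).IsHermitian) :
    ∀ᵐ y ∂ν, (μ.densWrt ν y).IsHermitian := by
  have key : ∀ i k, ∀ᵐ y ∂ν, star (μ.densWrt ν y k i) = μ.densWrt ν y i k := fun i k => by
    refine Integrable.ae_eq_of_forall_setIntegral_eq (fun y => star (μ.densWrt ν y k i))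
      (fun y => μ.densWrt ν y i k) ?_ (integrable_densWrt h i k) fun E hE _ => ?_
    · exact Complex.conjCLE.integrable_comp_iff.2 (integrable_densWrt h k i)
    · rw [setIntegral_densWrt h i k hE]
      have : ∫ y in E, star (μ.densWrt ν y k i) ∂ν = star (∫ y in E, μ.densWrt ν y k i ∂ν) :=
        integral_conj
      rw [this, setIntegral_densWrt h k i hE]
      exact (hμ E hE).apply i k
  filter_upwards [ae_all_iff.2 fun i => ae_all_iff.2 (key i)] with y hy
  exact Matrix.IsHermitian.ext hy

end MatMeasure

end Densities

/-! ### Non-negative matrix measures and integrability of wf -/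

section Positive

variable {n : ℕ}

open scoped MatrixOrder in
-- Write M = B*B. Then (Mv)_i is the inner product of the i-th column of B with Bv, and 2|xy| ≤ |x|²
-- + |y|² applies termwise. Only the trace part of M and the form v*Mv enter the bound, which is
-- what square integrability controls.
theorem norm_mulVec_le_of_posSemidef {M : Matrix (Fin n) (Fin n) ℂ} (hM : M.PosSemidef)
    (v : Fin n → ℂ) (i : Fin n) :
    ‖(M *ᵥ v) i‖ ≤ 1 / 2 * ((M i i).re + (star v ⬝ᵥ (M *ᵥ v)).re) := by
  obtain ⟨B, rfl⟩ := CStarAlgebra.nonneg_iff_eq_star_mul_self.mp hM.nonneg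
  have h1 : ((star B * B) *ᵥ v) i = ∑ k, star (B k i) * (B *ᵥ v) k := by
    rw [← Matrix.mulVec_mulVec]
    rfl
  have h2 : ((star B * B) i i).re = ∑ k, ‖B k i‖ ^ 2 := by
    rw [Matrix.mul_apply, Complex.re_sum]
    refine Finset.sum_congr rfl fun k _ => ?_
    rw [Matrix.star_apply, ← Complex.normSq_eq_norm_sq]
    simp [Complex.normSq_apply]
  have h3 : (star v ⬝ᵥ ((star B * B) *ᵥ v)).re = ∑ k, ‖(B *ᵥ v) k‖ ^ 2 := by
    rw [← Matrix.mulVec_mulVec, Matrix.dotProduct_mulVec, Matrix.star_eq_conjTranspose,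
      Matrix.vecMul_conjTranspose, star_star, dotProduct, Complex.re_sum]
    refine Finset.sum_congr rfl fun k _ => ?_
    rw [Pi.star_apply, ← Complex.normSq_eq_norm_sq]
    simp [Complex.normSq_apply]
  rw [h1, h2, h3, ← Finset.sum_add_distrib, Finset.mul_sum]
  refine norm_sum_le_of_le _ fun k _ => ?_
  rw [norm_mul, norm_star]
  nlinarith [sq_nonneg (‖B k i‖ - ‖(B *ᵥ v) k‖)]

namespace MatMeasure

variable {μ : MatMeasure n}

theorem ae_isHermitian_dens (hμ : ∀ E : Set ℝ, MeasurableSet E → (μ.val E).IsHermitian) :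
    ∀ᵐ y ∂μ.ref, (μ.dens y).IsHermitian := by
  filter_upwards [ae_isHermitian_densWrt Measure.AbsolutelyContinuous.rfl hμ,
    Measure.rnDeriv_self μ.ref] with y hy h1
  simpa [densWrt, h1] using hy

theorem dotProduct_mulVec_eq_sum (M : Matrix (Fin n) (Fin n) ℂ) (v : Fin n → ℂ) :
    star v ⬝ᵥ (M *ᵥ v) = ∑ i, ∑ k, (star (v i) * v k) * M i k := by
  simp only [dotProduct, Matrix.mulVec, Finset.mul_sum, Pi.star_apply]
  refine Finset.sum_congr rfl fun i _ => Finset.sum_congr rfl fun k _ => by ring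

theorem ae_posSemidef_dens (hμ : ∀ E : Set ℝ, MeasurableSet E → (μ.val E).PosSemidef) :
    ∀ᵐ y ∂μ.ref, (μ.dens y).PosSemidef := by
  have key : ∀ v : Fin n → ℂ, ∀ᵐ y ∂μ.ref, 0 ≤ (star v ⬝ᵥ (μ.dens y *ᵥ v)).re := fun v => by
    have hi : Integrable (fun y => star v ⬝ᵥ (μ.dens y *ᵥ v)) μ.ref := by
      simp only [dotProduct_mulVec_eq_sum]
      exact integrable_finsetSum _ fun i _ => integrable_finsetSum _ fun k _ =>
        (μ.integrable_dens i k).const_mul _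
    refine ae_nonneg_of_forall_setIntegral_nonneg hi.re fun E hE _ => ?_
    have h1 : ∫ y in E, star v ⬝ᵥ (μ.dens y *ᵥ v) ∂μ.ref = star v ⬝ᵥ (μ.val E *ᵥ v) := by
      simp only [dotProduct_mulVec_eq_sum]
      rw [integral_finsetSum _ fun i _ => integrable_finsetSum _ fun k _ =>
        ((μ.integrable_dens i k).const_mul _).integrableOn]
      refine Finset.sum_congr rfl fun i _ => ?_
      rw [integral_finsetSum _ fun k _ => ((μ.integrable_dens i k).const_mul _).integrableOn]
      refine Finset.sum_congr rfl fun k _ => ?_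
      rw [integral_const_mul, μ.setIntegral_dens i k hE]
    have h2 : ∫ y in E, (star v ⬝ᵥ (μ.dens y *ᵥ v)).re ∂μ.ref =
        (∫ y in E, star v ⬝ᵥ (μ.dens y *ᵥ v) ∂μ.ref).re := integral_re hi.integrableOn
    change 0 ≤ ∫ y in E, (star v ⬝ᵥ (μ.dens y *ᵥ v)).re ∂μ.ref
    rw [h2, h1]
    exact (Complex.le_def.1 ((Matrix.posSemidef_iff_dotProduct_mulVec.1 (hμ E hE)).2 v)).1
  -- A countable dense set of vectors yields one common null set; continuity of the quadratic form
  -- in v does the rest.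
  filter_upwards [ae_isHermitian_dens fun E hE => (hμ E hE).1,
    ae_all_iff.2 fun k => key (TopologicalSpace.denseSeq (Fin n → ℂ) k)] with y hH hy
  refine Matrix.posSemidef_iff_dotProduct_mulVec.2 ⟨hH, fun v => ?_⟩
  have hcont : Continuous fun v : Fin n → ℂ => (star v ⬝ᵥ (μ.dens y *ᵥ v)).re := by
    simp only [dotProduct_mulVec_eq_sum]
    fun_prop
  have hre : 0 ≤ (star v ⬝ᵥ (μ.dens y *ᵥ v)).re := by
    have hcl : IsClosed {v : Fin n → ℂ | 0 ≤ (star v ⬝ᵥ (μ.dens y *ᵥ v)).re} :=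
      isClosed_le continuous_const hcont
    have hd := (TopologicalSpace.denseRange_denseSeq (Fin n → ℂ)).closure_range
    have : v ∈ closure (range (TopologicalSpace.denseSeq (Fin n → ℂ))) := by rw [hd]; trivial
    exact closure_minimal (by rintro _ ⟨k, rfl⟩; exact hy k) hcl this
  refine Complex.le_def.2 ⟨hre, ?_⟩
  have := hH.im_star_dotProduct_mulVec_self v
  exact this.symm

/-- `w f` is a finite vector measure if `f ∈ 𝓛²(w)`. -/
theorem MemL2.integrable_dens_mulVec (hμ : ∀ E : Set ℝ, MeasurableSet E → (μ.val E).PosSemidef)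
    {f : ℝ → Fin n → ℂ} (hf : μ.MemL2 f) : Integrable (fun y => μ.dens y *ᵥ f y) μ.ref := by
  refine Integrable.of_eval fun i => ?_
  have hm : AEStronglyMeasurable (fun y => (μ.dens y *ᵥ f y) i) μ.ref := by
    have h1 : ∀ k ∈ Finset.univ, AEStronglyMeasurable (fun y => μ.dens y i k * f y k) μ.ref :=
      fun k _ => (μ.integrable_dens i k).1.mul ((continuous_apply k).comp_aestronglyMeasurable hf.1)
    exact Finset.aestronglyMeasurable_fun_sum _ h1
  refine ((((μ.integrable_dens i i).re).add hf.2).const_mul (1 / 2)).mono' hm ?_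
  filter_upwards [ae_posSemidef_dens hμ] with y hy using norm_mulVec_le_of_posSemidef hy _ _

theorem MemL2.integrable_densWrt_mulVec
    (hμ : ∀ E : Set ℝ, MeasurableSet E → (μ.val E).PosSemidef) {ν : Measure ℝ} [SigmaFinite ν]
    (h : μ.ref ≪ ν) {f : ℝ → Fin n → ℂ} (hf : μ.MemL2 f) :
    Integrable (fun y => μ.densWrt ν y *ᵥ f y) ν := by
  refine ((integrable_rnDeriv_smul_iff h).2 (hf.integrable_dens_mulVec hμ)).congr
    (Eventually.of_forall fun y => ?_)
  simp only [densWrt, Matrix.smul_mulVec]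

end MatMeasure

end Positive

/-! ### Matrices as continuous linear maps -/

section MatrixCLM

variable {n : ℕ}

/-- Multiplication by a matrix as a continuous linear map. -/
def mulVecCLM (M : Matrix (Fin n) (Fin n) ℂ) : (Fin n → ℂ) →L[ℝ] (Fin n → ℂ) :=
  LinearMap.toContinuousLinearMap ((Matrix.mulVecLin M).restrictScalars ℝ)

@[simp] theorem mulVecCLM_apply (M : Matrix (Fin n) (Fin n) ℂ) (v : Fin n → ℂ) :
    mulVecCLM M v = M *ᵥ v := rfl

theorem isUnit_mulVecCLM {M : Matrix (Fin n) (Fin n) ℂ} (h : IsUnit M) : IsUnit (mulVecCLM M) := by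
  obtain ⟨U, rfl⟩ := h
  refine ⟨⟨mulVecCLM U, mulVecCLM (U⁻¹ : (Matrix (Fin n) (Fin n) ℂ)ˣ), ?_, ?_⟩, rfl⟩
  · ext v : 1
    change (U : Matrix (Fin n) (Fin n) ℂ) *ᵥ (((U⁻¹ : (Matrix (Fin n) (Fin n) ℂ)ˣ) :
      Matrix (Fin n) (Fin n) ℂ) *ᵥ v) = v
    rw [Matrix.mulVec_mulVec, Units.mul_inv, Matrix.one_mulVec]
  · ext v : 1
    change ((U⁻¹ : (Matrix (Fin n) (Fin n) ℂ)ˣ) : Matrix (Fin n) (Fin n) ℂ) *ᵥ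
      ((U : Matrix (Fin n) (Fin n) ℂ) *ᵥ v) = v
    rw [Matrix.mulVec_mulVec, Units.inv_mul, Matrix.one_mulVec]

/-- `mulVecCLM` as a linear map on arrays. -/
def mulVecCLMₗ (n : ℕ) : (Fin n → Fin n → ℂ) →ₗ[ℝ] ((Fin n → ℂ) →L[ℝ] (Fin n → ℂ)) where
  toFun M := mulVecCLM (Matrix.of M)
  map_add' M M' := by
    ext v : 1
    exact Matrix.add_mulVec (Matrix.of M) (Matrix.of M') v
  map_smul' r M := by
    ext v : 1
    exact Matrix.smul_mulVec r (Matrix.of M) v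

theorem integrable_mulVecCLM {μ : Measure ℝ} {M : ℝ → Matrix (Fin n) (Fin n) ℂ}
    (h : ∀ i k, Integrable (fun y => M y i k) μ) : Integrable (fun y => mulVecCLM (M y)) μ := by
  have h1 : Integrable (fun y i k => M y i k) μ :=
    Integrable.of_eval fun i => Integrable.of_eval fun k => h i k
  exact (LinearMap.toContinuousLinearMap (mulVecCLMₗ n)).integrable_comp h1

end MatrixCLM

/-! ### Measurability, bounds and limits under locally bounded variation -/

section BoundedVariation

theorem aemeasurable_of_locallyBoundedVariationOn {f : ℝ → ℝ} {S : Set ℝ} (hS : MeasurableSet S)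
    (h : LocallyBoundedVariationOn f S) (ρ : Measure ℝ) : AEMeasurable f (ρ.restrict S) := by
  obtain ⟨p, r, hp, hr, rfl⟩ := h.exists_monotoneOn_sub_monotoneOn
  exact (aemeasurable_restrict_of_monotoneOn hS hp).sub (aemeasurable_restrict_of_monotoneOn hS hr)

/-- Real and imaginary parts of the components are differences of monotone functions. The measure is
arbitrary, so the lemma serves both ν and Lebesgue measure. -/
theorem aestronglyMeasurable_of_locallyBoundedVariationOn {n : ℕ} {u : ℝ → Fin n → ℂ} {S : Set ℝ}
    (hS : MeasurableSet S) (h : LocallyBoundedVariationOn u S) (ρ : Measure ℝ) :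
    AEStronglyMeasurable u (ρ.restrict S) := by
  refine AEMeasurable.aestronglyMeasurable (aemeasurable_pi_iff.2 fun i => ?_)
  have hl : LipschitzWith 1 fun v : Fin n → ℂ => v i := LipschitzWith.eval i
  have h1 := (Complex.reCLM.lipschitz.comp hl).comp_locallyBoundedVariationOn h
  have h2 := (Complex.imCLM.lipschitz.comp hl).comp_locallyBoundedVariationOn h
  have m1 := aemeasurable_of_locallyBoundedVariationOn hS h1 ρ
  have m2 := aemeasurable_of_locallyBoundedVariationOn hS h2 ρ
  refine ((Complex.measurable_ofReal.comp_aemeasurable m1).add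
    ((Complex.measurable_ofReal.comp_aemeasurable m2).mul_const Complex.I)).congr
    (Eventually.of_forall fun y => ?_)
  exact Complex.re_add_im (u y i)

theorem exists_norm_le_of_locallyBoundedVariationOn {E : Type*} [NormedAddCommGroup E]
    {c d : EReal} {u : ℝ → E} (h : LocallyBoundedVariationOn u (ival c d)) {s t : ℝ}
    (hs : s ∈ ival c d) (ht : t ∈ ival c d) : ∃ M, ∀ y ∈ Icc s t, ‖u y‖ ≤ M := by
  have hBVst : BoundedVariationOn u (ival c d ∩ Icc s t) := h s t hs ht
  refine ⟨(eVariationOn u (ival c d ∩ Icc s t)).toReal + ‖u s‖, fun y hy => ?_⟩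
  have h1 := hBVst.dist_le ⟨Icc_subset_ival hs ht hy, hy⟩
    ⟨hs, left_mem_Icc.2 (hy.1.trans hy.2)⟩
  rw [dist_eq_norm] at h1
  calc ‖u y‖ = ‖(u y - u s) + u s‖ := by rw [sub_add_cancel]
    _ ≤ _ := (norm_add_le _ _).trans (add_le_add h1 le_rfl)

theorem exists_norm_le_on_compact {E : Type*} [NormedAddCommGroup E]
    {c d : EReal} {u : ℝ → E} (h : LocallyBoundedVariationOn u (ival c d)) {K : Set ℝ}
    (hK : IsCompact K) (hKS : K ⊆ ival c d) : ∃ M, ∀ y ∈ K, ‖u y‖ ≤ M := by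
  rcases K.eq_empty_or_nonempty with rfl | hne
  · exact ⟨0, by simp⟩
  obtain ⟨s, hs, h1⟩ := hK.exists_isLeast hne
  obtain ⟨t, ht, h2⟩ := hK.exists_isGreatest hne
  obtain ⟨M, hM⟩ := exists_norm_le_of_locallyBoundedVariationOn h (hKS hs) (hKS ht)
  exact ⟨M, fun y hy => hM y ⟨h1 hy, h2 hy⟩⟩

theorem tendsto_limits_of_locallyBoundedVariationOn {E : Type*} [NormedAddCommGroup E]
    [CompleteSpace E] {c d : EReal} {u : ℝ → E} (h : LocallyBoundedVariationOn u (ival c d)) {y : ℝ}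
    (hy : y ∈ ival c d) :
    Tendsto u (𝓝[>] y) (𝓝 (Function.rightLim u y)) ∧
      Tendsto u (𝓝[<] y) (𝓝 (Function.leftLim u y)) := by
  obtain ⟨α, hα, hαy⟩ := exists_lt_mem_ival hy
  obtain ⟨β, hβ, hβy⟩ := exists_gt_mem_ival hy
  have hBV : BoundedVariationOn u (ival α β) := BoundedVariationOn.mono (h α β hα hβ)
    fun t ht => by
      have h1 : t ∈ Icc α β := ⟨EReal.coe_le_coe_iff.1 ht.1.le, EReal.coe_le_coe_iff.1 ht.2.le⟩
      exact ⟨Icc_subset_ival hα hβ h1, h1⟩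
  obtain ⟨h1, h2⟩ := tendsto_limits_of_boundedVariationOn_ival hBV
    (y := y) ⟨EReal.coe_lt_coe_iff.2 hαy, EReal.coe_lt_coe_iff.2 hβy⟩
  rw [rightLim_eq_of_tendsto h1, leftLim_eq_of_tendsto h2]
  exact ⟨h1, h2⟩

end BoundedVariation

/-! ### Equivalence of the differential and the integrated equation -/

section IntegralForm

variable {n : ℕ}

/-- The coefficient `A = J⁻¹(z w - q)`, as a density with respect to `ν`. -/
def coefA (J : Matrix (Fin n) (Fin n) ℂ) (q w : MatMeasure n) (ν : Measure ℝ) (z : ℂ) (y : ℝ) :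
    Matrix (Fin n) (Fin n) ℂ := J⁻¹ * (z • w.densWrt ν y - q.densWrt ν y)

/-- The density of `u'` with respect to `ν`, if `u` solves `Ju' + (q - z w)u = wf`. -/
def rhs (J : Matrix (Fin n) (Fin n) ℂ) (q w : MatMeasure n) (ν : Measure ℝ) (z : ℂ)
    (f u : ℝ → Fin n → ℂ) (y : ℝ) : Fin n → ℂ :=
  coefA J q w ν z y *ᵥ u y + J⁻¹ *ᵥ (w.densWrt ν y *ᵥ f y)

variable {J : Matrix (Fin n) (Fin n) ℂ} {q w : MatMeasure n} {ν : Measure ℝ} {z : ℂ}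
  {f u : ℝ → Fin n → ℂ} {c d : EReal}

theorem mulVec_rhs (hJ : IsUnit J) (y : ℝ) :
    J *ᵥ rhs J q w ν z f u y =
      z • (w.densWrt ν y *ᵥ u y) - q.densWrt ν y *ᵥ u y + w.densWrt ν y *ᵥ f y := by
  have h : J * J⁻¹ = 1 := Matrix.mul_nonsing_inv _ ((Matrix.isUnit_iff_isUnit_det J).1 hJ)
  rw [rhs, coefA, Matrix.mulVec_add, Matrix.mulVec_mulVec, Matrix.mulVec_mulVec, ← mul_assoc, h,
    one_mul, Matrix.one_mulVec, Matrix.sub_mulVec, Matrix.smul_mulVec]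

theorem mulVec_injective_of_isUnit (hJ : IsUnit J) {x y : Fin n → ℂ} (h : J *ᵥ x = J *ᵥ y) :
    x = y := by
  have h1 : J⁻¹ * J = 1 := Matrix.nonsing_inv_mul _ ((Matrix.isUnit_iff_isUnit_det J).1 hJ)
  have := congrArg (fun v => J⁻¹ *ᵥ v) h
  simpa [Matrix.mulVec_mulVec, h1] using this

theorem integrable_coefA [IsFiniteMeasure ν] (hq : q.ref ≪ ν) (hw : w.ref ≪ ν) :
    Integrable (fun y => mulVecCLM (coefA J q w ν z y)) ν := by
  refine integrable_mulVecCLM fun i k => ?_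
  simp only [coefA, Matrix.mul_apply, Matrix.sub_apply, Matrix.smul_apply, smul_eq_mul]
  exact integrable_finsetSum _ fun l _ => (((MatMeasure.integrable_densWrt hw l k).const_mul z).sub
    (MatMeasure.integrable_densWrt hq l k)).const_mul _

theorem integrable_mulVec {μ : Measure ℝ} {g : ℝ → Fin n → ℂ} (hg : Integrable g μ)
    (M : Matrix (Fin n) (Fin n) ℂ) : Integrable (fun y => M *ᵥ g y) μ :=
  (mulVecCLM M).integrable_comp hg

theorem integral_mulVec {μ : Measure ℝ} {g : ℝ → Fin n → ℂ} (hg : Integrable g μ)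
    (M : Matrix (Fin n) (Fin n) ℂ) : ∫ y, M *ᵥ g y ∂μ = M *ᵥ ∫ y, g y ∂μ :=
  (mulVecCLM M).integral_comp_comm hg

theorem integrable_test_smul_mulVec {μ : Measure ℝ} {M : ℝ → Matrix (Fin n) (Fin n) ℂ}
    (hM : ∀ i k, Integrable (fun y => M y i k) μ)
    (hu : LocallyBoundedVariationOn u (ival c d)) {φ : ℝ → ℝ} (hφ : Continuous φ)
    (hc : HasCompactSupport φ) (hS : tsupport φ ⊆ ival c d) :
    Integrable (fun y => φ y • (M y *ᵥ u y)) μ := by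
  have hK : IsCompact (tsupport φ) := hc
  obtain ⟨C, hC⟩ := exists_norm_le_on_compact hu hK hS
  have h1 : AEStronglyMeasurable ((tsupport φ).indicator u) μ := by
    rw [aestronglyMeasurable_indicator_iff (isClosed_tsupport φ).measurableSet]
    exact (aestronglyMeasurable_of_locallyBoundedVariationOn (measurableSet_ival c d) hu
        μ).mono_measure
      (Measure.restrict_mono hS le_rfl)
  have h2 : ∀ y, ‖(tsupport φ).indicator u y‖ ≤ |C| := fun y => by
    by_cases hy : y ∈ tsupport φ
    · rw [indicator_of_mem hy]; exact (hC y hy).trans (le_abs_self C)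
    · rw [indicator_of_notMem hy, norm_zero]; positivity
  have h3 := integrable_clm_apply (integrable_mulVecCLM hM) h1 (Eventually.of_forall h2)
  refine (integrable_smul_of_contDiff h3 hφ hc).congr (Eventually.of_forall fun y => ?_)
  by_cases hy : y ∈ tsupport φ
  · simp [indicator_of_mem hy]
  · simp [image_eq_zero_of_notMem_tsupport hy]

theorem integrable_deriv_smul (hu : LocallyBoundedVariationOn u (ival c d)) {φ : ℝ → ℝ}
    (hφ : ContDiff ℝ ∞ φ) (hc : HasCompactSupport φ) (hS : tsupport φ ⊆ ival c d) :
    Integrable (fun y => deriv φ y • u y) := by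
  have hK : IsCompact (tsupport φ) := hc
  have hfin : IsFiniteMeasure ((volume : Measure ℝ).restrict (tsupport φ)) :=
    ⟨by rw [Measure.restrict_apply_univ]; exact hK.measure_lt_top⟩
  have h1 := integrable_test_smul_mulVec (μ := (volume : Measure ℝ).restrict (tsupport φ))
    (M := fun _ => (1 : Matrix (Fin n) (Fin n) ℂ))
    (fun i k => integrable_const ((1 : Matrix (Fin n) (Fin n) ℂ) i k)) hu
    (hφ.continuous_deriv (by simp)) hc.deriv (tsupport_deriv_subset.trans hS)
  simp only [Matrix.one_mulVec] at h1
  refine (integrableOn_iff_integrable_of_support_subset fun y hy => ?_).1 h1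
  by_contra hcon
  refine hy ?_
  simp only
  rw [image_eq_zero_of_notMem_tsupport fun h' => hcon (tsupport_deriv_subset h'), zero_smul]

/-- The two identities differ by multiplication with J. All terms are integrable because u is
bounded on the compact support of φ. -/
theorem weak_equation_iff [IsFiniteMeasure ν] (hJ : IsUnit J) (hq : q.ref ≪ ν) (hw : w.ref ≪ ν)
    (hf : Integrable (fun y => w.densWrt ν y *ᵥ f y) ν)
    (hu : LocallyBoundedVariationOn u (ival c d)) {φ : ℝ → ℝ} (hφ : ContDiff ℝ ∞ φ)
    (hc : HasCompactSupport φ) (hS : tsupport φ ⊆ ival c d) :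
    (-(∫ y, deriv φ y • (J *ᵥ u y)) + q.pair u φ - z • w.pair u φ = w.pair f φ) ↔
      ∫ y, deriv φ y • u y = -∫ y, φ y • rhs J q w ν z f u y ∂ν := by
  have i1 := integrable_test_smul_mulVec (fun i k => MatMeasure.integrable_densWrt hq i k) hu
    hφ.continuous hc hS
  have i2 := integrable_test_smul_mulVec (fun i k => MatMeasure.integrable_densWrt hw i k) hu
    hφ.continuous hc hS
  have i3 := integrable_smul_of_contDiff hf hφ.continuous hc
  have i4 := integrable_deriv_smul hu hφ hc hS
  have e1 : ∫ y, deriv φ y • (J *ᵥ u y) = J *ᵥ ∫ y, deriv φ y • u y := by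
    rw [← integral_mulVec i4]
    simp only [Matrix.mulVec_smul]
  have e2 : ∀ y, J *ᵥ (φ y • rhs J q w ν z f u y) = z • (φ y • (w.densWrt ν y *ᵥ u y)) -
      φ y • (q.densWrt ν y *ᵥ u y) + φ y • (w.densWrt ν y *ᵥ f y) := fun y => by
    rw [Matrix.mulVec_smul, mulVec_rhs hJ, smul_add, smul_sub, smul_comm (φ y) z]
  have i5 : Integrable (fun y => φ y • rhs J q w ν z f u y) ν := by
    have h1 : Integrable (fun y => J *ᵥ (φ y • rhs J q w ν z f u y)) ν := by
      simp only [e2]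
      exact ((i2.smul z).sub i1).add i3
    have h2 := integrable_mulVec h1 J⁻¹
    simpa only [Matrix.mulVec_mulVec, Matrix.nonsing_inv_mul _
      ((Matrix.isUnit_iff_isUnit_det J).1 hJ), Matrix.one_mulVec] using h2
  have i6 : Integrable (fun y => z • (φ y • (w.densWrt ν y *ᵥ u y))) ν := i2.smul z
  have i7 : Integrable (fun y => z • (φ y • (w.densWrt ν y *ᵥ u y)) -
      φ y • (q.densWrt ν y *ᵥ u y)) ν := i6.sub i1
  have e3 : J *ᵥ ∫ y, φ y • rhs J q w ν z f u y ∂ν =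
      z • w.pair u φ - q.pair u φ + w.pair f φ := by
    rw [← integral_mulVec i5]
    simp only [e2]
    rw [integral_add i7 i3, integral_sub i6 i1, integral_smul, ← MatMeasure.pair_eq hw,
      ← MatMeasure.pair_eq hq, ← MatMeasure.pair_eq hw]
  rw [e1]
  constructor
  · intro h
    refine mulVec_injective_of_isUnit hJ ?_
    rw [Matrix.mulVec_neg, e3, ← h]
    abel
  · intro h
    rw [h, Matrix.mulVec_neg, e3]
    abel

theorem smul_half_eq (v : Fin n → ℂ) : (1 / 2 : ℂ) • v = (1 / 2 : ℝ) • v := by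
  ext i
  simp

/-- `Function.leftLim` and `Function.rightLim` have default values where no limit exists; locally
bounded variation makes them genuine limits. -/
theorem isBalancedBV_iff : IsBalancedBV (ival c d) u ↔
    LocallyBoundedVariationOn u (ival c d) ∧ IsBalancedOn u (ival c d) ∧
      ∀ y, y ∉ ival c d → u y = 0 := by
  unfold IsBalancedBV
  refine and_congr_right fun hBV => and_congr_left fun _ => forall₂_congr fun y hy => ?_
  obtain ⟨hr, hl⟩ := tendsto_limits_of_locallyBoundedVariationOn hBV hy
  rw [smul_half_eq]
  constructor
  · exact fun h => ⟨_, _, hl, hr, h⟩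
  · rintro ⟨l, r, hl', hr', h⟩
    rw [tendsto_nhds_unique hl hl', tendsto_nhds_unique hr hr', h]

/-- Solutions in the sense of distributions are the solutions of the integrated equation. -/
theorem isSolution_iff [IsFiniteMeasure ν] (hJ : IsUnit J) (hq : q.ref ≪ ν) (hw : w.ref ≪ ν)
    (hf : Integrable (fun y => w.densWrt ν y *ᵥ f y) ν) (hcd : c < d) :
    IsSolution J q w z f (ival c d) u ↔ (∀ y, y ∉ ival c d → u y = 0) ∧
      IntegrableOn (rhs J q w ν z f u) (ival c d) ν ∧
      ∃ ξ, ∀ t ∈ ival c d, u t = bal (ν.restrict (ival c d)) ξ (rhs J q w ν z f u) t := by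
  rw [IsSolution, isBalancedBV_iff]
  constructor
  · rintro ⟨⟨hBV, hb, h0⟩, hweak⟩
    exact ⟨h0, exists_eq_bal_of_weak_linear hcd
        (integrable_coefA hq hw (J := J) (z := z)).integrableOn
      (integrable_mulVec hf J⁻¹).integrableOn hBV
      (aestronglyMeasurable_of_locallyBoundedVariationOn (measurableSet_ival c d) hBV) hb
      fun φ h1 h2 h3 => (weak_equation_iff hJ hq hw hf hBV h1 h2 h3).1 (hweak φ h1 h2 h3)⟩
  · rintro ⟨h0, hi, ξ, hξ⟩
    have hBV : LocallyBoundedVariationOn u (ival c d) := by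
      intro s t hs ht
      rw [BoundedVariationOn, eVariationOn.eq_of_eqOn fun y (hy : y ∈ ival c d ∩ Icc s t) =>
          hξ y hy.1]
      exact locallyBoundedVariationOn_bal hi ξ _ s t hs ht
    have hb : IsBalancedOn u (ival c d) := by
      intro y hy
      obtain ⟨l, r, hl, hr, h⟩ := isBalancedOn_bal hi ξ (ival c d) y hy
      have hS : ival c d ∈ 𝓝 y := (isOpen_ival c d).mem_nhds hy
      refine ⟨l, r, hl.congr' ?_, hr.congr' ?_, (hξ y hy).trans h⟩
      · filter_upwards [nhdsWithin_le_nhds hS] with t ht using (hξ t ht).symm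
      · filter_upwards [nhdsWithin_le_nhds hS] with t ht using (hξ t ht).symm
    refine ⟨⟨hBV, hb, h0⟩, fun φ h1 h2 h3 => (weak_equation_iff hJ hq hw hf hBV h1 h2 h3).2 ?_⟩
    have hz : ∀ t ∉ ival c d, φ t = 0 := fun t ht =>
      image_eq_zero_of_notMem_tsupport fun h' => ht (h3 h')
    have hz' : ∀ t ∉ ival c d, deriv φ t = 0 := fun t ht =>
      image_eq_zero_of_notMem_tsupport fun h' => ht (h3 (tsupport_deriv_subset h'))
    have e := integral_deriv_smul_bal hi ξ h1 h2
    rw [setIntegral_eq_integral_of_forall_compl_eq_zero fun y hy => by rw [hz y hy, zero_smul]] at e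
    rw [← e]
    refine integral_congr_ae (Eventually.of_forall fun t => ?_)
    by_cases ht : t ∈ ival c d
    · simp only [hξ t ht]
    · simp only [hz' t ht, zero_smul]

end IntegralForm

/-! ### Solutions with right limits prescribed on a finite set -/

section Solvability

variable {n : ℕ} {J : Matrix (Fin n) (Fin n) ℂ} {q w : MatMeasure n} {ν : Measure ℝ} {z : ℂ}
  {f u : ℝ → Fin n → ℂ} {c d : EReal}

/-- Since ν{y} times a density is the mass at y, the operator is multiplication by J⁻¹B₊(y, z). -/
theorem isUnit_one_sub_mulVecCLM_coefA [IsFiniteMeasure ν] (hJ : IsUnit J) (hq : q.ref ≪ ν)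
    (hw : w.ref ≪ ν) {y : ℝ} (hB : IsUnit (J + (1 / 2 : ℂ) • (q.val {y} - z • w.val {y}))) :
    IsUnit (1 - (ν.real {y} / 2) • mulVecCLM (coefA J q w ν z y)) := by
  have h : J⁻¹ * J = 1 := Matrix.nonsing_inv_mul _ ((Matrix.isUnit_iff_isUnit_det J).1 hJ)
  have h1 : IsUnit (J⁻¹) := (Matrix.isUnit_nonsing_inv_iff).2 hJ
  have h2 : 1 - (ν.real {y} / 2) • mulVecCLM (coefA J q w ν z y) =
      mulVecCLM (J⁻¹ * (J + (1 / 2 : ℂ) • (q.val {y} - z • w.val {y}))) := by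
    have h3 : (ν.real {y} / 2) • coefA J q w ν z y =
        (1 / 2 : ℂ) • (J⁻¹ * (z • w.val {y} - q.val {y})) := by
      rw [← MatMeasure.real_smul_densWrt hq, ← MatMeasure.real_smul_densWrt hw, coefA]
      rw [smul_comm z, ← smul_sub, Matrix.mul_smul]
      ext i k
      simp only [Matrix.smul_apply, Complex.real_smul, smul_eq_mul]
      push_cast
      ring
    have h4 : (ν.real {y} / 2) • mulVecCLM (coefA J q w ν z y) =
        mulVecCLM ((ν.real {y} / 2) • coefA J q w ν z y) := by
      ext v : 1
      simp [Matrix.smul_mulVec]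
    rw [h4, h3]
    ext v : 1
    simp only [sub_apply, one_apply_eq_self, mulVecCLM_apply]
    rw [mul_add, h, Matrix.add_mulVec, Matrix.one_mulVec, Matrix.mul_smul,
        ← neg_sub (z • w.val {y}),
      mul_neg, smul_neg, Matrix.neg_mulVec, sub_eq_add_neg]
  rw [h2]
  exact isUnit_mulVecCLM (h1.mul hB)

theorem real_restrict_singleton {S : Set ℝ} (y : ℝ) (hy : y ∈ S) :
    (ν.restrict S).real {y} = ν.real {y} := by
  rw [measureReal_def, Measure.restrict_apply (measurableSet_singleton y),
    singleton_inter_of_mem hy, measureReal_def]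

theorem real_restrict_singleton_of_notMem {S : Set ℝ} (y : ℝ) (hy : y ∉ S) :
    (ν.restrict S).real {y} = 0 := by
  rw [measureReal_def, Measure.restrict_apply (measurableSet_singleton y),
    singleton_inter_eq_empty.2 hy]
  simp

/-- Existence for the integrated equation, if the right limits at the points of a finite set `D`
are prescribed and the equation is not imposed there. -/
theorem exists_solution_off_finite [IsFiniteMeasure ν] (hJ : IsUnit J) (hq : q.ref ≪ ν)
    (hw : w.ref ≪ ν) (hf : Integrable (fun y => w.densWrt ν y *ᵥ f y) ν) {D : Set ℝ}
    (hD : D.Finite) (hDS : D ⊆ ival c d) (hνD : ∀ y ∈ D, ν.real {y} ≠ 0)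
    (hB : ∀ y ∈ ival c d, y ∉ D → IsUnit (J + (1 / 2 : ℂ) • (q.val {y} - z • w.val {y})))
    (ξ : Fin n → ℂ) (ζ : ℝ → Fin n → ℂ) :
    ∃ u G : ℝ → Fin n → ℂ, (∀ y, y ∉ ival c d → u y = 0) ∧ IntegrableOn G (ival c d) ν ∧
      (∀ y ∈ ival c d, u y = bal (ν.restrict (ival c d)) ξ G y) ∧
      (∀ y ∈ ival c d, y ∉ D → G y = rhs J q w ν z f u y) ∧
      ∀ y ∈ D, ξ + ∫ s in Iic y, G s ∂ν.restrict (ival c d) = ζ y := by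
  obtain ⟨G, hGi, hG, hGD⟩ := exists_bal_eq (μ := ν.restrict (ival c d))
    (A := fun y => mulVecCLM (coefA J q w ν z y)) (integrable_coefA hq hw).integrableOn
    (g := fun y => J⁻¹ *ᵥ (w.densWrt ν y *ᵥ f y)) (integrable_mulVec hf J⁻¹).integrableOn hD
    (fun y hy => by rw [real_restrict_singleton y (hDS hy)]; exact hνD y hy)
    (fun y hy => by
      by_cases hyS : y ∈ ival c d
      · rw [real_restrict_singleton y hyS]
        exact isUnit_one_sub_mulVecCLM_coefA hJ hq hw (hB y hyS hy)
      · rw [real_restrict_singleton_of_notMem y hyS]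
        simp) ξ ζ
  refine ⟨(ival c d).indicator (bal (ν.restrict (ival c d)) ξ G), G,
    fun y hy => indicator_of_notMem hy _, hGi, fun y hy => indicator_of_mem hy _,
    fun y hy hyD => ?_, fun y hy => ?_⟩
  · rw [hG y hyD, rhs, indicator_of_mem hy]
    rfl
  · rw [setIntegral_Iic_eq hGi, ← add_assoc]
    exact hGD y hy

theorem bal_sub {E : Type*} [NormedAddCommGroup E] [NormedSpace ℝ E] {μ : Measure ℝ}
    {G H : ℝ → E} (hG : Integrable G μ) (hH : Integrable H μ) (ξ η : E) (t : ℝ) :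
    bal μ (ξ - η) (fun y => G y - H y) t = bal μ ξ G t - bal μ η H t := by
  simp only [bal]
  rw [integral_sub hG.integrableOn hH.integrableOn]
  module

theorem rightLim_bal_eq [IsFiniteMeasure ν] {G : ℝ → Fin n → ℂ} {ξ : Fin n → ℂ}
    (hG : IntegrableOn G (ival c d) ν)
    (hu : ∀ t ∈ ival c d, u t = bal (ν.restrict (ival c d)) ξ G t) {y : ℝ} (hy : y ∈ ival c d) :
    Tendsto u (𝓝[>] y) (𝓝 (ξ + ∫ s in Iic y, G s ∂ν.restrict (ival c d))) := by
  refine (tendsto_bal_right hG ξ y).congr' ?_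
  filter_upwards [nhdsWithin_le_nhds ((isOpen_ival c d).mem_nhds hy)] with t ht using (hu t ht).symm

theorem tendsto_rightNhds_of_eq_bal [IsFiniteMeasure ν] (hcd : c < d) {G : ℝ → Fin n → ℂ}
    {ξ : Fin n → ℂ} (hG : IntegrableOn G (ival c d) ν)
    (hu : ∀ t ∈ ival c d, u t = bal (ν.restrict (ival c d)) ξ G t) :
    Tendsto u (rightNhds c) (𝓝 ξ) := by
  refine (tendsto_bal_rightNhds hG ξ).congr' ?_
  filter_upwards [ival_mem_rightNhds hcd] with t ht using (hu t ht).symm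

theorem tendsto_leftNhds_of_eq_bal [IsFiniteMeasure ν] (hcd : c < d) {G : ℝ → Fin n → ℂ}
    {ξ : Fin n → ℂ} (hG : IntegrableOn G (ival c d) ν)
    (hu : ∀ t ∈ ival c d, u t = bal (ν.restrict (ival c d)) ξ G t) :
    Tendsto u (leftNhds d) (𝓝 (ξ + ∫ s in ival c d, G s ∂ν)) := by
  refine (tendsto_bal_leftNhds hG ξ).congr' ?_
  filter_upwards [ival_mem_leftNhds hcd] with t ht using (hu t ht).symm

/-- A solution is determined by its right limits at the left endpoint and at the points at which
`B₊` is singular. -/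
theorem IsSolution.eq_of_tendsto [IsFiniteMeasure ν] (hJ : IsUnit J) (hq : q.ref ≪ ν)
    (hw : w.ref ≪ ν) (hf : Integrable (fun y => w.densWrt ν y *ᵥ f y) ν) (hcd : c < d) {D : Set ℝ}
    (hD : D.Finite) (hDS : D ⊆ ival c d) (hνD : ∀ y ∈ D, ν.real {y} ≠ 0)
    (hB : ∀ y ∈ ival c d, y ∉ D → IsUnit (J + (1 / 2 : ℂ) • (q.val {y} - z • w.val {y})))
    {u v : ℝ → Fin n → ℂ} (hu : IsSolution J q w z f (ival c d) u)
    (hv : IsSolution J q w z f (ival c d) v) {ξ : Fin n → ℂ}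
    (huξ : Tendsto u (rightNhds c) (𝓝 ξ)) (hvξ : Tendsto v (rightNhds c) (𝓝 ξ)) {ζ : ℝ → Fin n → ℂ}
    (huD : ∀ y ∈ D, Tendsto u (𝓝[>] y) (𝓝 (ζ y))) (hvD : ∀ y ∈ D, Tendsto v (𝓝[>] y) (𝓝 (ζ y))) :
    u = v := by
  obtain ⟨hu0, hui, ξ₁, hu1⟩ := (isSolution_iff hJ hq hw hf hcd).1 hu
  obtain ⟨hv0, hvi, ξ₂, hv1⟩ := (isSolution_iff hJ hq hw hf hcd).1 hv
  have := rightNhds_neBot hcd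
  obtain rfl : ξ = ξ₁ := tendsto_nhds_unique huξ (tendsto_rightNhds_of_eq_bal hcd hui hu1)
  obtain rfl : ξ = ξ₂ := tendsto_nhds_unique hvξ (tendsto_rightNhds_of_eq_bal hcd hvi hv1)
  ext1 y
  by_cases hy : y ∈ ival c d
  swap
  · rw [hu0 y hy, hv0 y hy]
  have hsub : ∀ t, bal (ν.restrict (ival c d)) 0
      (fun y => rhs J q w ν z f u y - rhs J q w ν z f v y) t =
      bal (ν.restrict (ival c d)) ξ (rhs J q w ν z f u) t -
        bal (ν.restrict (ival c d)) ξ (rhs J q w ν z f v) t := fun t => by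
    rw [← bal_sub hui hvi, sub_self]
  -- The difference of the two solutions solves the homogeneous integrated equation, starts at 0,
  -- and has right limit 0 at each point of D.
  have key := bal_zero_eq_zero (measurableSet_ival c d)
    (A := fun y => mulVecCLM (coefA J q w ν z y)) (integrable_coefA hq hw).integrableOn hD hνD
    (fun y hy hyD => isUnit_one_sub_mulVecCLM_coefA hJ hq hw (hB y hy hyD))
    (G := fun y => rhs J q w ν z f u y - rhs J q w ν z f v y) (hui.sub hvi)
    (fun y hy _ => by
      rw [hsub, ← hu1 y hy, ← hv1 y hy, mulVecCLM_apply, Matrix.mulVec_sub, rhs, rhs,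
        add_sub_add_right_eq_sub])
    (fun y hy => by
      have e1 := tendsto_nhds_unique (huD y hy) (rightLim_bal_eq hui hu1 (hDS hy))
      have e2 := tendsto_nhds_unique (hvD y hy) (rightLim_bal_eq hvi hv1 (hDS hy))
      rw [setIntegral_Iic_eq hui, real_restrict_singleton y (hDS hy)] at e1
      rw [setIntegral_Iic_eq hvi, real_restrict_singleton y (hDS hy)] at e2
      rw [integral_sub hui.integrableOn hvi.integrableOn, smul_sub]
      have e3 := e1.symm.trans e2
      rw [add_right_inj] at e3
      rw [sub_add_sub_comm, e3, sub_self]) y hy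
  rw [hsub, ← hu1 y hy, ← hv1 y hy] at key
  exact sub_eq_zero.1 key

end Solvability

/-! ### Lagrange's identity -/

section Lagrange

variable {n : ℕ} {J : Matrix (Fin n) (Fin n) ℂ} {q w : MatMeasure n} {ν : Measure ℝ} {z : ℂ}
  {f u : ℝ → Fin n → ℂ} {c d : EReal}

theorem star_mulVec_dotProduct_of_isHermitian {M : Matrix (Fin n) (Fin n) ℂ} (hM : M.IsHermitian)
    (x y : Fin n → ℂ) : star (M *ᵥ x) ⬝ᵥ y = star x ⬝ᵥ (M *ᵥ y) := by
  rw [Matrix.star_mulVec, hM.eq, Matrix.dotProduct_mulVec]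

theorem bal_apply {μ : Measure ℝ} {G : ℝ → Fin n → ℂ} (hG : Integrable G μ) (ξ : Fin n → ℂ) (t : ℝ)
    (i : Fin n) : bal μ ξ G t i = bal μ (ξ i) (fun y => G y i) t := by
  simp only [bal, Pi.add_apply, Pi.smul_apply]
  rw [eval_integral fun i => hG.integrableOn.eval i]

theorem bal_star {μ : Measure ℝ} (G : ℝ → ℂ) (ξ : ℂ) (t : ℝ) :
    bal μ (star ξ) (fun y => star (G y)) t = star (bal μ ξ G t) := by
  simp only [bal, star_add]
  have : ∫ s in Iio t, star (G s) ∂μ = star (∫ s in Iio t, G s ∂μ) := integral_conj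
  rw [this]
  simp

/-- The product rule for `v* J u`. -/
theorem integral_star_dotProduct_mulVec {μ : Measure ℝ} [IsFiniteMeasure μ] {G H : ℝ → Fin n → ℂ}
    (hG : Integrable G μ) (hH : Integrable H μ) (ξ η : Fin n → ℂ) (J : Matrix (Fin n) (Fin n) ℂ) :
    ∫ y, (star (bal μ η H y) ⬝ᵥ (J *ᵥ G y) + star (H y) ⬝ᵥ (J *ᵥ bal μ ξ G y)) ∂μ =
      star (η + ∫ y, H y ∂μ) ⬝ᵥ (J *ᵥ (ξ + ∫ y, G y ∂μ)) - star η ⬝ᵥ (J *ᵥ ξ) := by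
  have hexp : ∀ x y : Fin n → ℂ, star x ⬝ᵥ (J *ᵥ y) = ∑ i, ∑ k, J i k * (star (x i) * y k) :=
    fun x y => by
      simp only [dotProduct, Matrix.mulVec, Finset.mul_sum, Pi.star_apply]
      exact Finset.sum_congr rfl fun i _ => Finset.sum_congr rfl fun k _ => by ring
  have hHs : ∀ i, Integrable (fun y => star (H y i)) μ := fun i =>
    Complex.conjCLE.integrable_comp_iff.2 (hH.eval i)
  have key : ∀ i k, Integrable (fun y => star (bal μ η H y i) * G y k +
      star (H y i) * bal μ ξ G y k) μ ∧
      ∫ y, (star (bal μ η H y i) * G y k + star (H y i) * bal μ ξ G y k) ∂μ =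
      star (η i + ∫ y, H y i ∂μ) * (ξ k + ∫ y, G y k ∂μ) - star (η i) * ξ k := by
    intro i k
    have h1 := integral_mul_bal_add_bal_mul (hHs i) (hG.eval k) (star (η i)) (ξ k)
    have e1 : ∀ y, star (bal μ η H y i) = bal μ (star (η i)) (fun y => star (H y i)) y := 
        fun y => by
      rw [bal_apply hH, bal_star]
    have e2 : ∀ y, bal μ ξ G y k = bal μ (ξ k) (fun y => G y k) y := fun y => bal_apply hG ξ y k
    have e3 : ∫ y, star (H y i) ∂μ = star (∫ y, H y i ∂μ) := integral_conj
    have hbd : ∀ (ζ : ℂ) {K : ℝ → ℂ}, Integrable K μ →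
        ∀ y, ‖bal μ ζ K y‖ ≤ ‖ζ‖ + ∫ y, ‖K y‖ ∂μ := fun ζ K hK y => by
      have := norm_bal_zero_le hK y
      have e : bal μ ζ K y = ζ + bal μ 0 K y := by simp only [bal]; ring
      rw [e]
      exact (norm_add_le _ _).trans (add_le_add le_rfl this)
    constructor
    · simp only [e1, e2]
      refine Integrable.add ?_ ?_
      · exact (hG.eval k).bdd_mul (aestronglyMeasurable_bal (hHs i) _ μ)
          (Eventually.of_forall (hbd _ (hHs i)))
      · exact (hHs i).mul_bdd (aestronglyMeasurable_bal (hG.eval k) _ μ)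
          (Eventually.of_forall (hbd _ (hG.eval k)))
    · simp only [e1, e2]
      rw [h1, e3, star_add]
  simp only [hexp]
  have e4 : ∀ y, (∑ i, ∑ k, J i k * (star (bal μ η H y i) * G y k) +
      ∑ i, ∑ k, J i k * (star (H y i) * bal μ ξ G y k)) =
      ∑ i, ∑ k, J i k * (star (bal μ η H y i) * G y k + star (H y i) * bal μ ξ G y k) := fun y => by
    simp only [mul_add, Finset.sum_add_distrib]
  simp only [e4]
  have i1 : ∀ i k, Integrable (fun y => J i k * (star (bal μ η H y i) * G y k +
      star (H y i) * bal μ ξ G y k)) μ := fun i k => (key i k).1.const_mul _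
  have i2 : ∀ i, Integrable (fun y => ∑ k, J i k * (star (bal μ η H y i) * G y k +
      star (H y i) * bal μ ξ G y k)) μ := fun i => integrable_finsetSum _ fun k _ => i1 i k
  rw [integral_finsetSum _ fun i _ => i2 i, ← Finset.sum_sub_distrib]
  refine Finset.sum_congr rfl fun i _ => ?_
  rw [integral_finsetSum _ fun k _ => i1 i k, ← Finset.sum_sub_distrib]
  refine Finset.sum_congr rfl fun k _ => ?_
  rw [integral_const_mul, (key i k).2]
  simp only [Pi.add_apply]
  rw [eval_integral fun i => hH.eval i, eval_integral fun i => hG.eval i]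
  ring

/-- Lagrange's identity. -/
theorem lagrange_identity [IsFiniteMeasure ν] (hJ : IsUnit J) (hJs : Jᴴ = -J)
    (hqH : ∀ᵐ y ∂ν, (q.densWrt ν y).IsHermitian) (hwH : ∀ᵐ y ∂ν, (w.densWrt ν y).IsHermitian)
    {v : ℝ → Fin n → ℂ} {ξ η : Fin n → ℂ}
    (hui : IntegrableOn (rhs J q w ν z f u) (ival c d) ν)
    (hu : ∀ t ∈ ival c d, u t = bal (ν.restrict (ival c d)) ξ (rhs J q w ν z f u) t)
    (hvi : IntegrableOn (rhs J q w ν (conj z) 0 v) (ival c d) ν)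
    (hv : ∀ t ∈ ival c d, v t = bal (ν.restrict (ival c d)) η (rhs J q w ν (conj z) 0 v) t) :
    star (η + ∫ y in ival c d, rhs J q w ν (conj z) 0 v y ∂ν) ⬝ᵥ
        (J *ᵥ (ξ + ∫ y in ival c d, rhs J q w ν z f u y ∂ν)) =
      star η ⬝ᵥ (J *ᵥ ξ) + ∫ y in ival c d, star (v y) ⬝ᵥ (w.densWrt ν y *ᵥ f y) ∂ν := by
  rw [← sub_eq_iff_eq_add', ← integral_star_dotProduct_mulVec hui hvi]
  refine integral_congr_ae ?_
  filter_upwards [ae_restrict_of_ae hqH, ae_restrict_of_ae hwH,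
    ae_restrict_mem (measurableSet_ival c d)] with y hqy hwy hy
  rw [← hu y hy, ← hv y hy, mulVec_rhs hJ]
  -- As J is skew-Hermitian, v′*Ju = −(Jv′)*u. Inserting both equations, the q-terms cancel since q
  -- is Hermitian, and the w-terms cancel since v belongs to z̄; only v*wf survives.
  have h1 : star (rhs J q w ν (conj z) 0 v y) ⬝ᵥ (J *ᵥ u y) =
      -(star (J *ᵥ rhs J q w ν (conj z) 0 v y) ⬝ᵥ u y) := by
    rw [Matrix.star_mulVec, hJs, Matrix.vecMul_neg, neg_dotProduct, neg_neg,
      Matrix.dotProduct_mulVec]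
  rw [h1, mulVec_rhs hJ]
  simp only [Pi.zero_apply, Matrix.mulVec_zero, add_zero, star_sub, star_smul, sub_dotProduct,
    smul_dotProduct, star_mulVec_dotProduct_of_isHermitian hqy,
    star_mulVec_dotProduct_of_isHermitian hwy, dotProduct_add, dotProduct_sub, dotProduct_smul]
  simp
  ring

end Lagrange

/-! ### Fundamental matrices and variation of constants -/

section Fundamental

variable {n : ℕ} {J : Matrix (Fin n) (Fin n) ℂ} {q w : MatMeasure n} {ν : Measure ℝ} {z : ℂ}
  {f u : ℝ → Fin n → ℂ} {c d : EReal} {U V : ℝ → Matrix (Fin n) (Fin n) ℂ}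
  {Ud Vd : Matrix (Fin n) (Fin n) ℂ}

/-- `U` is the fundamental matrix on `(c, d)` with limit `1` at `c`. -/
def IsFundamentalOn (J : Matrix (Fin n) (Fin n) ℂ) (q w : MatMeasure n) (z : ℂ) (c d : EReal)
    (U : ℝ → Matrix (Fin n) (Fin n) ℂ) : Prop :=
  (∀ l, IsSolution J q w z 0 (ival c d) fun y i => U y i l) ∧ Tendsto U (rightNhds c) (𝓝 1)

theorem integrable_densWrt_mulVec_zero :
    Integrable (fun y => w.densWrt ν y *ᵥ (0 : ℝ → Fin n → ℂ) y) ν := by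
  simp

/-- The pointwise term at t ∉ S is harmless because the restricted measure has no mass there. -/
theorem bal_restrict_congr {E : Type*} [NormedAddCommGroup E] [NormedSpace ℝ E] {S : Set ℝ}
    (hS : MeasurableSet S) {G H : ℝ → E} (h : ∀ y ∈ S, G y = H y) (ξ : E) (t : ℝ) :
    bal (ν.restrict S) ξ G t = bal (ν.restrict S) ξ H t := by
  have hae : G =ᵐ[ν.restrict S] H := by
    filter_upwards [ae_restrict_mem hS] with y hy using h y hy
  rw [bal, bal, integral_congr_ae (ae_restrict_of_ae hae)]
  by_cases ht : t ∈ S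
  · rw [h t ht]
  · rw [real_restrict_singleton_of_notMem t ht, zero_div, zero_smul, zero_smul]

/-- Each column is the homogeneous solution starting at a unit vector, obtained with an empty
exceptional set. -/
theorem exists_isFundamentalOn [IsFiniteMeasure ν] (hJ : IsUnit J) (hq : q.ref ≪ ν)
    (hw : w.ref ≪ ν) (hcd : c < d)
    (hB : ∀ y ∈ ival c d, IsUnit (J + (1 / 2 : ℂ) • (q.val {y} - z • w.val {y}))) :
    ∃ U, IsFundamentalOn J q w z c d U := by
  have h : ∀ l : Fin n, ∃ u, IsSolution J q w z 0 (ival c d) u ∧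
      Tendsto u (rightNhds c) (𝓝 (Pi.single l 1)) := fun l => by
    obtain ⟨u, G, h0, hGi, hu, hG, -⟩ := exists_solution_off_finite (D := ∅) (c := c) (d := d) hJ hq
      hw (integrable_densWrt_mulVec_zero (w := w) (ν := ν)) finite_empty (empty_subset _)
      (by simp) (fun y hy _ => hB y hy) (Pi.single l 1) 0
    have hG' : ∀ y ∈ ival c d, G y = rhs J q w ν z 0 u y := fun y hy => hG y hy (notMem_empty y)
    exact ⟨u, (isSolution_iff hJ hq hw integrable_densWrt_mulVec_zero hcd).2
      ⟨h0, hGi.congr_fun hG' (measurableSet_ival c d), Pi.single l 1, fun t ht => (hu t ht).trans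
        (bal_restrict_congr (measurableSet_ival c d) hG' _ t)⟩,
      tendsto_rightNhds_of_eq_bal hcd hGi hu⟩
  choose u hu hu1 using h
  refine ⟨fun y => Matrix.of fun i l => u l y i, hu, ?_⟩
  refine tendsto_pi_nhds.2 fun i => tendsto_pi_nhds.2 fun l => ?_
  have := (tendsto_pi_nhds.1 (hu1 l)) i
  simpa [Matrix.one_apply, Pi.single_apply] using this

theorem IsFundamentalOn.exists_eq_bal [IsFiniteMeasure ν] (hJ : IsUnit J) (hq : q.ref ≪ ν)
    (hw : w.ref ≪ ν) (hcd : c < d) (hU : IsFundamentalOn J q w z c d U) (l : Fin n) :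
    IntegrableOn (rhs J q w ν z 0 fun y i => U y i l) (ival c d) ν ∧
      ∀ t ∈ ival c d, (fun i => U t i l) =
        bal (ν.restrict (ival c d)) (Pi.single l 1) (rhs J q w ν z 0 fun y i => U y i l) t := by
  obtain ⟨-, h1, ξ, h2⟩ := (isSolution_iff hJ hq hw integrable_densWrt_mulVec_zero hcd).1 (hU.1 l)
  have := rightNhds_neBot hcd
  have h3 : Tendsto (fun y i => U y i l) (rightNhds c) (𝓝 (Pi.single l 1)) := by
    rw [tendsto_pi_nhds]
    intro i
    have := tendsto_pi_nhds.1 (tendsto_pi_nhds.1 hU.2 i) l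
    simpa [Matrix.one_apply, Pi.single_apply] using this
  rw [tendsto_nhds_unique h3 (tendsto_rightNhds_of_eq_bal hcd h1 h2)]
  exact ⟨h1, h2⟩

theorem IsFundamentalOn.tendsto_leftNhds [IsFiniteMeasure ν] (hJ : IsUnit J) (hq : q.ref ≪ ν)
    (hw : w.ref ≪ ν) (hcd : c < d) (hU : IsFundamentalOn J q w z c d U) :
    Tendsto U (leftNhds d) (𝓝 (Matrix.of fun i l => (Pi.single l 1 +
      ∫ y in ival c d, rhs J q w ν z 0 (fun y i => U y i l) y ∂ν : Fin n → ℂ) i)) := by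
  refine tendsto_pi_nhds.2 fun i => tendsto_pi_nhds.2 fun l => ?_
  obtain ⟨h1, h2⟩ := hU.exists_eq_bal (ν := ν) hJ hq hw hcd l
  exact tendsto_pi_nhds.1 (tendsto_leftNhds_of_eq_bal hcd h1 h2) i

theorem integrable_star_dotProduct [IsFiniteMeasure ν] {H : ℝ → Fin n → ℂ} {η : Fin n → ℂ}
    {v g : ℝ → Fin n → ℂ} (hH : IntegrableOn H (ival c d) ν)
    (hv : ∀ t ∈ ival c d, v t = bal (ν.restrict (ival c d)) η H t) (hg : Integrable g ν) :
    IntegrableOn (fun y => star (v y) ⬝ᵥ g y) (ival c d) ν := by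
  have h1 : IntegrableOn (fun y => ∑ i, star (bal (ν.restrict (ival c d)) η H y i) * g y i)
      (ival c d) ν := by
    refine integrable_finsetSum _ fun i _ => ?_
    refine (hg.eval i).integrableOn.bdd_mul (c := ‖η‖ + ∫ y in ival c d, ‖H y‖ ∂ν)
      ?_ (Eventually.of_forall fun y => ?_)
    · have := (aestronglyMeasurable_bal hH η (ν.restrict (ival c d))).aemeasurable
      have h2 := (aemeasurable_pi_iff.1 this i).aestronglyMeasurable
      exact Complex.continuous_conj.comp_aestronglyMeasurable h2
    · rw [norm_star]
      refine (norm_le_pi_norm _ i).trans ?_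
      have e : bal (ν.restrict (ival c d)) η H y = η + bal (ν.restrict (ival c d)) 0 H y := by
        simp only [bal]
        rw [zero_add, add_assoc]
      rw [e]
      exact (norm_add_le _ _).trans (add_le_add le_rfl (norm_bal_zero_le hH y))
  refine h1.congr ?_
  filter_upwards [ae_restrict_mem (measurableSet_ival c d)] with y hy
  rw [hv y hy]
  rfl

/-- Variation of constants, as an identity at the endpoints. -/
theorem IsFundamentalOn.conjTranspose_mulVec [IsFiniteMeasure ν] (hJ : IsUnit J) (hJs : Jᴴ = -J)
    (hq : q.ref ≪ ν) (hw : w.ref ≪ ν)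
    (hqH : ∀ᵐ y ∂ν, (q.densWrt ν y).IsHermitian) (hwH : ∀ᵐ y ∂ν, (w.densWrt ν y).IsHermitian)
    (hf : Integrable (fun y => w.densWrt ν y *ᵥ f y) ν) (hcd : c < d)
    (hV : IsFundamentalOn J q w (conj z) c d V) (hVd : Tendsto V (leftNhds d) (𝓝 Vd))
    {ξ : Fin n → ℂ} (hui : IntegrableOn (rhs J q w ν z f u) (ival c d) ν)
    (hu : ∀ t ∈ ival c d, u t = bal (ν.restrict (ival c d)) ξ (rhs J q w ν z f u) t) :
    Vdᴴ *ᵥ (J *ᵥ (ξ + ∫ y in ival c d, rhs J q w ν z f u y ∂ν)) =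
      J *ᵥ ξ + ∫ y in ival c d, (V y)ᴴ *ᵥ (w.densWrt ν y *ᵥ f y) ∂ν := by
  have := leftNhds_neBot hcd
  ext l
  obtain ⟨h1, h2⟩ := hV.exists_eq_bal (ν := ν) hJ hq hw hcd l
  have key := lagrange_identity hJ hJs hqH hwH hui hu h1 h2
  have e1 : (Pi.single l 1 + ∫ y in ival c d, rhs J q w ν (conj z) 0 (fun y i => V y i l) y ∂ν) =
      fun i => Vd i l := by
    rw [tendsto_nhds_unique hVd (hV.tendsto_leftNhds (ν := ν) hJ hq hw hcd)]
    rfl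
  have e2 : star (Pi.single l 1 : Fin n → ℂ) ⬝ᵥ (J *ᵥ ξ) = (J *ᵥ ξ) l := by
    rw [← Pi.single_star, star_one, single_one_dotProduct]
  rw [e1, e2] at key
  rw [Pi.add_apply, eval_integral fun i => ?_]
  · exact key
  · obtain ⟨h1, h2⟩ := hV.exists_eq_bal (ν := ν) hJ hq hw hcd i
    exact integrable_star_dotProduct h1 h2 hf

/-- The value at the right endpoint in terms of the value at the left endpoint. -/
theorem IsFundamentalOn.add_setIntegral_eq [IsFiniteMeasure ν] (hJ : IsUnit J) (hJs : Jᴴ = -J)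
    (hq : q.ref ≪ ν) (hw : w.ref ≪ ν)
    (hqH : ∀ᵐ y ∂ν, (q.densWrt ν y).IsHermitian) (hwH : ∀ᵐ y ∂ν, (w.densWrt ν y).IsHermitian)
    (hf : Integrable (fun y => w.densWrt ν y *ᵥ f y) ν) (hcd : c < d)
    (hU : IsFundamentalOn J q w z c d U) (hUd : Tendsto U (leftNhds d) (𝓝 Ud))
    (hV : IsFundamentalOn J q w (conj z) c d V)
    {ξ : Fin n → ℂ} (hui : IntegrableOn (rhs J q w ν z f u) (ival c d) ν)
    (hu : ∀ t ∈ ival c d, u t = bal (ν.restrict (ival c d)) ξ (rhs J q w ν z f u) t) :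
    ξ + ∫ y in ival c d, rhs J q w ν z f u y ∂ν =
      Ud *ᵥ (ξ + J⁻¹ *ᵥ ∫ y in ival c d, (V y)ᴴ *ᵥ (w.densWrt ν y *ᵥ f y) ∂ν) := by
  have := leftNhds_neBot hcd
  have hdet := (Matrix.isUnit_iff_isUnit_det J).1 hJ
  have hVd := hV.tendsto_leftNhds (ν := ν) hJ hq hw hcd
  set Vd := Matrix.of fun i l => (Pi.single l 1 +
      ∫ y in ival c d, rhs J q w ν (conj z) 0 (fun y i => V y i l) y ∂ν : Fin n → ℂ) i with hVdef
  -- Variation of constants with f = 0, applied to the columns of U, shows that U_d J⁻¹ inverts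
  -- V_d*J. The same identity for u can then be solved for its value at d.
  have h1 : Vdᴴ * (J * Ud) = J := by
    ext i l
    obtain ⟨h1, h2⟩ := hU.exists_eq_bal (ν := ν) hJ hq hw hcd l
    have h3 := hV.conjTranspose_mulVec hJ hJs hq hw hqH hwH integrable_densWrt_mulVec_zero hcd hVd
      h1 h2
    have e1 : (Pi.single l 1 + ∫ y in ival c d, rhs J q w ν z 0 (fun y i => U y i l) y ∂ν) =
        fun i => Ud i l := by
      rw [tendsto_nhds_unique hUd (hU.tendsto_leftNhds (ν := ν) hJ hq hw hcd)]
      rfl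
    rw [e1] at h3
    have h4 := congrFun h3 i
    simp only [Pi.zero_apply, Matrix.mulVec_zero, integral_zero, add_zero,
      Matrix.mulVec_single_one] at h4
    exact h4
  have h2 : Vdᴴ * J * (Ud * J⁻¹) = 1 := by
    rw [Matrix.mul_assoc, ← Matrix.mul_assoc J, ← Matrix.mul_assoc, h1,
      Matrix.mul_nonsing_inv _ hdet]
  have h3 := mul_eq_one_comm.1 h2
  have h4 := hV.conjTranspose_mulVec hJ hJs hq hw hqH hwH hf hcd hVd hui hu
  rw [Matrix.mulVec_mulVec] at h4
  have h5 := congrArg (fun v => (Ud * J⁻¹) *ᵥ v) h4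
  simp only [Matrix.mulVec_mulVec, h3, Matrix.one_mulVec, Matrix.mulVec_add] at h5
  rw [h5, Matrix.mul_assoc, Matrix.nonsing_inv_mul _ hdet, Matrix.mul_one, Matrix.mulVec_add]
  simp only [Matrix.mulVec_mulVec]

end Fundamental

theorem leftNhds_coe (x : ℝ) : leftNhds (x : EReal) = 𝓝[<] x := by
  rw [leftNhds, nhdsWithin, comap_inf, comap_principal, ← EReal.isEmbedding_coe.nhds_eq_comap,
    nhdsWithin]
  congr 2
  ext y
  simp

/-! ### Restriction of primitives to subintervals -/

section Subinterval

variable {E : Type*} [NormedAddCommGroup E] [NormedSpace ℝ E] {ν : Measure ℝ} {a b c d : EReal}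
  {G : ℝ → E}

theorem measurableSet_coe_le (c : EReal) : MeasurableSet {y : ℝ | (y : EReal) ≤ c} :=
  measurableSet_le measurable_coe_real_ereal measurable_const

/-- The mass on (a, c], including the atom at c, is moved into the initial value, which thereby
becomes the right limit at c. -/
theorem bal_restrict_ival_of_le (hac : a ≤ c) (hdb : d ≤ b) (hG : IntegrableOn G (ival a b) ν)
    (ξ : E) {t : ℝ} (ht : t ∈ ival c d) :
    bal (ν.restrict (ival a b)) ξ G t = bal (ν.restrict (ival c d))
      (ξ + ∫ y in {y : ℝ | (y : EReal) ≤ c}, G y ∂ν.restrict (ival a b)) G t := by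
  have htI : t ∈ ival a b := ⟨hac.trans_lt ht.1, ht.2.trans_le hdb⟩
  have h : Iio t ∩ ival a b = ({y : ℝ | (y : EReal) ≤ c} ∩ ival a b) ∪ (Iio t ∩ ival c d) := by
    ext y
    simp only [mem_inter_iff, mem_Iio, mem_union, mem_ofPred_eq, ival]
    constructor
    · rintro ⟨h1, h2, h3⟩
      rcases le_or_gt (y : EReal) c with h | h
      · exact Or.inl ⟨h, h2, h3⟩
      · exact Or.inr ⟨h1, h, (EReal.coe_lt_coe_iff.2 h1).trans ht.2⟩
    · rintro (⟨h1, h2, h3⟩ | ⟨h1, h2, h3⟩)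
      · exact ⟨EReal.coe_lt_coe_iff.1 (h1.trans_lt ht.1), h2, h3⟩
      · exact ⟨h1, hac.trans_lt h2, h3.trans_le hdb⟩
  have hsub : ival c d ⊆ ival a b := fun y hy => ⟨hac.trans_lt hy.1, hy.2.trans_le hdb⟩
  rw [bal, bal, real_restrict_singleton t htI, real_restrict_singleton t ht,
    Measure.restrict_restrict measurableSet_Iio, Measure.restrict_restrict measurableSet_Iio,
    Measure.restrict_restrict (measurableSet_coe_le c), h, setIntegral_union]
  · simp only [add_assoc]
  · refine Set.disjoint_left.2 fun y hy hy' => ?_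
    exact (hy'.2.1.trans_le hy.1).false
  · exact measurableSet_Iio.inter (measurableSet_ival c d)
  · exact hG.mono_set inter_subset_right
  · exact hG.mono_set (inter_subset_right.trans hsub)

theorem setIntegral_Iio_eq_add {x : ℝ} (hac : a ≤ c) (hcx : c < x) (hxb : (x : EReal) ≤ b)
    (hG : IntegrableOn G (ival a b) ν) :
    ∫ y in Iio x, G y ∂ν.restrict (ival a b) =
      (∫ y in {y : ℝ | (y : EReal) ≤ c}, G y ∂ν.restrict (ival a b)) + ∫ y in ival c x, G y ∂ν := by
  have h : Iio x ∩ ival a b = ({y : ℝ | (y : EReal) ≤ c} ∩ ival a b) ∪ ival c x := by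
    ext y
    simp only [mem_inter_iff, mem_Iio, mem_union, mem_ofPred_eq, ival]
    constructor
    · rintro ⟨h1, h2, h3⟩
      rcases le_or_gt (y : EReal) c with h | h
      · exact Or.inl ⟨h, h2, h3⟩
      · exact Or.inr ⟨h, EReal.coe_lt_coe_iff.2 h1⟩
    · rintro (⟨h1, h2, h3⟩ | ⟨h2, h3⟩)
      · exact ⟨EReal.coe_lt_coe_iff.1 (h1.trans_lt hcx), h2, h3⟩
      · exact ⟨EReal.coe_lt_coe_iff.1 h3, hac.trans_lt h2, h3.trans_le hxb⟩
  have hsub : ival c x ⊆ ival a b := fun y hy => ⟨hac.trans_lt hy.1, hy.2.trans_le hxb⟩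
  rw [Measure.restrict_restrict measurableSet_Iio, Measure.restrict_restrict
    (measurableSet_coe_le c), h, setIntegral_union]
  · refine Set.disjoint_left.2 fun y hy hy' => ?_
    exact (hy'.1.trans_le hy.1).false
  · exact measurableSet_ival c x
  · exact hG.mono_set inter_subset_right
  · exact hG.mono_set hsub

theorem setIntegral_coe_le_left :
    ∫ y in {y : ℝ | (y : EReal) ≤ a}, G y ∂ν.restrict (ival a b) = 0 := by
  have h : {y : ℝ | (y : EReal) ≤ a} ∩ ival a b = ∅ := by
    refine eq_empty_of_forall_notMem fun y hy => ?_
    exact (hy.2.1.trans_le hy.1).false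
  rw [Measure.restrict_restrict (measurableSet_coe_le a), h, setIntegral_empty]

end Subinterval

/-! ### Standing hypotheses and the dominating measure -/

namespace Problem

variable {n N : ℕ} (P : Problem n N)

/-- The standing hypotheses on the data of the problem. -/
structure Admissible : Prop where
  lt : P.a < P.b
  isUnit_J : IsUnit P.J
  conjTranspose_J : P.Jᴴ = -P.J
  orderZero : P.OrderZero
  regularLeft : P.RegularLeft
  regularRight : P.RegularRight
  isHermitian : ∀ E : Set ℝ, MeasurableSet E → (P.q.val E).IsHermitian
  posSemidef : ∀ E : Set ℝ, MeasurableSet E → (P.w.val E).PosSemidef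
  strictMono : StrictMono P.x
  mem : ∀ j, P.x j ∈ P.I

/-- A finite measure dominating `q` and `w` with an atom at each of the points `x_j`. -/
def dom : Measure ℝ := P.q.ref + P.w.ref + ∑ j, Measure.dirac (P.x j)

instance : IsFiniteMeasure P.dom := by unfold dom; infer_instance

theorem q_absolutelyContinuous : P.q.ref ≪ P.dom :=
  Measure.absolutelyContinuous_of_le ((Measure.le_add_right le_rfl).trans
      (Measure.le_add_right le_rfl))

theorem w_absolutelyContinuous : P.w.ref ≪ P.dom :=
  Measure.absolutelyContinuous_of_le ((Measure.le_add_left le_rfl).trans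
      (Measure.le_add_right le_rfl))

/-- The added point masses matter when neither q nor w charges x_j: prescribing a right limit there
requires division by the atom. -/
theorem dom_real_ne_zero (j : Fin N) : P.dom.real {P.x j} ≠ 0 := by
  rw [measureReal_def, ENNReal.toReal_ne_zero]
  refine ⟨fun h => ?_, measure_ne_top _ _⟩
  rw [dom, Measure.add_apply, add_eq_zero, Measure.finsetSum_apply, Finset.sum_eq_zero_iff] at h
  have := h.2 j (Finset.mem_univ j)
  simp at this

/-! ### The cells of the partition -/

section Cells

theorem lend_zero : P.lend 0 = P.a := rfl

theorem lend_succ (j : Fin N) : P.lend j.succ = P.x j := rfl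

theorem rend_castSucc (j : Fin N) : P.rend j.castSucc = P.x j :=
  Fin.snoc_castSucc (α := fun _ => EReal) _ _ j

theorem rend_last : P.rend (Fin.last N) = P.b := Fin.snoc_last (α := fun _ => EReal) _ _

variable {P}

theorem Admissible.le_lend (h : P.Admissible) (j : Fin (N + 1)) : P.a ≤ P.lend j := by
  induction j using Fin.cases with
  | zero => exact le_rfl
  | succ j => exact (h.mem j).1.le

theorem Admissible.rend_le (h : P.Admissible) (j : Fin (N + 1)) : P.rend j ≤ P.b := by
  induction j using Fin.lastCases with
  | last => rw [rend_last]
  | cast j => rw [rend_castSucc]; exact (h.mem j).2.le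

theorem Admissible.lend_lt (h : P.Admissible) (j : Fin (N + 1)) : P.lend j < P.b := by
  induction j using Fin.cases with
  | zero => exact h.lt
  | succ j => exact (h.mem j).2

theorem Admissible.lend_lt_coe_iff (h : P.Admissible) (j : Fin (N + 1)) (k : Fin N) :
    P.lend j < P.x k ↔ j ≤ k.castSucc := by
  induction j using Fin.cases with
  | zero => exact iff_of_true (h.mem k).1 (Fin.zero_le _)
  | succ j => rw [lend_succ, EReal.coe_lt_coe_iff, h.strictMono.lt_iff_lt, Fin.succ_le_castSucc_iff]

theorem Admissible.coe_lt_rend_iff (h : P.Admissible) (j : Fin (N + 1)) (k : Fin N) :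
    P.x k < P.rend j ↔ k.castSucc < j := by
  induction j using Fin.lastCases with
  | last => rw [rend_last]; exact iff_of_true (h.mem k).2 (Fin.castSucc_lt_last k)
  | cast j => rw [rend_castSucc, EReal.coe_lt_coe_iff, h.strictMono.lt_iff_lt,
      Fin.castSucc_lt_castSucc_iff]

theorem Admissible.lend_lt_rend (h : P.Admissible) (j : Fin (N + 1)) : P.lend j < P.rend j := by
  induction j using Fin.lastCases with
  | last => rw [rend_last]; exact h.lend_lt _
  | cast j => rw [rend_castSucc, h.lend_lt_coe_iff]

theorem Admissible.cell_subset (h : P.Admissible) (j : Fin (N + 1)) : P.cell j ⊆ P.I :=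
  fun _ hy => ⟨(h.le_lend j).trans_lt hy.1, hy.2.trans_le (h.rend_le j)⟩

theorem Admissible.notMem_range_of_mem_cell (h : P.Admissible) {j : Fin (N + 1)} {y : ℝ}
    (hy : y ∈ P.cell j) : y ∉ range P.x := by
  rintro ⟨k, rfl⟩
  exact ((h.lend_lt_coe_iff j k).1 hy.1).not_gt ((h.coe_lt_rend_iff j k).1 hy.2)

end Cells

/-! ### Jumps and the matrices B₊ and B₋ -/

section Jumps

variable {P}

theorem Admissible.boundedVariationOn_Q (h : P.Admissible) (i k : Fin n) :
    BoundedVariationOn (fun y => P.Q y i k) P.I := by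
  obtain ⟨c, hc, hl⟩ := h.regularLeft
  obtain ⟨c', hc', hr⟩ := h.regularRight
  exact boundedVariationOn_ival_of_ends (h.orderZero i k).1 hc hc' (hl i k).1 (hr i k).1

theorem Admissible.boundedVariationOn_W (h : P.Admissible) (i k : Fin n) :
    BoundedVariationOn (fun y => P.W y i k) P.I := by
  obtain ⟨c, hc, hl⟩ := h.regularLeft
  obtain ⟨c', hc', hr⟩ := h.regularRight
  exact boundedVariationOn_ival_of_ends (h.orderZero i k).2 hc hc' (hl i k).2 (hr i k).2

theorem val_stieltjes_singleton {F : ℝ → Matrix (Fin n) (Fin n) ℂ} {a b : EReal}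
    (hF : ∀ i k, BoundedVariationOn (fun y => F y i k) (ival a b)) {y : ℝ} (hy : y ∈ ival a b) :
    MatMeasure.val (fun i k => stieltjes (ival a b) fun y => F y i k) {y} =
      Function.rightLim F y - Function.leftLim F y := by
  have hr : Tendsto F (𝓝[>] y) (𝓝 (Matrix.of fun i k => Function.rightLim (fun y => F y i k) y)) :=
    tendsto_pi_nhds.2 fun i => tendsto_pi_nhds.2 fun k => by
      have := (tendsto_limits_of_boundedVariationOn_ival (hF i k) hy).1
      rw [← rightLim_eq_of_tendsto this] at this
      exact this
  have hl : Tendsto F (𝓝[<] y) (𝓝 (Matrix.of fun i k => Function.leftLim (fun y => F y i k) y)) :=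
    tendsto_pi_nhds.2 fun i => tendsto_pi_nhds.2 fun k => by
      have := (tendsto_limits_of_boundedVariationOn_ival (hF i k) hy).2
      rw [← leftLim_eq_of_tendsto this] at this
      exact this
  rw [rightLim_eq_of_tendsto hr, leftLim_eq_of_tendsto hl]
  ext i k
  exact stieltjes_singleton (hF i k) hy

theorem Admissible.val_q_singleton (h : P.Admissible) {y : ℝ} (hy : y ∈ P.I) :
    P.q.val {y} = P.Δq y := val_stieltjes_singleton h.boundedVariationOn_Q hy

theorem Admissible.val_w_singleton (h : P.Admissible) {y : ℝ} (hy : y ∈ P.I) :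
    P.w.val {y} = P.Δw y := val_stieltjes_singleton h.boundedVariationOn_W hy

theorem Admissible.Bplus_eq (h : P.Admissible) {y : ℝ} (hy : y ∈ P.I) (z : ℂ) :
    P.Bplus y z = P.J + (1 / 2 : ℂ) • (P.q.val {y} - z • P.w.val {y}) := by
  rw [Bplus, h.val_q_singleton hy, h.val_w_singleton hy]

theorem Admissible.conjTranspose_Bplus (h : P.Admissible) {y : ℝ} (hy : y ∈ P.I) (z : ℂ) :
    (P.Bplus y (conj z))ᴴ = -P.Bminus y z := by
  have h1 : (P.Δq y)ᴴ = P.Δq y := by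
    rw [← h.val_q_singleton hy]; exact h.isHermitian _ (measurableSet_singleton y)
  have h2 : (P.Δw y)ᴴ = P.Δw y := by
    rw [← h.val_w_singleton hy]; exact (h.posSemidef _ (measurableSet_singleton y)).1
  rw [Bplus, Bminus, Matrix.conjTranspose_add, Matrix.conjTranspose_smul, Matrix.conjTranspose_sub,
    Matrix.conjTranspose_smul, h1, h2, h.conjTranspose_J]
  have e : star (1 / 2 : ℂ) = 1 / 2 := by simp
  have e' : star (conj z) = z := star_star z
  rw [e, e', neg_sub, sub_eq_add_neg _ P.J, add_comm]

/-- Invertibility of B₋ at z is what provides the fundamental matrices at z̄ that occur in the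
integrals I_j. -/
theorem Admissible.isUnit_Bplus_conj (h : P.Admissible) {y : ℝ} (hy : y ∈ P.I) {z : ℂ}
    (hB : IsUnit (P.Bminus y z)) : IsUnit (P.Bplus y (conj z)) := by
  have h1 : IsUnit ((P.Bplus y (conj z))ᴴ) := by
    rw [h.conjTranspose_Bplus hy]; exact hB.neg
  exact (Matrix.isUnit_conjTranspose _).1 h1

end Jumps

end Problem

/-! ### The block system as the equation at the partition points -/

namespace Problem

variable {n N : ℕ} {P : Problem n N} {z : ℂ} {f u G : ℝ → Fin n → ℂ} {ξ : Fin n → ℂ}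

/-- `B₊(·, z)` and `B₋(·, z)` are invertible off the points of the partition. -/
def NonSingular (P : Problem n N) (z : ℂ) : Prop :=
  ∀ y ∈ P.I, y ∉ range P.x → IsUnit (P.Bplus y z) ∧ IsUnit (P.Bminus y z)

theorem Admissible.isUnit_of_nonSingular (h : P.Admissible) (hz : P.NonSingular z) {y : ℝ}
    (hy : y ∈ P.I) (hyx : y ∉ range P.x) :
    IsUnit (P.J + (1 / 2 : ℂ) • (P.q.val {y} - z • P.w.val {y})) := by
  rw [← h.Bplus_eq hy]
  exact (hz y hy hyx).1

theorem isFundamental_U {j : Fin (N + 1)} (h : ∃ V, P.IsFundamental j z V) :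
    P.IsFundamental j z (P.U j z) := by
  rw [U, dif_pos h]
  exact h.choose_spec

theorem Admissible.isFundamental_U (h : P.Admissible) (hz : P.NonSingular z) (j : Fin (N + 1)) :
    IsFundamentalOn P.J P.q P.w z (P.lend j) (P.rend j) (P.U j z) :=
  Problem.isFundamental_U (exists_isFundamentalOn h.isUnit_J P.q_absolutelyContinuous
    P.w_absolutelyContinuous (h.lend_lt_rend j) fun _ hy =>
      h.isUnit_of_nonSingular hz (h.cell_subset j hy) (h.notMem_range_of_mem_cell hy))

theorem Admissible.isFundamental_U_conj (h : P.Admissible) (hz : P.NonSingular z)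
    (j : Fin (N + 1)) :
    IsFundamentalOn P.J P.q P.w (conj z) (P.lend j) (P.rend j) (P.U j (conj z)) :=
  Problem.isFundamental_U (exists_isFundamentalOn h.isUnit_J P.q_absolutelyContinuous
    P.w_absolutelyContinuous (h.lend_lt_rend j) fun y hy => by
      rw [← h.Bplus_eq (h.cell_subset j hy)]
      exact h.isUnit_Bplus_conj (h.cell_subset j hy)
        (hz y (h.cell_subset j hy) (h.notMem_range_of_mem_cell hy)).2)

theorem measurableSet_cell (P : Problem n N) (j : Fin (N + 1)) : MeasurableSet (P.cell j) :=
  measurableSet_ival _ _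

theorem int_eq (f : ℝ → Fin n → ℂ) (z : ℂ) (j : Fin (N + 1)) :
    P.int f z j =
      ∫ y in P.cell j, (P.U j (conj z) y)ᴴ *ᵥ (P.w.densWrt P.dom y *ᵥ f y) ∂P.dom := by
  rw [int, ← setIntegral_rnDeriv_smul P.w_absolutelyContinuous (P.measurableSet_cell j)]
  refine integral_congr_ae (Eventually.of_forall fun y => ?_)
  simp only [MatMeasure.densWrt, Matrix.smul_mulVec, Matrix.mulVec_smul]

theorem Admissible.integrable (h : P.Admissible) (hf : P.w.MemL2 f) :
    Integrable (fun y => P.w.densWrt P.dom y *ᵥ f y) P.dom :=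
  hf.integrable_densWrt_mulVec h.posSemidef P.w_absolutelyContinuous

/-- The right limits at the points `x_j` of `u(t) = ξ + ∫_a^t G`. -/
def limits (P : Problem n N) (ξ : Fin n → ℂ) (G : ℝ → Fin n → ℂ) (j : Fin (N + 1)) : Fin n → ℂ :=
  ξ + ∫ y in {y : ℝ | (y : EReal) ≤ P.lend j}, G y ∂P.dom.restrict P.I

theorem limits_zero : P.limits ξ G 0 = ξ := by
  rw [limits, lend_zero, I, setIntegral_coe_le_left, add_zero]

theorem limits_succ (j : Fin N) :
    P.limits ξ G j.succ = ξ + ∫ y in Iic (P.x j), G y ∂P.dom.restrict P.I := by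
  simp only [limits, lend_succ, EReal.coe_le_coe_iff]
  rfl

theorem Admissible.eq_bal_cell (h : P.Admissible) (hG : IntegrableOn G P.I P.dom)
    (hu : ∀ t ∈ P.I, u t = bal (P.dom.restrict P.I) ξ G t) (j : Fin (N + 1)) :
    ∀ t ∈ P.cell j, u t = bal (P.dom.restrict (P.cell j)) (P.limits ξ G j) G t := fun t ht =>
  (hu t (h.cell_subset j ht)).trans
    (bal_restrict_ival_of_le (h.le_lend j) (h.rend_le j) hG ξ ht)

theorem Admissible.tendsto_limits (h : P.Admissible) (hG : IntegrableOn G P.I P.dom)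
    (hu : ∀ t ∈ P.I, u t = bal (P.dom.restrict P.I) ξ G t) (j : Fin (N + 1)) :
    Tendsto u (rightNhds (P.lend j)) (𝓝 (P.limits ξ G j)) :=
  tendsto_rightNhds_of_eq_bal (h.lend_lt_rend j) (hG.mono_set (h.cell_subset j))
    (h.eq_bal_cell hG hu j)

/-- The left limit at `x_j` in terms of the right limit at the preceding point. -/
theorem Admissible.leftLimit_eq (h : P.Admissible) (hz : P.NonSingular z) (hf : P.w.MemL2 f)
    (hG : IntegrableOn G P.I P.dom) (hu : ∀ t ∈ P.I, u t = bal (P.dom.restrict P.I) ξ G t)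
    (hGu : ∀ y ∈ P.I, y ∉ range P.x → G y = rhs P.J P.q P.w P.dom z f u y) (j : Fin N) :
    ξ + ∫ y in Iio (P.x j), G y ∂P.dom.restrict P.I =
      Function.leftLim (P.U j.castSucc z) (P.x j) *ᵥ
        (P.limits ξ G j.castSucc + P.J⁻¹ *ᵥ P.int f z j.castSucc) := by
  have hcd := h.lend_lt_rend j.castSucc
  have hGc := hG.mono_set (h.cell_subset j.castSucc)
  have huc := h.eq_bal_cell hG hu j.castSucc
  have hGr : ∀ y ∈ P.cell j.castSucc, G y = rhs P.J P.q P.w P.dom z f u y := fun y hy =>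
    hGu y (h.cell_subset _ hy) (h.notMem_range_of_mem_cell hy)
  have hU := h.isFundamental_U hz j.castSucc
  obtain ⟨Ud, hUd⟩ : ∃ Ud, Tendsto (P.U j.castSucc z) (leftNhds (P.rend j.castSucc)) (𝓝 Ud) :=
    ⟨_, hU.tendsto_leftNhds h.isUnit_J P.q_absolutelyContinuous P.w_absolutelyContinuous hcd⟩
  have e : Function.leftLim (P.U j.castSucc z) (P.x j) = Ud := leftLim_eq_of_tendsto (by
    rwa [rend_castSucc, leftNhds_coe] at hUd)
  have key := hU.add_setIntegral_eq h.isUnit_J h.conjTranspose_J P.q_absolutelyContinuous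
    P.w_absolutelyContinuous
    (MatMeasure.ae_isHermitian_densWrt P.q_absolutelyContinuous h.isHermitian)
    (MatMeasure.ae_isHermitian_densWrt P.w_absolutelyContinuous fun E hE => (h.posSemidef E hE).1)
    (h.integrable hf) hcd hUd (h.isFundamental_U_conj hz j.castSucc)
    (hGc.congr_fun hGr (measurableSet_ival _ _))
    (fun t ht => (huc t ht).trans (bal_restrict_congr (measurableSet_ival _ _) hGr _ t))
  rw [int_eq, e]
  refine Eq.trans ?_ key
  rw [I, setIntegral_Iio_eq_add (h.le_lend j.castSucc) (by rwa [rend_castSucc] at hcd)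
      (h.mem j).2.le
    hG, ← add_assoc, ← rend_castSucc]
  congr 1
  exact setIntegral_congr_fun (measurableSet_ival _ _) hGr

theorem blockDiagonal_mulVec (M : Fin N → Matrix (Fin n) (Fin n) ℂ) (v : Fin n × Fin N → ℂ)
    (i : Fin n) (j : Fin N) :
    (Matrix.blockDiagonal M *ᵥ v) (i, j) = (M j *ᵥ fun k => v (k, j)) i := by
  simp only [Matrix.mulVec, dotProduct, Matrix.blockDiagonal_apply, Fintype.sum_prod_type, ite_mul,
    zero_mul, Finset.sum_ite_eq, Finset.mem_univ, if_true]

theorem Etop_mulVec (c : Fin n × Fin (N + 1) → ℂ) (i : Fin n) (j : Fin N) :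
    (Etop n N *ᵥ c) (i, j) = c (i, j.succ) := by
  simp [Matrix.mulVec, dotProduct, Etop]

theorem Ebot_mulVec (c : Fin n × Fin (N + 1) → ℂ) (i : Fin n) (j : Fin N) :
    (Ebot n N *ᵥ c) (i, j) = c (i, j.castSucc) := by
  simp [Matrix.mulVec, dotProduct, Ebot]

theorem bbB_mulVec (c : Fin n × Fin (N + 1) → ℂ) (i : Fin n) (j : Fin N) :
    (P.bbB z *ᵥ c) (i, j) = ((P.Bplus (P.x j) (conj z))ᴴ *ᵥ
      (Function.leftLim (P.U j.castSucc z) (P.x j) *ᵥ fun k => c (k, j.castSucc)) +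
      P.Bplus (P.x j) z *ᵥ fun k => c (k, j.succ)) i := by
  rw [bbB, Matrix.add_mulVec, ← Matrix.mulVec_mulVec, ← Matrix.mulVec_mulVec,
      ← Matrix.mulVec_mulVec,
    calB, calB, calU, Matrix.blockDiagonal_conjTranspose, Pi.add_apply, blockDiagonal_mulVec,
    blockDiagonal_mulVec, Pi.add_apply]
  simp only [blockDiagonal_mulVec, Etop_mulVec, Ebot_mulVec]

theorem calF_apply (hJ : IsUnit P.J) (i : Fin n) (j : Fin N) :
    P.calF f z (i, j) = (P.Δw (P.x j) *ᵥ f (P.x j) - (P.Bplus (P.x j) (conj z))ᴴ *ᵥ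
      (Function.leftLim (P.U j.castSucc z) (P.x j) *ᵥ (P.J⁻¹ *ᵥ P.int f z j.castSucc))) i := by
  have hJi : (P.calJ)⁻¹ = Matrix.blockDiagonal fun _ => P.J⁻¹ := by
    refine Matrix.inv_eq_right_inv ?_
    rw [calJ, ← Matrix.blockDiagonal_mul]
    simp only [Matrix.mul_nonsing_inv _ ((Matrix.isUnit_iff_isUnit_det _).1 hJ)]
    exact Matrix.blockDiagonal_one
  rw [calF, hJi, ← Matrix.mulVec_mulVec, ← Matrix.mulVec_mulVec, calB, calU,
    Matrix.blockDiagonal_conjTranspose, Pi.sub_apply, blockDiagonal_mulVec, Pi.sub_apply]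
  simp only [blockDiagonal_mulVec]
  rfl

/-- The block system says that the equation holds at the points of the partition. -/
theorem Admissible.bbB_mulVec_limits_eq_calF_iff (h : P.Admissible) (hz : P.NonSingular z)
    (hf : P.w.MemL2 f)
    (hG : IntegrableOn G P.I P.dom) (hu : ∀ t ∈ P.I, u t = bal (P.dom.restrict P.I) ξ G t)
    (hGu : ∀ y ∈ P.I, y ∉ range P.x → G y = rhs P.J P.q P.w P.dom z f u y) :
    (P.bbB z *ᵥ fun r => P.limits ξ G r.2 r.1) = P.calF f z ↔
      ∀ j, G (P.x j) = rhs P.J P.q P.w P.dom z f u (P.x j) := by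
  have hrow : (P.bbB z *ᵥ fun r => P.limits ξ G r.2 r.1) = P.calF f z ↔ ∀ j : Fin N,
      (P.Bplus (P.x j) (conj z))ᴴ *ᵥ
        (Function.leftLim (P.U j.castSucc z) (P.x j) *ᵥ P.limits ξ G j.castSucc) +
        P.Bplus (P.x j) z *ᵥ P.limits ξ G j.succ =
      P.Δw (P.x j) *ᵥ f (P.x j) - (P.Bplus (P.x j) (conj z))ᴴ *ᵥ
        (Function.leftLim (P.U j.castSucc z) (P.x j) *ᵥ (P.J⁻¹ *ᵥ P.int f z j.castSucc)) := by
    constructor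
    · intro e j
      ext i
      have := congrFun e (i, j)
      rwa [bbB_mulVec, calF_apply h.isUnit_J] at this
    · intro e
      ext ⟨i, j⟩
      rw [bbB_mulVec, calF_apply h.isUnit_J]
      exact congrFun (e j) i
  rw [hrow]
  refine forall_congr' fun j => ?_
  set x := P.x j with hxdef
  set m := ξ + ∫ y in Iio x, G y ∂P.dom.restrict P.I with hm
  set p := P.limits ξ G j.succ with hp
  set r := P.dom.real {x} with hr
  have hr0 : r ≠ 0 := P.dom_real_ne_zero j
  -- Here m and p are the left and right limits of u at x, and u(x) is their mean.
  have hp1 : p = m + r • G x := by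
    rw [hp, limits_succ, setIntegral_Iic_eq hG, real_restrict_singleton _ (h.mem j), hm, add_assoc]
  have hux : u x = m + (r / 2) • G x := by
    rw [hu x (h.mem j), bal, real_restrict_singleton _ (h.mem j)]
  have hm1 := h.leftLimit_eq hz hf hG hu hGu j
  rw [← hxdef, ← hm, Matrix.mulVec_add] at hm1
  rw [eq_sub_iff_add_eq, add_right_comm, ← Matrix.mulVec_add, ← hm1, h.conjTranspose_Bplus
      (h.mem j)]
  have hq1 : P.Δq x = r • P.q.densWrt P.dom x := by
    rw [← h.val_q_singleton (h.mem j), MatMeasure.real_smul_densWrt P.q_absolutelyContinuous]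
  have hw1 : P.Δw x = r • P.w.densWrt P.dom x := by
    rw [← h.val_w_singleton (h.mem j), MatMeasure.real_smul_densWrt P.w_absolutelyContinuous]
  have hc : ∀ v : Fin n → ℂ, (1 / 2 : ℂ) • v = (1 / 2 : ℝ) • v := smul_half_eq
  -- B₊p − B₋m equals J(p − m) + (Δ_q − zΔ_w)(p + m)/2, that is, J times the jump plus the
  -- coefficient applied to u(x). The residual of the block row is therefore the defect of the
  -- equation at x, scaled by the nonzero atom r.
  have key : -P.Bminus x z *ᵥ m + P.Bplus x z *ᵥ p - P.Δw x *ᵥ f x =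
      r • (P.J *ᵥ (G x - rhs P.J P.q P.w P.dom z f u x)) := by
    rw [Matrix.mulVec_sub, mulVec_rhs h.isUnit_J, Bminus, Bplus, hq1, hw1, hux, hp1]
    simp only [Matrix.neg_mulVec, Matrix.sub_mulVec, Matrix.add_mulVec, Matrix.smul_mulVec, hc,
      Matrix.mulVec_add, Matrix.mulVec_smul, smul_comm z]
    module
  rw [← sub_eq_zero, key, smul_eq_zero_iff_right hr0]
  constructor
  · intro e
    refine mulVec_injective_of_isUnit h.isUnit_J ?_
    rwa [Matrix.mulVec_sub, sub_eq_zero] at e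
  · intro e
    rw [e, sub_self, Matrix.mulVec_zero]

end Problem

/-! ### Linearity of the homogeneous equation -/

section Linearity

variable {n : ℕ} {J : Matrix (Fin n) (Fin n) ℂ} {q w : MatMeasure n} {ν : Measure ℝ} {z : ℂ}
  {c d : EReal} {u v : ℝ → Fin n → ℂ}

theorem bal_add_smul {μ : Measure ℝ} {G H : ℝ → Fin n → ℂ} (hG : Integrable G μ)
    (hH : Integrable H μ) (ξ η : Fin n → ℂ) (k : ℂ) (t : ℝ) :
    bal μ (ξ + k • η) (fun y => G y + k • H y) t = bal μ ξ G t + k • bal μ η H t := by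
  simp only [bal]
  have hk : Integrable (fun y => k • H y) μ := hH.smul k
  rw [integral_add hG.integrableOn hk.integrableOn, integral_smul]
  simp only [smul_add, smul_comm k]
  abel

theorem IsSolution.add_smul [IsFiniteMeasure ν] (hJ : IsUnit J) (hq : q.ref ≪ ν) (hw : w.ref ≪ ν)
    (hcd : c < d) (hu : IsSolution J q w z 0 (ival c d) u)
    (hv : IsSolution J q w z 0 (ival c d) v) (k : ℂ) :
    IsSolution J q w z 0 (ival c d) (u + k • v) := by
  rw [isSolution_iff hJ hq hw integrable_densWrt_mulVec_zero hcd] at hu hv ⊢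
  obtain ⟨hu0, hui, ξ, hu⟩ := hu
  obtain ⟨hv0, hvi, η, hv⟩ := hv
  have e : rhs J q w ν z 0 (u + k • v) = fun y => rhs J q w ν z 0 u y + k • rhs J q w ν z 0 v y :=
      by
    ext1 y
    simp [rhs, Matrix.mulVec_add, Matrix.mulVec_smul]
  refine ⟨fun y hy => by simp [hu0 y hy, hv0 y hy], ?_, ξ + k • η, fun t ht => ?_⟩
  · rw [e]
    exact Integrable.add hui (Integrable.smul k hvi)
  · rw [e, bal_add_smul hui hvi, ← hu t ht, ← hv t ht]
    rfl

theorem isSolution_zero [IsFiniteMeasure ν] (hJ : IsUnit J) (hq : q.ref ≪ ν) (hw : w.ref ≪ ν)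
    (hcd : c < d) : IsSolution J q w z 0 (ival c d) 0 := by
  have e : rhs J q w ν z 0 0 = 0 := by
    ext1 y
    simp [rhs]
  refine (isSolution_iff hJ hq hw integrable_densWrt_mulVec_zero hcd).2
    ⟨fun _ _ => rfl, ?_, 0, fun t _ => ?_⟩
  · rw [e]
    exact integrableOn_zero
  · rw [e]
    simp [bal]

end Linearity

/-! ### Correspondence between solutions and the block system -/

namespace Problem

variable {n N : ℕ} {P : Problem n N} {z : ℂ} {f u v : ℝ → Fin n → ℂ}

theorem Admissible.exists_hasRightLimits (h : P.Admissible) (hz : P.NonSingular z)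
    (hf : P.w.MemL2 f) (hu : P.Solves z f u) :
    ∃ c, P.HasRightLimits u c ∧ P.bbB z *ᵥ c = P.calF f z := by
  obtain ⟨-, hi, ξ, hu⟩ := (isSolution_iff h.isUnit_J P.q_absolutelyContinuous
    P.w_absolutelyContinuous (h.integrable hf) h.lt).1 hu
  exact ⟨fun r => P.limits ξ _ r.2 r.1, h.tendsto_limits hi hu,
    (h.bbB_mulVec_limits_eq_calF_iff hz hf hi hu fun _ _ _ => rfl).2 fun _ => rfl⟩

theorem Admissible.solves_unique (h : P.Admissible) (hz : P.NonSingular z) (hf : P.w.MemL2 f)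
    {c : Fin n × Fin (N + 1) → ℂ} (hu : P.Solves z f u) (huc : P.HasRightLimits u c)
    (hv : P.Solves z f v) (hvc : P.HasRightLimits v c) : u = v := by
  have hζ : ∀ {u : ℝ → Fin n → ℂ}, P.HasRightLimits u c → ∀ y ∈ range P.x, Tendsto u (𝓝[>] y)
      (𝓝 (Function.extend P.x (fun j i => c (i, j.succ)) 0 y)) := fun hu y hy => by
    obtain ⟨j, rfl⟩ := hy
    rw [h.strictMono.injective.extend_apply, ← rightNhds_coe]
    exact hu j.succ
  exact IsSolution.eq_of_tendsto h.isUnit_J P.q_absolutelyContinuous P.w_absolutelyContinuous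
    (h.integrable hf) h.lt (finite_range P.x) (range_subset_iff.2 h.mem)
    (forall_mem_range.2 P.dom_real_ne_zero) (fun y hy hyx => h.isUnit_of_nonSingular hz hy hyx)
    hu hv (huc 0) (hvc 0) (hζ huc) (hζ hvc)

theorem Admissible.exists_solves (h : P.Admissible) (hz : P.NonSingular z) (hf : P.w.MemL2 f)
    {c : Fin n × Fin (N + 1) → ℂ} (hc : P.bbB z *ᵥ c = P.calF f z) :
    ∃ u, P.Solves z f u ∧ P.HasRightLimits u c := by
  obtain ⟨u, G, h0, hGi, hu, hG, hGD⟩ := exists_solution_off_finite (c := P.a) (d := P.b) (z := z)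
    h.isUnit_J
    P.q_absolutelyContinuous P.w_absolutelyContinuous (h.integrable hf) (finite_range P.x)
    (range_subset_iff.2 h.mem) (forall_mem_range.2 P.dom_real_ne_zero)
    (fun y hy hyx => h.isUnit_of_nonSingular hz hy hyx) (fun i => c (i, 0))
    (Function.extend P.x (fun j i => c (i, j.succ)) 0)
  have hlim : ∀ j, P.limits (fun i => c (i, 0)) G j = fun i => c (i, j) := fun j => by
    induction j using Fin.cases with
    | zero => exact limits_zero
    | succ j =>
      rw [limits_succ]
      exact (hGD _ (mem_range_self j)).trans (h.strictMono.injective.extend_apply _ _ j)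
  -- The construction ignored the equation at the partition points; the block system for the
  -- prescribed limits c supplies it.
  have hGx := (h.bbB_mulVec_limits_eq_calF_iff hz hf hGi hu hG).1 (by
    simp only [hlim]
    exact hc)
  have hGI : ∀ y ∈ P.I, G y = rhs P.J P.q P.w P.dom z f u y := fun y hy => by
    by_cases hyx : y ∈ range P.x
    · obtain ⟨j, rfl⟩ := hyx
      exact hGx j
    · exact hG y hy hyx
  refine ⟨u, (isSolution_iff h.isUnit_J P.q_absolutelyContinuous P.w_absolutelyContinuous
    (h.integrable hf) h.lt).2 ⟨h0, hGi.congr_fun hGI (measurableSet_ival _ _), fun i => c (i, 0),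
    fun t ht => (hu t ht).trans (bal_restrict_congr (measurableSet_ival _ _) hGI _ t)⟩, fun j => ?_⟩
  rw [← hlim]
  exact h.tendsto_limits hGi hu j

theorem memL2_zero : P.w.MemL2 (0 : ℝ → Fin n → ℂ) :=
  ⟨aestronglyMeasurable_zero, by simp⟩

theorem calF_zero : P.calF 0 z = 0 := by
  have h1 : P.calR 0 = 0 := by ext r; simp [calR]
  have h2 : P.calI 0 z = 0 := by ext r; simp [calI, int]
  rw [calF, h1, h2, Matrix.mulVec_zero, sub_zero]

theorem Admissible.hasRightLimits_unique (h : P.Admissible) {c c' : Fin n × Fin (N + 1) → ℂ}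
    (hc : P.HasRightLimits u c) (hc' : P.HasRightLimits u c') : c = c' := by
  ext ⟨i, j⟩
  have := rightNhds_neBot (h.lend_lt_rend j)
  exact congrFun (tendsto_nhds_unique (hc j) (hc' j)) i

/-- The space of solutions of the homogeneous equation. -/
def Admissible.solutionSpace (h : P.Admissible) (z : ℂ) : Submodule ℂ (ℝ → Fin n → ℂ) where
  carrier := {u | P.Solves z 0 u}
  zero_mem' := isSolution_zero h.isUnit_J P.q_absolutelyContinuous P.w_absolutelyContinuous h.lt
  add_mem' {u v} hu hv := by
    have := IsSolution.add_smul h.isUnit_J P.q_absolutelyContinuous P.w_absolutelyContinuous h.lt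
      hu hv 1
    rwa [one_smul] at this
  smul_mem' k u hu := by
    have := IsSolution.add_smul h.isUnit_J P.q_absolutelyContinuous P.w_absolutelyContinuous h.lt
      (isSolution_zero h.isUnit_J P.q_absolutelyContinuous P.w_absolutelyContinuous h.lt) hu k
    rwa [zero_add] at this

/-- A solution of the homogeneous equation corresponds to its right limits at the `x_j`. -/
theorem Admissible.nonempty_linearEquiv (h : P.Admissible) (hz : P.NonSingular z) :
    Nonempty (h.solutionSpace z ≃ₗ[ℂ] LinearMap.ker (P.bbB z).mulVecLin) := by
  have hex : ∀ u : h.solutionSpace z, ∃ c : LinearMap.ker (P.bbB z).mulVecLin,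
      P.HasRightLimits u c := fun u => by
    obtain ⟨c, hc, hB⟩ := h.exists_hasRightLimits hz memL2_zero u.2
    exact ⟨⟨c, by rw [LinearMap.mem_ker, Matrix.mulVecLin_apply, hB, calF_zero]⟩, hc⟩
  choose L hL using hex
  -- The map to right limits is linear because limits are unique, injective because a solution is
  -- determined by them, and surjective by the existence part, as the right-hand side vanishes for f
  -- = 0.
  refine ⟨LinearEquiv.ofBijective
    { toFun := L
      map_add' := fun u v => Subtype.ext (h.hasRightLimits_unique (hL (u + v)) fun j =>
        (hL u j).add (hL v j))
      map_smul' := fun k u => Subtype.ext (h.hasRightLimits_unique (hL (k • u)) fun j =>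
        (hL u j).const_smul k) } ⟨fun u v huv => ?_, fun c => ?_⟩⟩
  · have huv : L u = L v := huv
    exact Subtype.ext (h.solves_unique hz memL2_zero u.2 (huv ▸ hL u) v.2 (hL v))
  · obtain ⟨u, hu, hc⟩ := h.exists_solves hz memL2_zero (c := c) (by
      rw [calF_zero]; exact c.2)
    exact ⟨⟨u, hu⟩, Subtype.ext (h.hasRightLimits_unique (hL ⟨u, hu⟩) hc)⟩

theorem finrank_ker_add_rank_bbB :
    Module.finrank ℂ (LinearMap.ker (P.bbB z).mulVecLin) + (P.bbB z).rank = n * (N + 1) := by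
  rw [add_comm, Matrix.rank, LinearMap.finrank_range_add_finrank_ker,
      Module.finrank_fintype_fun_eq_card]
  simp

theorem rank_bbB_le : (P.bbB z).rank ≤ n * N := by
  refine (Matrix.rank_le_card_height _).trans_eq ?_
  simp

end Problem

end MeasureODE

end

theorem theoremT {n N : ℕ} (P : MeasureODE.Problem n N) (hab : P.a < P.b)
    (hJ : IsUnit P.J) (hJskew : P.Jᴴ = -P.J)
    (hQW : P.OrderZero) (ha : P.RegularLeft) (hb : P.RegularRight)
    (hq : ∀ E : Set ℝ, MeasurableSet E → (P.q.val E).IsHermitian)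
    (hw : ∀ E : Set ℝ, MeasurableSet E → (P.w.val E).PosSemidef)
    (hx : StrictMono P.x) (hxI : ∀ j, P.x j ∈ P.I)
    (hΞ : P.Ξ 0 ⊆ Set.range P.x)
    (z : ℂ)
    (hz : ∀ y ∈ P.I, y ∉ Set.range P.x → IsUnit (P.Bplus y z) ∧ IsUnit (P.Bminus y z)) :
    (∀ f : ℝ → Fin n → ℂ, P.w.MemL2 f →
      ((∃ u, P.Solves z f u) ↔ ∃ c, P.bbB z *ᵥ c = P.calF f z) ∧
      (∀ u, P.Solves z f u → ∃ c, P.HasRightLimits u c ∧ P.bbB z *ᵥ c = P.calF f z) ∧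
      (∀ c, P.bbB z *ᵥ c = P.calF f z → ∃! u, P.Solves z f u ∧ P.HasRightLimits u c)) ∧
    ∃ V : Submodule ℂ (ℝ → Fin n → ℂ), (V : Set (ℝ → Fin n → ℂ)) = {u | P.Solves z 0 u} ∧
      Module.Finite ℂ V ∧
      Module.finrank ℂ V + (P.bbB z).rank = n * (N + 1) ∧
      n ≤ Module.finrank ℂ V := by
  have h : P.Admissible := ⟨hab, hJ, hJskew, hQW, ha, hb, hq, hw, hx, hxI⟩
  refine ⟨fun f hf => ⟨⟨fun ⟨u, hu⟩ => ?_, fun ⟨c, hc⟩ => ?_⟩, fun u hu =>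
    h.exists_hasRightLimits hz hf hu, fun c hc => ?_⟩, ?_⟩
  · obtain ⟨c, -, hc⟩ := h.exists_hasRightLimits hz hf hu
    exact ⟨c, hc⟩
  · obtain ⟨u, hu, -⟩ := h.exists_solves hz hf hc
    exact ⟨u, hu⟩
  · obtain ⟨u, hu, huc⟩ := h.exists_solves hz hf hc
    exact ⟨u, ⟨hu, huc⟩, fun v hv => h.solves_unique hz hf hv.1 hv.2 hu huc⟩
  · obtain ⟨e⟩ := h.nonempty_linearEquiv hz
    have hsum := P.finrank_ker_add_rank_bbB (z := z)
    rw [← e.finrank_eq] at hsum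
    refine ⟨h.solutionSpace z, rfl, Module.Finite.equiv e.symm, hsum, ?_⟩
    have := P.rank_bbB_le (z := z)
    rw [mul_add, mul_one] at hsum
    omega
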